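/- Let $n\ge 0$, let $SO_n$ be the special orthogonal group with Lie algebra $\mathfrak{so}_n$, and for $\xi\in\mathfrak{so}_n$ put $\eta_\xi(t)=\exp(t\xi)$, $t\in\mathbb R$. Let $L_{pol}SO_n$ be the group of polynomial loops, i.e. loops $\gamma:\mathbb R/\mathbb Z\to SO_n$ of the form $\gamma=\sum_{k=-N}^{N}c_kz^k$ ($z=e^{2\pi i t}$, $c_k\in M_n(\mathbb C)$, some $N$), with the direct limit topology of its compact subspaces $L_{pol,N}SO_n$ of loops with fixed bound $N$. Let $P_{per}SO_n$ be the set of smooth paths $\alpha:\mathbb R\to SO_n$ with $\alpha(t+1)\alpha(t)^{-1}$ constant, and $P_{pol}SO_n\subseteq P_{per}SO_n$ the set of those of the form $\eta_\xi\gamma$ with $\xi\in\mathfrak{so}_n$, $\gamma\in L_{pol}SO_n$, with the direct limit topology of its compact subspaces $\{\eta_\xi\gamma : |\xi_{ij}|\le N \text{ for all } i,j,\ \gamma\in L_{pol,N}SO_n\}$ (taken in the compact-open topology). Let $\pi:P_{pol}SO_n\to SO_n$, $\pi(\alpha)=\alpha(1)\alpha(0)^{-1}$. **Theorem.** One has $\pi(\eta_\xi\gamma)=\exp\xi$,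 and $\pi$ is a locally trivial principal $L_{pol}SO_n$-bundle for the action $(\alpha\gamma)(t)=\alpha(t)\gamma(t)$: $L_{pol}SO_n$ is a topological group, the action is continuous, it preserves the fibres of $\pi$ and is free and transitive on each of them, and every point of $SO_n$ has an open neighbourhood over which $\pi$ has an equivariant local trivialization. More precisely, let $r\in[-1,1]$ and let $W_r\subseteq SO_n$ be the set of those $h$ with no complex eigenvalue of real part $r$. For $h\in W_r$ let $E_{-1}^r(h)$, respectively $E_r^1(h)$, be the set of real vectors in the sum of the eigenspaces of $h$ in $\mathbb C^n$ for the eigenvalues with real part in $[-1,r]$, respectively $[r,1]$. Let $\log_0$ be the inverse of the exponential map from the set of $X\in\mathfrak{so}_n$ with all eigenvalues in the open interval $(-i\pi,i\pi)$ onto the set of elements of $SO_n$ without eigenvalue $-1$. Call $(J_h)_{h\in U}$, for $U\subseteq W_r$ open in $SO_n$, a smooth family of unitary structures if $h\mapsto J_h\in M_n(\mathbb R)$ is smooth, and for each $h\in U$, $J_h$ restricts to an orthogonal map of $E_{-1}^r(h)$ to itself with square $-1$ and is zero on $E_r^1(h)$. Then: 1. The sets $W_r$, $r\in[-1,1]$,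 cover $SO_n$. For $g\in W_r$, $\mathbb R^n=E_{-1}^r(g)\oplus E_r^1(g)$ is an orthogonal decomposition; the set $W_r(g)$ of those $h\in W_r$ for which the orthogonal projection $E_{-1}^r(h)\to E_{-1}^r(g)$ is an isomorphism is an open neighbourhood of $g$, and there is a smooth family of unitary structures over $W_r(g)$. 2. Let $U\subseteq W_r$ be open in $SO_n$ and $(J_h)_{h\in U}$ a smooth family of unitary structures. For $h\in U$, $\epsilon(h)=h\exp(-\pi J_h)$ does not have eigenvalue $-1$, and $\log_0$ is defined at it. The formula $$\beta(h)(t)=\exp\big(t\log_0(\epsilon(h))\big)\exp(t\pi J_h)$$ is smooth in $(h,t)\in U\times\mathbb R$ and defines a continuous section $\beta:U\to P_{pol}SO_n$ of $\pi$ over $U$; and there is an equivariant local trivialization of $\pi$ over $U$ which maps $\beta(h)$ to $(h,1)$ for every $h\in U$. -/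

import Mathlib

open Matrix Set
open scoped Topology ContDiff

noncomputable section

/-- The special orthogonal group `SO_n`, with the topology of a subspace of the real matrices. -/
abbrev SO (n : ℕ) : Type := Matrix.specialOrthogonalGroup (Fin n) ℝ

theorem SO.coe_inv {n : ℕ} (g : SO n) :
    ((g⁻¹ : SO n) : Matrix (Fin n) (Fin n) ℝ) = (g : Matrix (Fin n) (Fin n) ℝ)ᵀ := rfl

instance SO.isTopologicalGroup (n : ℕ) : IsTopologicalGroup (SO n) where
  continuous_inv := by
    refine continuous_induced_rng.2 ?_
    exact (continuous_subtype_val (p := fun x => x ∈ Matrix.specialOrthogonalGroup (Fin n) ℝ)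
      ).matrix_transpose

/-- A real matrix, regarded as a complex one. -/
def cplx {n : ℕ} (A : Matrix (Fin n) (Fin n) ℝ) : Matrix (Fin n) (Fin n) ℂ :=
  A.map Complex.ofReal

/-- `lam` is a complex eigenvalue of the real matrix `A`. -/
def IsCEigenvalue {n : ℕ} (A : Matrix (Fin n) (Fin n) ℝ) (lam : ℂ) : Prop :=
  Module.End.HasEigenvalue (Matrix.toLin' (cplx A)) lam

/-! ### The polynomial loop group -/

/-- The loop `γ` has the form `∑_{k = -N}^{N} c_k z^k`, where `z = exp (2 π i t)` is the coordinate
on the circle `ℝ / ℤ` and the `c_k` are complex matrices. -/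
def IsLaurent {n : ℕ} (N : ℕ) (γ : C(UnitAddCircle, SO n)) : Prop :=
  ∃ c : ℤ → Matrix (Fin n) (Fin n) ℂ, ∀ z : UnitAddCircle,
    cplx (γ z : Matrix (Fin n) (Fin n) ℝ) = ∑ k ∈ Finset.Icc (-(N : ℤ)) N, fourier k z • c k

theorem IsLaurent.one (n : ℕ) : IsLaurent 0 (1 : C(UnitAddCircle, SO n)) := by
  refine ⟨fun _ => 1, fun z => ?_⟩
  simp [cplx]

theorem IsLaurent.mul {n N M : ℕ} {γ δ : C(UnitAddCircle, SO n)}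
    (hγ : IsLaurent N γ) (hδ : IsLaurent M δ) : IsLaurent (N + M) (γ * δ) := by
  obtain ⟨c, hc⟩ := hγ
  obtain ⟨d, hd⟩ := hδ
  refine ⟨fun m => ∑ p ∈ (Finset.Icc (-(N : ℤ)) N ×ˢ Finset.Icc (-(M : ℤ)) M) with p.1 + p.2 = m,
    c p.1 * d p.2, fun z => ?_⟩
  have h1 : cplx ((γ * δ) z : Matrix (Fin n) (Fin n) ℝ) = cplx (γ z) * cplx (δ z) := by
    simp only [cplx, ContinuousMap.mul_apply, Submonoid.coe_mul]
    exact Matrix.map_mul (f := Complex.ofRealHom)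
  rw [h1, hc, hd, Finset.sum_mul_sum, ← Finset.sum_product',
    ← Finset.sum_fiberwise_of_maps_to (t := Finset.Icc (-((N + M : ℕ) : ℤ)) ((N + M : ℕ) : ℤ))
      (g := fun p : ℤ × ℤ => p.1 + p.2)]
  · refine Finset.sum_congr rfl fun m _ => ?_
    rw [Finset.smul_sum]
    refine Finset.sum_congr rfl fun p hp => ?_
    rw [← (Finset.mem_filter.1 hp).2, fourier_add, smul_mul_smul_comm]
  · intro p hp
    simp only [Finset.mem_product, Finset.mem_Icc] at hp ⊢
    push_cast
    omega

theorem IsLaurent.inv {n N : ℕ} {γ : C(UnitAddCircle, SO n)}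
    (hγ : IsLaurent N γ) : IsLaurent N γ⁻¹ := by
  obtain ⟨c, hc⟩ := hγ
  refine ⟨fun k => (c k)ᵀ, fun z => ?_⟩
  have h1 : cplx ((γ⁻¹) z : Matrix (Fin n) (Fin n) ℝ) = (cplx (γ z))ᵀ := by
    rw [ContinuousMap.inv_apply, SO.coe_inv]
    rfl
  rw [h1, hc, Matrix.transpose_sum]
  simp

/-- The polynomial loops in `SO_n`, as a subgroup of the group of all continuous loops. -/
def polLoops (n : ℕ) : Subgroup C(UnitAddCircle, SO n) where
  carrier := {γ | ∃ N, IsLaurent N γ}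
  mul_mem' := fun ⟨N, hN⟩ ⟨M, hM⟩ => ⟨N + M, hN.mul hM⟩
  one_mem' := ⟨0, IsLaurent.one n⟩
  inv_mem' := fun ⟨N, hN⟩ => ⟨N, hN.inv⟩

/-- The polynomial loop group `L_pol SO_n`. It is a type of its own since it carries the direct limit
topology, not the subspace topology. -/
def LpolSO (n : ℕ) : Type := polLoops n

instance (n : ℕ) : Group (LpolSO n) := inferInstanceAs (Group (polLoops n))

/-- The loop underlying an element of `L_pol SO_n`. -/
def LpolSO.loop {n : ℕ} (γ : LpolSO n) : C(UnitAddCircle, SO n) := γ.1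

/-- The compact space `L_{pol,N} SO_n` of the loops `∑_{|k| ≤ N} c_k z^k`, with the topology of
uniform convergence. -/
abbrev LpolPiece (n N : ℕ) : Type := {γ : C(UnitAddCircle, SO n) // IsLaurent N γ}

def LpolPiece.incl (n N : ℕ) (γ : LpolPiece n N) : LpolSO n := ⟨γ.1, N, γ.2⟩

/-- The direct limit topology: the finest one for which all `L_{pol,N} SO_n → L_pol SO_n` are
continuous. -/
instance (n : ℕ) : TopologicalSpace (LpolSO n) :=
  ⨆ N : ℕ, TopologicalSpace.coinduced (LpolPiece.incl n N) inferInstance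

/-! ### The polynomial path space -/

/-- `P_per SO_n`: the smooth paths `α : ℝ → SO_n` with `α (t + 1) * (α t)⁻¹` constant. -/
def Pper (n : ℕ) : Set C(ℝ, SO n) :=
  {α | (∀ i j, ContDiff ℝ ∞ (fun t : ℝ => (α t : Matrix (Fin n) (Fin n) ℝ) i j)) ∧
    ∃ g : SO n, ∀ t : ℝ, α (t + 1) * (α t)⁻¹ = g}

/-- `α = η_ξ γ`, where `η_ξ t = exp (t ξ)`. -/
def FactorsAs {n : ℕ} (α : C(ℝ, SO n)) (ξ : Matrix (Fin n) (Fin n) ℝ)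
    (γ : C(UnitAddCircle, SO n)) : Prop :=
  ∀ t : ℝ, (α t : Matrix (Fin n) (Fin n) ℝ) =
    NormedSpace.exp (t • ξ) * (γ (t : UnitAddCircle) : Matrix (Fin n) (Fin n) ℝ)

/-- `P_pol SO_n` as a set: the paths in `P_per SO_n` of the form `η_ξ γ` with `ξ` in the Lie algebra
`so_n` of skew-symmetric matrices and `γ` a polynomial loop. -/
def Ppol (n : ℕ) : Set C(ℝ, SO n) :=
  {α | α ∈ Pper n ∧ ∃ ξ ∈ LieAlgebra.Orthogonal.so (Fin n) ℝ, ∃ γ ∈ polLoops n, FactorsAs α ξ γ}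

/-- The product of a path and a loop: `t ↦ α t * γ t`. -/
def mulLoop {n : ℕ} (α : C(ℝ, SO n)) (γ : C(UnitAddCircle, SO n)) : C(ℝ, SO n) :=
  ⟨fun t => α t * γ (t : UnitAddCircle),
    α.continuous.mul (γ.continuous.comp (AddCircle.continuous_mk' 1))⟩

theorem IsLaurent.contDiff {n N : ℕ} {γ : C(UnitAddCircle, SO n)} (hγ : IsLaurent N γ)
    (i j : Fin n) :
    ContDiff ℝ ∞ (fun t : ℝ => (γ (t : UnitAddCircle) : Matrix (Fin n) (Fin n) ℝ) i j) := by
  obtain ⟨c, hc⟩ := hγ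
  have h1 : (fun t : ℝ => (γ (t : UnitAddCircle) : Matrix (Fin n) (Fin n) ℝ) i j) = fun t : ℝ =>
      (∑ k ∈ Finset.Icc (-(N : ℤ)) N,
        Complex.exp (2 * Real.pi * Complex.I * k * t) * c k i j).re := by
    funext t
    have h2 := congrFun (congrFun (hc (t : UnitAddCircle)) i) j
    have h3 := congrArg Complex.re h2
    simpa [cplx, Matrix.sum_apply, fourier_coe_apply] using h3
  rw [h1]
  have h4 : ContDiff ℝ ∞ (fun t : ℝ => ∑ k ∈ Finset.Icc (-(N : ℤ)) N,
      Complex.exp (2 * Real.pi * Complex.I * k * t) * c k i j) := by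
    refine ContDiff.sum fun k _ => ContDiff.mul ?_ contDiff_const
    exact (contDiff_const.mul Complex.ofRealCLM.contDiff).cexp
  exact Complex.reCLM.contDiff.comp h4

theorem mulLoop_mem_Pper {n : ℕ} {α : C(ℝ, SO n)} {γ : C(UnitAddCircle, SO n)}
    (hα : α ∈ Pper n) (hγ : γ ∈ polLoops n) : mulLoop α γ ∈ Pper n := by
  obtain ⟨hs, g, hg⟩ := hα
  obtain ⟨N, hN⟩ := hγ
  refine ⟨?_, g, fun t => ?_⟩
  · intro i j
    have h1 : (fun t : ℝ => (mulLoop α γ t : Matrix (Fin n) (Fin n) ℝ) i j) = fun t : ℝ =>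
        ∑ k, (α t : Matrix (Fin n) (Fin n) ℝ) i k *
          (γ (t : UnitAddCircle) : Matrix (Fin n) (Fin n) ℝ) k j := by
      funext t
      exact Matrix.mul_apply
    rw [h1]
    refine ContDiff.sum fun k _ => ContDiff.mul ?_ (hN.contDiff k j)
    exact hs i k
  · have h1 : ((t + 1 : ℝ) : UnitAddCircle) = (t : UnitAddCircle) := AddCircle.coe_add_period 1 t
    change α (t + 1) * γ ((t + 1 : ℝ) : UnitAddCircle) * (α t * γ (t : UnitAddCircle))⁻¹ = g
    rw [h1, ← hg t]
    group

theorem mulLoop_mem_Ppol {n : ℕ} {α : C(ℝ, SO n)} {γ : C(UnitAddCircle, SO n)}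
    (hα : α ∈ Ppol n) (hγ : γ ∈ polLoops n) : mulLoop α γ ∈ Ppol n := by
  obtain ⟨hp, ξ, hξ, δ, hδ, h⟩ := hα
  refine ⟨mulLoop_mem_Pper hp hγ, ξ, hξ, δ * γ, mul_mem hδ hγ, fun t => ?_⟩
  change (α t : Matrix (Fin n) (Fin n) ℝ) * (γ (t : UnitAddCircle) : Matrix (Fin n) (Fin n) ℝ) =
    NormedSpace.exp (t • ξ) * ((δ (t : UnitAddCircle) : Matrix (Fin n) (Fin n) ℝ) *
      (γ (t : UnitAddCircle) : Matrix (Fin n) (Fin n) ℝ))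
  rw [h t, Matrix.mul_assoc]

/-- The polynomial path space `P_pol SO_n`. -/
@[ext]
structure PpolSO (n : ℕ) where
  path : C(ℝ, SO n)
  mem : path ∈ Ppol n

/-- The compact piece of `P_pol SO_n` of the paths `η_ξ γ` with `γ` in `L_{pol,N} SO_n` and the
entries of `ξ` bounded by `N`, with the compact-open topology (which, by compactness, agrees on it
with the topology of uniform convergence of all derivatives on compact sets, and with the quotient
topology from the pairs `(ξ, γ)`). -/
abbrev PpolPiece (n N : ℕ) : Type :=
  {α : C(ℝ, SO n) // α ∈ Pper n ∧ ∃ ξ ∈ LieAlgebra.Orthogonal.so (Fin n) ℝ,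
    (∀ i j, |ξ i j| ≤ N) ∧ ∃ γ, IsLaurent N γ ∧ FactorsAs α ξ γ}

def PpolPiece.incl (n N : ℕ) (α : PpolPiece n N) : PpolSO n where
  path := α.1
  mem := by
    obtain ⟨hp, ξ, hξ, -, γ, hγ, h⟩ := α.2
    exact ⟨hp, ξ, hξ, γ, ⟨N, hγ⟩, h⟩

/-- The direct limit topology on `P_pol SO_n`, the union of its compact pieces. -/
instance (n : ℕ) : TopologicalSpace (PpolSO n) :=
  ⨆ N : ℕ, TopologicalSpace.coinduced (PpolPiece.incl n N) inferInstance

/-- The right action of `L_pol SO_n` on `P_pol SO_n` by pointwise multiplication. -/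
instance (n : ℕ) : MulAction (LpolSO n)ᵐᵒᵖ (PpolSO n) where
  smul γ α := ⟨mulLoop α.path γ.unop.loop, mulLoop_mem_Ppol α.mem γ.unop.2⟩
  one_smul α := by
    refine PpolSO.ext (ContinuousMap.ext fun t => ?_)
    exact mul_one (α.path t)
  mul_smul γ δ α := by
    refine PpolSO.ext (ContinuousMap.ext fun t => ?_)
    exact (mul_assoc (α.path t) (δ.unop.loop t) (γ.unop.loop t)).symm

/-- The projection `P_pol SO_n → SO_n`, `α ↦ α(1) α(0)⁻¹`. -/
def PpolSO.proj (n : ℕ) (α : PpolSO n) : SO n := α.path 1 * (α.path 0)⁻¹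

/-! ### Principal bundles -/

/-- A local trivialization of `π : P → B` with fibre the group `G`, acting on `P` from the right,
is equivariant if it carries the action to right multiplication on the fibre. -/
def IsEquivariantTrivialization {G P B : Type*} [Group G] [TopologicalSpace G]
    [TopologicalSpace P] [TopologicalSpace B] [MulAction Gᵐᵒᵖ P] {π : P → B}
    (e : Bundle.Trivialization G π) : Prop :=
  ∀ p : P, π p ∈ e.baseSet → ∀ g : G, (e (MulOpposite.op g • p)).2 = (e p).2 * g

/-- `π : P → B` is a locally trivial principal `G`-bundle, `G` acting on `P` from the right. -/
structure IsPrincipalBundle (G : Type*) {P B : Type*} [Group G] [TopologicalSpace G]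
    [TopologicalSpace P] [TopologicalSpace B] [MulAction Gᵐᵒᵖ P] (π : P → B) : Prop where
  isTopologicalGroup : IsTopologicalGroup G
  continuousSMul : ContinuousSMul Gᵐᵒᵖ P
  proj_smul : ∀ (g : G) (p : P), π (MulOpposite.op g • p) = π p
  existsUnique_smul : ∀ p q : P, π p = π q → ∃! g : G, MulOpposite.op g • p = q
  locallyTrivial : ∀ b : B, ∃ e : Bundle.Trivialization G π,
    b ∈ e.baseSet ∧ IsEquivariantTrivialization e

/-! ### Spectral splittings, unitary structures and the logarithm -/

/-- The inclusion `ℝ^n → ℂ^n`. -/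
def vecCplx (n : ℕ) : EuclideanSpace ℝ (Fin n) →ₗ[ℝ] (Fin n → ℂ) :=
  Complex.ofRealCLM.toLinearMap.compLeft (Fin n) ∘ₗ
    (WithLp.linearEquiv 2 ℝ (Fin n → ℝ)).toLinearMap

/-- `E_a^b(h)`: the real vectors in the sum of the eigenspaces, in `ℂ^n`, of `h` for the eigenvalues
with real part in `[a, b]`. -/
def spectralSpace {n : ℕ} (a b : ℝ) (h : SO n) : Submodule ℝ (EuclideanSpace ℝ (Fin n)) :=
  ((⨆ lam ∈ {lam : ℂ | lam.re ∈ Icc a b}, Module.End.eigenspace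
    (Matrix.toLin' (cplx (h : Matrix (Fin n) (Fin n) ℝ))) lam).restrictScalars ℝ).comap (vecCplx n)

/-- `W_r`: the elements of `SO_n` without eigenvalues of real part `r`. -/
def specGap (n : ℕ) (r : ℝ) : Set (SO n) :=
  {h | ∀ lam : ℂ, IsCEigenvalue (h : Matrix (Fin n) (Fin n) ℝ) lam → lam.re ≠ r}

/-- `W_r(g)`: the `h` in `W_r` for which the orthogonal projection `E_{-1}^r(h) → E_{-1}^r(g)` is an
isomorphism. -/
def specGapNear {n : ℕ} (r : ℝ) (g : SO n) : Set (SO n) :=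
  {h | h ∈ specGap n r ∧ Function.Bijective fun v : spectralSpace (-1) r h =>
    (spectralSpace (-1) r g).orthogonalProjectionOnto (v : EuclideanSpace ℝ (Fin n))}

/-- The matrix `J` maps `F` to itself, and is there a unitary structure: an orthogonal map of
square `-1`. -/
def IsUnitaryStructureOn {n : ℕ} (J : Matrix (Fin n) (Fin n) ℝ)
    (F : Submodule ℝ (EuclideanSpace ℝ (Fin n))) : Prop :=
  ∀ v ∈ F, Matrix.toEuclideanLin J v ∈ F ∧ ‖Matrix.toEuclideanLin J v‖ = ‖v‖ ∧
    Matrix.toEuclideanLin J (Matrix.toEuclideanLin J v) = -v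

/-- The points of a subset `U` of `SO_n`, as matrices. -/
def matSet {n : ℕ} (U : Set (SO n)) : Set (Matrix (Fin n) (Fin n) ℝ) :=
  (fun h : SO n => (h : Matrix (Fin n) (Fin n) ℝ)) '' U

section Smooth

-- Any norm would do: it is only used to speak of smooth maps between spaces of matrices.
attribute [local instance] Matrix.normedAddCommGroup Matrix.normedSpace

/-- `f` is smooth on the set `S` of matrices. Where `S` is an open subset of the embedded submanifold
`SO_n`, this is the usual smoothness on the manifold (the Taylor expansion within `S` is not
required to be unique). -/
def MatSmoothOn {n : ℕ} (f : Matrix (Fin n) (Fin n) ℝ → Matrix (Fin n) (Fin n) ℝ)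
    (S : Set (Matrix (Fin n) (Fin n) ℝ)) : Prop :=
  ContDiffOn ℝ ∞ f S

/-- `(h, t) ↦ f h t` is jointly smooth for `h` in `S` and `t` in `ℝ`. -/
def MatPathSmoothOn {n : ℕ} (f : Matrix (Fin n) (Fin n) ℝ → ℝ → Matrix (Fin n) (Fin n) ℝ)
    (S : Set (Matrix (Fin n) (Fin n) ℝ)) : Prop :=
  ContDiffOn ℝ ∞ (fun p : Matrix (Fin n) (Fin n) ℝ × ℝ => f p.1 p.2) (S ×ˢ univ)

end Smooth

/-- `J_h`, for `h` in `U`, is a smoothly varying family of unitary structures on the spaces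
`E_{-1}^r(h)`, each extended by zero to `E_r^1(h)`. -/
structure IsUnitaryFamily {n : ℕ} (r : ℝ) (U : Set (SO n))
    (J : Matrix (Fin n) (Fin n) ℝ → Matrix (Fin n) (Fin n) ℝ) : Prop where
  smooth : MatSmoothOn J (matSet U)
  unitary : ∀ h ∈ U, IsUnitaryStructureOn (J h) (spectralSpace (-1) r h)
  zero : ∀ h ∈ U, ∀ v ∈ spectralSpace r 1 h, Matrix.toEuclideanLin (J h) v = 0

/-- The skew-symmetric matrices with all eigenvalues in the open interval `(-i π, i π)`. -/
def logRange (n : ℕ) : Set (Matrix (Fin n) (Fin n) ℝ) :=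
  {X | X ∈ LieAlgebra.Orthogonal.so (Fin n) ℝ ∧
    ∀ lam : ℂ, IsCEigenvalue X lam → lam.im ∈ Ioo (-Real.pi) Real.pi}

/-- `log_0`: the inverse of the exponential map from `logRange n` onto the elements of `SO_n` without
eigenvalue `-1`. -/
def logZero (n : ℕ) : Matrix (Fin n) (Fin n) ℝ → Matrix (Fin n) (Fin n) ℝ :=
  Function.invFunOn NormedSpace.exp (logRange n)

/-- `ε(h) = h exp(-π J_h)`. -/
def twist {n : ℕ} (J : Matrix (Fin n) (Fin n) ℝ → Matrix (Fin n) (Fin n) ℝ)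
    (h : Matrix (Fin n) (Fin n) ℝ) : Matrix (Fin n) (Fin n) ℝ :=
  h * NormedSpace.exp (-(Real.pi • J h))

/-- `β(h)(t) = exp(t log_0 (ε(h))) exp(t π J_h)`. -/
def sectionPath {n : ℕ} (J : Matrix (Fin n) (Fin n) ℝ → Matrix (Fin n) (Fin n) ℝ)
    (h : Matrix (Fin n) (Fin n) ℝ) (t : ℝ) : Matrix (Fin n) (Fin n) ℝ :=
  NormedSpace.exp (t • logZero n (twist J h)) * NormedSpace.exp (t • (Real.pi • J h))

end

noncomputable section

/-! ### Complexification of real matrices -/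

/-! Two paths with the same projection differ by the loop `α⁻¹ β`, so the fibres are torsors once
this loop is known to be polynomial. For `α = η_ξ γ` and `β = η_ζ δ` with `exp ξ = exp ζ` the point
is that `exp(-tξ) exp(tζ)` is polynomial. By the spectral theorem it is a finite sum of terms
`e^{iwt} c` with real frequencies `w`. It is also 1-periodic, and averaging over integer translates
kills every frequency outside `2πℤ` (`exp_sum_eq_of_periodic`). The remaining frequencies are
bounded in terms of the entries of `ξ` and `ζ`, so the degree of the loop is bounded on each pair of
compact pieces. The same argument shows that `exp` is injective on `logRange`.

The topology is handled by `IsLimitOfPieces`: both spaces are sequential limits of compact spaces,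
and for such limits products commute with the limit. Continuity is thus tested on pieces, where the
topology is the compact-open one. A local section whose values lie in one compact piece then yields
an equivariant trivialization, because division of paths is continuous from two pieces into one
piece of the loop group.

For the sections, let `S` be the symmetric part of `h`. Its eigenvalues are the real parts of those
of `h`, so `h ∈ W_r` means that `S - r` is invertible. The reflection `R_h` (`-1` on the lower
space, `1` on the upper one) is the orthogonal factor in the polar decomposition of `S - r`. This
factor depends smoothly on the matrix, by the inverse function theorem for `X ↦ X²`. Since `exp(±π
J_h) = R_h`, one has `ε(h) = h R_h`, which has no eigenvalue `-1`: the lower eigenvalues are not `1`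
and the upper ones are not `-1`. Hence `det R_h = 1`, the lower space has even dimension, and
unitary structures exist. They are carried from `g` to nearby `h` by the orthogonal part of `1 + R_g
R_h`, which intertwines the two reflections.

Smoothness of `log_0` comes from repeated square roots: the orthogonal part of `1 + A` is a square
root of `A`, closer to `1` by a factor `√2`, and near `1` the inverse function theorem applies.
Finally each `h` has a logarithm `C` with entries bounded in terms of `n`, and `exp(-tC) β(h)(t)` is
a Laurent loop of bounded degree, so `β` takes values in a single compact piece. -/

theorem cplx_mul {n : ℕ} (A B : Matrix (Fin n) (Fin n) ℝ) : cplx (A * B) = cplx A * cplx B :=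
  Matrix.map_mul (f := Complex.ofRealHom)

theorem cplx_one {n : ℕ} : cplx (1 : Matrix (Fin n) (Fin n) ℝ) = 1 := by simp [cplx]

theorem cplx_add {n : ℕ} (A B : Matrix (Fin n) (Fin n) ℝ) : cplx (A + B) = cplx A + cplx B := by
  ext i j; simp [cplx]

theorem cplx_neg {n : ℕ} (A : Matrix (Fin n) (Fin n) ℝ) : cplx (-A) = -cplx A := by
  ext i j; simp [cplx]

theorem cplx_smul {n : ℕ} (t : ℝ) (A : Matrix (Fin n) (Fin n) ℝ) :
    cplx (t • A) = (t : ℂ) • cplx A := by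
  ext i j; simp [cplx]

theorem cplx_conjTranspose {n : ℕ} (A : Matrix (Fin n) (Fin n) ℝ) : (cplx A)ᴴ = cplx Aᵀ := by
  ext i j; simp [cplx]

theorem cplx_injective {n : ℕ} : Function.Injective (cplx (n := n)) := fun A B h => by
  ext i j
  exact Complex.ofReal_injective (congrFun (congrFun h i) j)

theorem cplx_exp {n : ℕ} (A : Matrix (Fin n) (Fin n) ℝ) :
    cplx (NormedSpace.exp A) = NormedSpace.exp (cplx A) := by
  open scoped Matrix.Norms.Operator in
  exact NormedSpace.map_exp (Complex.ofRealHom.mapMatrix (m := Fin n))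
    (continuous_id.matrix_map Complex.continuous_ofReal) A

/-! ### Spectral decomposition of skew-symmetric matrices -/

theorem exists_unitary_conj_diagonal {n : ℕ} {X : Matrix (Fin n) (Fin n) ℝ}
    (hX : X ∈ LieAlgebra.Orthogonal.so (Fin n) ℝ) :
    ∃ U ∈ Matrix.unitaryGroup (Fin n) ℂ, ∃ a : Fin n → ℝ,
      cplx X = U * diagonal (fun k => (a k : ℂ) * Complex.I) * star U := by
  rw [LieAlgebra.Orthogonal.mem_so] at hX
  have hH : ((-Complex.I) • cplx X).IsHermitian := by
    rw [Matrix.IsHermitian, conjTranspose_smul, cplx_conjTranspose, hX, cplx_neg]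
    simp
  refine ⟨hH.eigenvectorUnitary.1, hH.eigenvectorUnitary.2, hH.eigenvalues, ?_⟩
  have h1 := hH.spectral_theorem
  rw [Unitary.conjStarAlgAut_apply] at h1
  have h2 : cplx X = Complex.I • ((-Complex.I) • cplx X) := by
    rw [smul_smul]; simp
  have h3 : diagonal (fun k => (hH.eigenvalues k : ℂ) * Complex.I) =
      Complex.I • diagonal (RCLike.ofReal ∘ hH.eigenvalues : Fin n → ℂ) := by
    rw [← diagonal_smul]
    congr 1
    funext k
    simp [mul_comm]
  refine h2.trans ?_
  rw [h3, mul_smul_comm, smul_mul_assoc]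
  exact congrArg (Complex.I • ·) h1

/-- Spectral decomposition of the one-parameter group generated by a skew-symmetric matrix. -/
theorem exists_exp_decomposition {n : ℕ} {X : Matrix (Fin n) (Fin n) ℝ}
    (hX : X ∈ LieAlgebra.Orthogonal.so (Fin n) ℝ) :
    ∃ (a : Fin n → ℝ) (R : Fin n → Matrix (Fin n) (Fin n) ℂ),
      (∀ k i j, ‖R k i j‖ ≤ 1) ∧ (∀ k, IsCEigenvalue X (a k * Complex.I)) ∧
      cplx X = ∑ k, (a k * Complex.I) • R k ∧
      ∀ t : ℝ, cplx (NormedSpace.exp (t • X)) =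
        ∑ k, Complex.exp (a k * Complex.I * t) • R k := by
  obtain ⟨U, hU, a, hXU⟩ := exists_unitary_conj_diagonal hX
  have hU1 : U * star U = 1 := Unitary.mul_star_self_of_mem hU
  have hU2 : star U * U = 1 := Unitary.star_mul_self_of_mem hU
  have hinv : U⁻¹ = star U := inv_eq_left_inv hU2
  have hbound : ∀ i j, ‖U i j‖ ≤ 1 := entry_norm_bound_of_unitary hU
  -- The rank one projections onto the columns of `U` do not depend on `d`, so the same ones serve
  -- `X` and every `exp(tX)`.
  have hdiag : ∀ d : Fin n → ℂ, U * diagonal d * star U =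
      ∑ k, d k • (Matrix.of fun i j => U i k * star (U j k)) := by
    intro d
    ext i j
    rw [Matrix.sum_apply, Matrix.mul_apply]
    refine Finset.sum_congr rfl fun k _ => ?_
    rw [mul_diagonal]
    simp
    ring
  refine ⟨a, fun k => Matrix.of fun i j => U i k * star (U j k), ?_, ?_, ?_, ?_⟩
  · intro k i j
    change ‖U i k * star (U j k)‖ ≤ 1
    rw [norm_mul, norm_star]
    exact mul_le_one₀ (hbound _ _) (norm_nonneg _) (hbound _ _)
  · intro k
    refine Module.End.hasEigenvalue_of_hasEigenvector (x := fun i => U i k) ⟨?_, ?_⟩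
    · rw [Module.End.mem_eigenspace_iff, toLin'_apply]
      have h1 : cplx X * U = U * diagonal (fun k => (a k : ℂ) * Complex.I) := by
        rw [hXU, Matrix.mul_assoc _ (star U), hU2, Matrix.mul_one]
      funext i
      have h2 := congrFun (congrFun h1 i) k
      rw [mul_diagonal, Matrix.mul_apply] at h2
      rw [mulVec, dotProduct, h2, Pi.smul_apply, smul_eq_mul, mul_comm]
    · intro h0
      have h1 := congrFun (congrFun hU2 k) k
      rw [Matrix.mul_apply] at h1
      have h2 : ∀ j, U j k = 0 := fun j => congrFun h0 j
      simp [h2] at h1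
  · rw [hXU, hdiag]
  · intro t
    have h1 : cplx (t • X) = U * diagonal (fun k => (a k : ℂ) * Complex.I * t) * U⁻¹ := by
      rw [cplx_smul, hXU, hinv, ← smul_mul_assoc, ← mul_smul_comm, ← diagonal_smul]
      congr 3
      funext k
      simp [mul_comm, mul_left_comm]
    rw [cplx_exp, h1, Matrix.exp_conj _ _ (IsUnit.of_mul_eq_one _ hU1), hinv, exp_diagonal, hdiag]
    refine Finset.sum_congr rfl fun k _ => ?_
    rw [Pi.coe_exp, Complex.exp_eq_exp_ℂ]

/-! ### Periodic exponential sums -/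

/-- The geometric sums stay bounded by `2 / ‖w - 1‖`, so their averages decay like `1/K`. -/
theorem tendsto_average_geom {w : ℂ} (hw : ‖w‖ = 1) (hw1 : w ≠ 1) :
    Filter.Tendsto (fun K : ℕ => (K : ℂ)⁻¹ * ∑ m ∈ Finset.range K, w ^ m) Filter.atTop (𝓝 0) := by
  have h0 : w - 1 ≠ 0 := sub_ne_zero.2 hw1
  refine squeeze_zero_norm (a := fun K : ℕ => (K : ℝ)⁻¹ * (2 / ‖w - 1‖)) (fun K => ?_) ?_
  · rw [norm_mul, norm_inv, Complex.norm_natCast, geom_sum_eq hw1, norm_div]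
    gcongr
    calc ‖w ^ K - 1‖ ≤ ‖w ^ K‖ + ‖(1 : ℂ)‖ := norm_sub_le _ _
      _ = 2 := by rw [norm_pow, hw]; norm_num
  · simpa using (tendsto_inv_atTop_nhds_zero_nat (𝕜 := ℝ)).mul_const (2 / ‖w - 1‖)

theorem tendsto_average_one :
    Filter.Tendsto (fun K : ℕ => (K : ℂ)⁻¹ * ∑ m ∈ Finset.range K, (1 : ℂ) ^ m)
      Filter.atTop (𝓝 1) := by
  refine tendsto_const_nhds.congr' ?_
  filter_upwards [Filter.eventually_gt_atTop 0] with K hK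
  have : (K : ℂ) ≠ 0 := by exact_mod_cast hK.ne'
  simp [this]

/-- In a `1`-periodic exponential sum only the terms of period `1` matter. -/
theorem exp_sum_eq_of_periodic {ι : Type*} (s : Finset ι) (a : ι → ℝ) (c : ι → ℂ)
    (hper : ∀ t : ℝ, ∑ i ∈ s, Complex.exp (a i * Complex.I * (t + 1 : ℝ)) * c i =
      ∑ i ∈ s, Complex.exp (a i * Complex.I * t) * c i) (t : ℝ) :
    ∑ i ∈ s, Complex.exp (a i * Complex.I * t) * c i =
      ∑ i ∈ s, if Complex.exp (a i * Complex.I) = 1 then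
        Complex.exp (a i * Complex.I * t) * c i else 0 := by
  have hm : ∀ m : ℕ, ∑ i ∈ s, Complex.exp (a i * Complex.I * (t + m : ℝ)) * c i =
      ∑ i ∈ s, Complex.exp (a i * Complex.I * t) * c i := by
    intro m
    induction m with
    | zero => simp
    | succ m ih =>
      rw [← ih, ← hper (t + m)]
      push_cast
      simp only [add_assoc]
  have hterm : ∀ i, ∀ m : ℕ, Complex.exp (a i * Complex.I * (t + m : ℝ)) =
      Complex.exp (a i * Complex.I) ^ m * Complex.exp (a i * Complex.I * t) := by
    intro i m
    rw [← Complex.exp_nat_mul, ← Complex.exp_add]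
    push_cast
    ring_nf
  obtain ⟨F, hF⟩ : ∃ F, F = ∑ i ∈ s, Complex.exp (a i * Complex.I * t) * c i := ⟨_, rfl⟩
  rw [← hF]
  -- Averaging over the translates by `0, …, K-1` leaves the sum unchanged but multiplies its `i`-th
  -- term by the average of the powers of `e^{i a_i}`, which tends to `1` or to `0`.
  have hav : ∀ᶠ K : ℕ in Filter.atTop, F = ∑ i ∈ s,
      ((K : ℂ)⁻¹ * ∑ m ∈ Finset.range K, Complex.exp (a i * Complex.I) ^ m) *
        (Complex.exp (a i * Complex.I * t) * c i) := by
    filter_upwards [Filter.eventually_gt_atTop 0] with K hK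
    have hK' : (K : ℂ) ≠ 0 := by exact_mod_cast hK.ne'
    have h1 : ∑ m ∈ Finset.range K, F = ∑ i ∈ s, (∑ m ∈ Finset.range K,
        Complex.exp (a i * Complex.I) ^ m) * (Complex.exp (a i * Complex.I * t) * c i) := by
      simp_rw [Finset.sum_mul]
      rw [Finset.sum_comm (s := s)]
      refine Finset.sum_congr rfl fun m _ => ?_
      rw [hF, ← hm m]
      refine Finset.sum_congr rfl fun i _ => ?_
      rw [hterm, mul_assoc]
    simp_rw [mul_assoc (K : ℂ)⁻¹]
    rw [← Finset.mul_sum, ← h1]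
    simp [hK']
  refine tendsto_nhds_unique (tendsto_const_nhds.congr' hav) (tendsto_finsetSum _ fun i _ => ?_)
  split_ifs with h
  · rw [h]
    simpa using tendsto_average_one.mul_const (Complex.exp (a i * Complex.I * t) * c i)
  · have hn : ‖Complex.exp (a i * Complex.I)‖ = 1 := Complex.norm_exp_ofReal_mul_I _
    simpa using (tendsto_average_geom hn h).mul_const (Complex.exp (a i * Complex.I * t) * c i)

/-- Spectral decomposition of a product of three one-parameter groups. -/
theorem exists_exp_mul_decomposition {n : ℕ} {A B C : Matrix (Fin n) (Fin n) ℝ}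
    (hA : A ∈ LieAlgebra.Orthogonal.so (Fin n) ℝ) (hB : B ∈ LieAlgebra.Orthogonal.so (Fin n) ℝ)
    (hC : C ∈ LieAlgebra.Orthogonal.so (Fin n) ℝ) :
    ∃ (w : Fin n × Fin n × Fin n → ℝ) (c : Fin n × Fin n × Fin n → Matrix (Fin n) (Fin n) ℂ),
      (∀ p, ∃ x y z : ℝ, IsCEigenvalue A (x * Complex.I) ∧ IsCEigenvalue B (y * Complex.I) ∧
        IsCEigenvalue C (z * Complex.I) ∧ w p = x + y + z) ∧
      ∀ t : ℝ, cplx (NormedSpace.exp (t • A) * NormedSpace.exp (t • B) * NormedSpace.exp (t • C)) =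
        ∑ p, Complex.exp (w p * Complex.I * t) • c p := by
  obtain ⟨a, P, -, ha, -, hP⟩ := exists_exp_decomposition hA
  obtain ⟨b, Q, -, hb, -, hQ⟩ := exists_exp_decomposition hB
  obtain ⟨c, R, -, hc, -, hR⟩ := exists_exp_decomposition hC
  refine ⟨fun p => a p.1 + b p.2.1 + c p.2.2, fun p => P p.1 * Q p.2.1 * R p.2.2,
    fun p => ⟨_, _, _, ha _, hb _, hc _, rfl⟩, fun t => ?_⟩
  rw [cplx_mul, cplx_mul, hP, hQ, hR, Fintype.sum_prod_type]
  simp_rw [Fintype.sum_prod_type, Finset.sum_mul, Finset.mul_sum]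
  refine Finset.sum_congr rfl fun i _ => ?_
  simp_rw [Finset.sum_mul]
  rw [Finset.sum_comm]
  refine Finset.sum_congr rfl fun j _ => ?_
  refine Finset.sum_congr rfl fun k _ => ?_
  rw [smul_mul_smul_comm, smul_mul_smul_comm, ← Complex.exp_add, ← Complex.exp_add]
  push_cast
  ring_nf

theorem exp_mul_eq_of_periodic {ι : Type*} [Fintype ι] {n : ℕ}
    {Φ : ℝ → Matrix (Fin n) (Fin n) ℝ} {w : ι → ℝ} {c : ι → Matrix (Fin n) (Fin n) ℂ}
    (hΦ : ∀ t : ℝ, cplx (Φ t) = ∑ p, Complex.exp (w p * Complex.I * t) • c p)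
    (hper : ∀ t, Φ (t + 1) = Φ t) (t : ℝ) :
    cplx (Φ t) = ∑ p, if Complex.exp (w p * Complex.I) = 1 then
      Complex.exp (w p * Complex.I * t) • c p else 0 := by
  ext i j
  have h1 : ∀ t : ℝ, cplx (Φ t) i j = ∑ p, Complex.exp (w p * Complex.I * t) * c p i j := by
    intro t
    rw [hΦ, Matrix.sum_apply]
    rfl
  rw [h1, exp_sum_eq_of_periodic Finset.univ w (fun p => c p i j) _ t, Matrix.sum_apply]
  · refine Finset.sum_congr rfl fun p _ => ?_
    split_ifs <;> rfl
  · intro s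
    rw [← h1, ← h1, hper]

theorem exp_mul_I_eq_one_iff {w : ℝ} :
    Complex.exp (w * Complex.I) = 1 ↔ ∃ k : ℤ, w = 2 * Real.pi * k := by
  rw [Complex.exp_eq_one_iff]
  refine exists_congr fun k => ?_
  rw [show (k : ℂ) * (2 * Real.pi * Complex.I) = ((2 * Real.pi * k : ℝ) : ℂ) * Complex.I by
    push_cast; ring, mul_left_inj' Complex.I_ne_zero, Complex.ofReal_inj]

/-- A periodic product of one-parameter groups, with bounded frequencies, is a Laurent loop. -/
theorem isLaurent_of_exp_sum {ι : Type*} [Fintype ι] {n N : ℕ}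
    {Φ : ℝ → Matrix (Fin n) (Fin n) ℝ} {w : ι → ℝ} {c : ι → Matrix (Fin n) (Fin n) ℂ}
    (hΦ : ∀ t : ℝ, cplx (Φ t) = ∑ p, Complex.exp (w p * Complex.I * t) • c p)
    (hper : ∀ t, Φ (t + 1) = Φ t) (hw : ∀ p, |w p| ≤ 2 * Real.pi * N)
    {γ : C(UnitAddCircle, SO n)}
    (hγ : ∀ t : ℝ, (γ (t : UnitAddCircle) : Matrix (Fin n) (Fin n) ℝ) = Φ t) : IsLaurent N γ := by
  -- Several indices may share a frequency, so the `k`-th coefficient collects all terms of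
  -- frequency `2πk`.
  refine ⟨fun k => ∑ p, if w p = 2 * Real.pi * k then c p else 0, fun z => ?_⟩
  induction z using QuotientAddGroup.induction_on with | H t => ?_
  rw [hγ t, exp_mul_eq_of_periodic hΦ hper]
  simp_rw [Finset.smul_sum]
  rw [Finset.sum_comm]
  refine Finset.sum_congr rfl fun p _ => ?_
  split_ifs with h
  · obtain ⟨k, hk⟩ := exp_mul_I_eq_one_iff.1 h
    have hpi : (0 : ℝ) < 2 * Real.pi := by positivity
    have hkN : k ∈ Finset.Icc (-(N : ℤ)) N := by
      have h1 := hw p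
      rw [hk, abs_mul, abs_of_pos hpi, mul_le_mul_iff_right₀ hpi] at h1
      rw [Finset.mem_Icc, ← abs_le]
      exact_mod_cast h1
    rw [Finset.sum_eq_single_of_mem k hkN]
    · rw [if_pos hk]
      change _ = (fourier k (t : UnitAddCircle) : ℂ) • c p
      rw [fourier_coe_apply, hk]
      congr 2
      push_cast
      ring
    · intro m _ hm
      rw [if_neg, smul_zero]
      rw [hk, mul_right_inj' hpi.ne']
      exact_mod_cast hm.symm
  · symm
    refine Finset.sum_eq_zero fun k _ => ?_
    rw [if_neg, smul_zero]
    exact fun hk => h (exp_mul_I_eq_one_iff.2 ⟨k, hk⟩)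

/-! ### Injectivity of the exponential map on `logRange` -/

theorem isCEigenvalue_iff {n : ℕ} {A : Matrix (Fin n) (Fin n) ℝ} {lam : ℂ} :
    IsCEigenvalue A lam ↔ ∃ v : Fin n → ℂ, v ≠ 0 ∧ cplx A *ᵥ v = lam • v := by
  constructor
  · intro h
    obtain ⟨v, hv⟩ := h.exists_hasEigenvector
    exact ⟨v, hv.2, by simpa using hv.apply_eq_smul⟩
  · rintro ⟨v, hv, h⟩
    exact Module.End.hasEigenvalue_of_hasEigenvector
      ⟨Module.End.mem_eigenspace_iff.2 (by simpa using h), hv⟩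

theorem IsCEigenvalue.of_neg {n : ℕ} {A : Matrix (Fin n) (Fin n) ℝ} {lam : ℂ}
    (h : IsCEigenvalue (-A) lam) : IsCEigenvalue A (-lam) := by
  obtain ⟨v, hv, h⟩ := isCEigenvalue_iff.1 h
  refine isCEigenvalue_iff.2 ⟨v, hv, ?_⟩
  rw [cplx_neg, neg_mulVec] at h
  rw [neg_smul, ← h, neg_neg]

theorem IsCEigenvalue.eq_zero {n : ℕ} {lam : ℂ}
    (h : IsCEigenvalue (0 : Matrix (Fin n) (Fin n) ℝ) lam) : lam = 0 := by
  obtain ⟨v, hv, h⟩ := isCEigenvalue_iff.1 h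
  have h0 : cplx (0 : Matrix (Fin n) (Fin n) ℝ) = 0 := by ext i j; simp [cplx]
  rw [h0, zero_mulVec] at h
  exact (smul_eq_zero.1 h.symm).resolve_right hv

theorem exp_smul_mul_exp_smul_neg {n : ℕ} (t : ℝ) (X : Matrix (Fin n) (Fin n) ℝ) :
    NormedSpace.exp (t • X) * NormedSpace.exp (t • -X) = 1 := by
  rw [← Matrix.exp_add_of_commute _ _ (((Commute.refl X).neg_right).smul_left t |>.smul_right t),
    smul_neg, add_neg_cancel, NormedSpace.exp_zero]

theorem exp_add_one_smul {n : ℕ} (t : ℝ) (X : Matrix (Fin n) (Fin n) ℝ) :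
    NormedSpace.exp ((t + 1) • X) = NormedSpace.exp (t • X) * NormedSpace.exp X := by
  rw [add_smul, one_smul, Matrix.exp_add_of_commute _ _ ((Commute.refl X).smul_left t)]

/-- Compare derivatives at `t = 0`. -/
theorem eq_of_exp_smul_eq {n : ℕ} {X Y : Matrix (Fin n) (Fin n) ℝ}
    (h : ∀ t : ℝ, NormedSpace.exp (t • X) = NormedSpace.exp (t • Y)) : X = Y := by
  open scoped Matrix.Norms.Operator in
  have h1 := hasDerivAt_exp_smul_const (𝕂 := ℝ) X (0 : ℝ)
  have h2 := hasDerivAt_exp_smul_const (𝕂 := ℝ) Y (0 : ℝ)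
  simpa using h1.unique (h2.congr_of_eventuallyEq (Filter.Eventually.of_forall h))

/-- If `exp X = exp Y`, then `exp(-tX) exp(tY)` is 1-periodic, and its frequencies lie strictly
between `-2π` and `2π`. Only frequency `0` survives, so the product is constant, equal to its value
`1` at `t = 0`. -/
theorem exp_injOn_logRange {n : ℕ} : InjOn NormedSpace.exp (logRange n) := by
  rintro X ⟨hX, hX'⟩ Y ⟨hY, hY'⟩ hXY
  -- The zero matrix fills the third factor, which is not needed here.
  obtain ⟨w, c, hw, hc⟩ := exists_exp_mul_decomposition (neg_mem hX) hY (zero_mem _)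
  have hw0 : ∀ p, Complex.exp (w p * Complex.I) = 1 → w p = 0 := by
    intro p h1
    obtain ⟨x, y, z, hx, hy, hz, hp⟩ := hw p
    obtain ⟨k, hk⟩ := exp_mul_I_eq_one_iff.1 h1
    have hx1 := hX' _ hx.of_neg
    have hy1 := hY' _ hy
    have hz1 : z = 0 := by simpa using hz.eq_zero
    simp only [Complex.neg_im, Complex.mul_I_im, Complex.ofReal_re, mem_Ioo] at hx1 hy1
    have h3 : -(2 * Real.pi) < w p := by linarith
    have h4 : w p < 2 * Real.pi := by linarith
    rw [hk] at h3 h4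
    have hpi : (0 : ℝ) < 2 * Real.pi := by positivity
    have h5 : (k : ℝ) < 1 := by nlinarith
    have h6 : (-1 : ℝ) < k := by nlinarith
    have h7 : k < 1 := by exact_mod_cast h5
    have h8 : -1 < k := by exact_mod_cast h6
    have h9 : k = 0 := by omega
    simp [hk, h9]
  have hinv : NormedSpace.exp (-X) * NormedSpace.exp Y = 1 := by
    rw [← hXY]
    simpa using exp_smul_mul_exp_smul_neg 1 (-X)
  have hper : ∀ t : ℝ, NormedSpace.exp ((t + 1) • -X) * NormedSpace.exp ((t + 1) • Y) *
      NormedSpace.exp ((t + 1) • (0 : Matrix (Fin n) (Fin n) ℝ)) =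
      NormedSpace.exp (t • -X) * NormedSpace.exp (t • Y) *
      NormedSpace.exp (t • (0 : Matrix (Fin n) (Fin n) ℝ)) := by
    intro t
    simp only [smul_zero, NormedSpace.exp_zero, mul_one]
    rw [exp_add_one_smul, add_comm t 1, add_smul, one_smul,
      Matrix.exp_add_of_commute _ _ ((Commute.refl Y).smul_right t), Matrix.mul_assoc,
      ← Matrix.mul_assoc (NormedSpace.exp (-X)), hinv, Matrix.one_mul]
  have key := exp_mul_eq_of_periodic hc hper
  refine eq_of_exp_smul_eq fun t => ?_
  have h1 : NormedSpace.exp (t • -X) * NormedSpace.exp (t • Y) = 1 := by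
    refine cplx_injective ?_
    have h2 := key t
    have h3 := key 0
    simp only [smul_zero, zero_smul, NormedSpace.exp_zero, mul_one] at h2 h3
    rw [h2, h3]
    refine Finset.sum_congr rfl fun p _ => ?_
    split_ifs with h
    · simp [hw0 p h]
    · rfl
  calc NormedSpace.exp (t • X) = NormedSpace.exp (t • X) *
        (NormedSpace.exp (t • -X) * NormedSpace.exp (t • Y)) := by rw [h1, mul_one]
    _ = NormedSpace.exp (t • Y) := by
      rw [← Matrix.mul_assoc, exp_smul_mul_exp_smul_neg, Matrix.one_mul]

end

noncomputable section

/-! ### Direct limits of sequences of compact spaces -/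

/-- The topology of `X` is the direct limit of an increasing sequence of locally compact spaces. -/
structure IsLimitOfPieces {X : Type*} [tX : TopologicalSpace X] {K : ℕ → Type*}
    [∀ N, TopologicalSpace (K N)] (ι : ∀ N, K N → X) : Prop where
  eq_iSup : tX = ⨆ N, TopologicalSpace.coinduced (ι N) inferInstance
  injective : ∀ N, Function.Injective (ι N)
  exists_map : ∀ M N, M ≤ N → ∃ j : K M → K N, Continuous j ∧ ∀ x, ι N (j x) = ι M x
  cover : ∀ x, ∃ N k, ι N k = x
  locallyCompact : ∀ N, LocallyCompactSpace (K N)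

namespace IsLimitOfPieces

variable {X Y Z : Type*} [TopologicalSpace X] [TopologicalSpace Y] [TopologicalSpace Z]
  {K L : ℕ → Type*} [∀ N, TopologicalSpace (K N)] [∀ N, TopologicalSpace (L N)]
  {ι : ∀ N, K N → X} {κ : ∀ N, L N → Y}

theorem isOpen_iff (h : IsLimitOfPieces ι) {U : Set X} :
    IsOpen U ↔ ∀ N, IsOpen (ι N ⁻¹' U) := by
  rw [h.eq_iSup, isOpen_iSup_iff]
  rfl

theorem continuous_incl (h : IsLimitOfPieces ι) (N : ℕ) : Continuous (ι N) :=
  continuous_def.2 fun _ hU => h.isOpen_iff.1 hU N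

theorem continuous_iff (h : IsLimitOfPieces ι) {f : X → Z} :
    Continuous f ↔ ∀ N, Continuous (f ∘ ι N) :=
  ⟨fun hf N => hf.comp (h.continuous_incl N), fun hf => continuous_def.2 fun U hU =>
    h.isOpen_iff.2 fun N => (hf N).isOpen_preimage U hU⟩

/-- For open `S` continuity on `S` is openness of the sets `S ∩ f⁻¹ U`, which can be tested on the
pieces. -/
theorem continuousOn_iff (h : IsLimitOfPieces ι) {f : X → Z} {S : Set X} (hS : IsOpen S) :
    ContinuousOn f S ↔ ∀ N, ContinuousOn (f ∘ ι N) (ι N ⁻¹' S) := by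
  refine ⟨fun hf N => hf.comp (h.continuous_incl N).continuousOn fun _ hx => hx, fun hf => ?_⟩
  rw [continuousOn_open_iff hS]
  intro U hU
  refine h.isOpen_iff.2 fun N => ?_
  exact (continuousOn_open_iff (h.isOpen_iff.1 hS N)).1 (hf N) U hU

theorem exists_pair (h : IsLimitOfPieces ι) (h' : IsLimitOfPieces κ) (x : X) (y : Y) :
    ∃ N k l, ι N k = x ∧ κ N l = y := by
  obtain ⟨N, k, rfl⟩ := h.cover x
  obtain ⟨M, l, rfl⟩ := h'.cover y
  obtain ⟨j, -, hj⟩ := h.exists_map N (max N M) (le_max_left _ _)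
  obtain ⟨j', -, hj'⟩ := h'.exists_map M (max N M) (le_max_right _ _)
  exact ⟨_, j k, j' l, hj _, hj' _⟩

/-- Increasing neighbourhoods in the pieces give a neighbourhood in the limit. -/
theorem iUnion_mem_nhds (h : IsLimitOfPieces ι) (N₀ : ℕ) (A : ∀ i, Set (K (N₀ + i)))
    (hA : ∀ i, ι (N₀ + i) '' A i ⊆ ι (N₀ + (i + 1)) '' interior (A (i + 1))) :
    IsOpen (⋃ i, ι (N₀ + i) '' A i) := by
  have hmono : ∀ i k, ι (N₀ + i) '' A i ⊆ ι (N₀ + (i + k + 1)) '' interior (A (i + k + 1)) := by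
    intro i k
    induction k with
    | zero => exact hA i
    | succ k ih => exact (ih.trans (image_mono interior_subset)).trans (hA _)
  refine h.isOpen_iff.2 fun M => isOpen_iff_mem_nhds.2 fun x hx => ?_
  obtain ⟨i, hi⟩ := mem_iUnion.1 hx
  -- The stage `i + M + 1` serves two purposes: it lies beyond `i`, so `x` comes from the interior
  -- of the set there, and `K M` maps into that piece.
  obtain ⟨a, ha, hax⟩ := hmono i M hi
  obtain ⟨j, hj, hj'⟩ := h.exists_map M (N₀ + (i + M + 1)) (by omega)
  have h1 : j x ∈ interior (A (i + M + 1)) := by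
    have h2 : j x = a := h.injective _ ((hj' x).trans hax.symm)
    rwa [h2]
  filter_upwards [(isOpen_interior.preimage hj).mem_nhds h1] with y hy
  exact mem_iUnion.2 ⟨_, j y, interior_subset hy, hj' y⟩

/-- The product of two such direct limits is the direct limit of the products. -/
theorem continuous_prod (h : IsLimitOfPieces ι) (h' : IsLimitOfPieces κ) {f : X × Y → Z}
    (hf : ∀ N, Continuous fun p : K N × L N => f (ι N p.1, κ N p.2)) : Continuous f := by
  refine continuous_def.2 fun W hW => isOpen_iff_mem_nhds.2 ?_
  rintro ⟨x, y⟩ hxy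
  obtain ⟨N₀, k₀, l₀, rfl, rfl⟩ := h.exists_pair h' x y
  let S : ∀ N, Set (K N × L N) := fun N => {p | f (ι N p.1, κ N p.2) ∈ W}
  have hS : ∀ N, IsOpen (S N) := fun N => (hf N).isOpen_preimage W hW
  -- A state is a compact box in the `i`-th pieces sent into `W`. The tube lemma and local
  -- compactness enlarge it to a box in the next pieces containing it in the interior. The unions of
  -- the two sides are then open, and their product is sent into `W`.
  let State : ℕ → Type _ := fun i => {p : Set (K (N₀ + i)) × Set (L (N₀ + i)) //
    IsCompact p.1 ∧ IsCompact p.2 ∧ p.1 ×ˢ p.2 ⊆ S (N₀ + i)}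
  have step : ∀ i (p : State i), ∃ q : State (i + 1),
      ι (N₀ + i) '' p.1.1 ⊆ ι (N₀ + (i + 1)) '' interior q.1.1 ∧
      κ (N₀ + i) '' p.1.2 ⊆ κ (N₀ + (i + 1)) '' interior q.1.2 := by
    rintro i ⟨⟨A, B⟩, hA, hB, hAB⟩
    obtain ⟨j, hj, hj'⟩ := h.exists_map (N₀ + i) (N₀ + (i + 1)) (by omega)
    obtain ⟨m, hm, hm'⟩ := h'.exists_map (N₀ + i) (N₀ + (i + 1)) (by omega)
    have hAB' : (j '' A) ×ˢ (m '' B) ⊆ S (N₀ + (i + 1)) := by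
      rintro ⟨_, _⟩ ⟨⟨a, ha, rfl⟩, ⟨b, hb, rfl⟩⟩
      change f (ι _ (j a), κ _ (m b)) ∈ W
      rw [hj', hm']
      exact hAB (mk_mem_prod ha hb)
    obtain ⟨u, v, hu, hv, hAu, hBv, huv⟩ :=
      generalized_tube_lemma (hA.image hj) (hB.image hm) (hS _) hAB'
    have := h.locallyCompact (N₀ + (i + 1))
    have := h'.locallyCompact (N₀ + (i + 1))
    obtain ⟨A', hA', hAA', hA'u⟩ := exists_compact_between (hA.image hj) hu hAu
    obtain ⟨B', hB', hBB', hB'v⟩ := exists_compact_between (hB.image hm) hv hBv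
    refine ⟨⟨(A', B'), hA', hB', (prod_mono hA'u hB'v).trans huv⟩, ?_, ?_⟩
    · rintro _ ⟨a, ha, rfl⟩
      exact ⟨j a, hAA' ⟨a, ha, rfl⟩, hj' a⟩
    · rintro _ ⟨b, hb, rfl⟩
      exact ⟨m b, hBB' ⟨b, hb, rfl⟩, hm' b⟩
  choose next hnext₁ hnext₂ using step
  let st : ∀ i, State i := fun i => Nat.rec (motive := State)
    ⟨({k₀}, {l₀}), isCompact_singleton, isCompact_singleton, by
      rintro ⟨_, _⟩ ⟨rfl, rfl⟩; exact hxy⟩ next i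
  have hU := h.iUnion_mem_nhds N₀ (fun i => (st i).1.1) fun i => hnext₁ i (st i)
  have hV := h'.iUnion_mem_nhds N₀ (fun i => (st i).1.2) fun i => hnext₂ i (st i)
  have mono₁ : Monotone fun i => ι (N₀ + i) '' (st i).1.1 := monotone_nat_of_le_succ fun i =>
    (hnext₁ i (st i)).trans (image_mono interior_subset)
  have mono₂ : Monotone fun i => κ (N₀ + i) '' (st i).1.2 := monotone_nat_of_le_succ fun i =>
    (hnext₂ i (st i)).trans (image_mono interior_subset)
  refine Filter.mem_of_superset ((hU.prod hV).mem_nhds (mk_mem_prod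
    (mem_iUnion.2 ⟨0, k₀, rfl, rfl⟩) (mem_iUnion.2 ⟨0, l₀, rfl, rfl⟩))) ?_
  rintro ⟨x', y'⟩ ⟨hx', hy'⟩
  obtain ⟨i, hi⟩ := mem_iUnion.1 hx'
  obtain ⟨i', hi'⟩ := mem_iUnion.1 hy'
  obtain ⟨a, ha, rfl⟩ := mono₁ (le_max_left i i') hi
  obtain ⟨b, hb, rfl⟩ := mono₂ (le_max_right i i') hi'
  exact (st (max i i')).2.2.2 (mk_mem_prod ha hb)

end IsLimitOfPieces

/-! ### One-parameter subgroups of `SO_n` -/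

theorem exp_mem_orthogonalGroup {n : ℕ} {X : Matrix (Fin n) (Fin n) ℝ}
    (hX : X ∈ LieAlgebra.Orthogonal.so (Fin n) ℝ) :
    NormedSpace.exp X ∈ Matrix.orthogonalGroup (Fin n) ℝ := by
  rw [LieAlgebra.Orthogonal.mem_so] at hX
  rw [mem_orthogonalGroup_iff, ← Matrix.exp_transpose, hX]
  simpa using exp_smul_mul_exp_smul_neg 1 X

theorem exp_mem_SO {n : ℕ} {X : Matrix (Fin n) (Fin n) ℝ}
    (hX : X ∈ LieAlgebra.Orthogonal.so (Fin n) ℝ) :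
    NormedSpace.exp X ∈ Matrix.specialOrthogonalGroup (Fin n) ℝ := by
  refine mem_specialOrthogonalGroup_iff.2 ⟨exp_mem_orthogonalGroup hX, ?_⟩
  -- `exp X` is the square of the orthogonal matrix `exp Y`, and `det (exp Y)² = 1`.
  set Y := (2⁻¹ : ℝ) • X with hY
  have hYso : Y ∈ LieAlgebra.Orthogonal.so (Fin n) ℝ := Submodule.smul_mem _ _ hX
  have h1 : NormedSpace.exp X = NormedSpace.exp Y * NormedSpace.exp Y := by
    rw [← Matrix.exp_add_of_commute _ _ (Commute.refl Y), hY, ← add_smul]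
    norm_num
  have h2 := congrArg Matrix.det ((mem_orthogonalGroup_iff _ _).1 (exp_mem_orthogonalGroup hYso))
  rw [det_mul, det_transpose, det_one] at h2
  rw [h1, det_mul]
  exact h2

theorem continuous_matrix_exp {n : ℕ} :
    Continuous (NormedSpace.exp : Matrix (Fin n) (Fin n) ℝ → Matrix (Fin n) (Fin n) ℝ) := by
  open scoped Matrix.Norms.Operator in
  exact NormedSpace.exp_continuous

/-- The elements of `so_n` with entries bounded by `N`. -/
abbrev SoPiece (n N : ℕ) : Type :=
  {X : Matrix (Fin n) (Fin n) ℝ // X ∈ LieAlgebra.Orthogonal.so (Fin n) ℝ ∧ ∀ i j, |X i j| ≤ N}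

instance (n N : ℕ) : CompactSpace (SoPiece n N) := by
  refine isCompact_iff_compactSpace.1 ?_
  have h1 : IsCompact {X : Matrix (Fin n) (Fin n) ℝ | ∀ i j, X i j ∈ Icc (-(N : ℝ)) N} := by
    have h2 : IsCompact {X : Fin n → Fin n → ℝ | ∀ i j, X i j ∈ Icc (-(N : ℝ)) N} := by
      convert isCompact_univ_pi (X := fun _ : Fin n => Fin n → ℝ) (s := fun _ =>
        Set.pi univ fun _ => Icc (-(N : ℝ)) N) fun _ => isCompact_univ_pi fun _ => isCompact_Icc
        using 1
      ext X
      exact ⟨fun h i _ j _ => h i j, fun h i j => h i trivial j trivial⟩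
    exact h2
  refine h1.of_isClosed_subset ?_ ?_
  · refine IsClosed.and ?_ ?_
    · simp_rw [LieAlgebra.Orthogonal.mem_so]
      exact isClosed_eq continuous_id.matrix_transpose continuous_neg
    · simp_rw [ofPred_forall]
      exact isClosed_iInter fun i => isClosed_iInter fun j =>
        isClosed_le (continuous_id.matrix_elem i j).abs continuous_const
  · rintro X ⟨-, hX⟩ i j
    exact abs_le.1 (hX i j)

/-- The path `η_ξ γ`. -/
def etaMul {n N : ℕ} (ξ : SoPiece n N) (γ : C(UnitAddCircle, SO n)) : C(ℝ, SO n) where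
  toFun t := ⟨NormedSpace.exp (t • ξ.1), exp_mem_SO (Submodule.smul_mem _ t ξ.2.1)⟩ *
    γ (t : UnitAddCircle)
  continuous_toFun := by
    refine Continuous.mul (Continuous.subtype_mk ?_ _)
      (γ.continuous.comp (AddCircle.continuous_mk' 1))
    exact continuous_matrix_exp.comp (continuous_id.smul continuous_const)

theorem etaMul_factorsAs {n N : ℕ} (ξ : SoPiece n N) (γ : C(UnitAddCircle, SO n)) :
    FactorsAs (etaMul ξ γ) ξ.1 γ := fun _ => rfl

theorem continuous_etaMul {n N : ℕ} :
    Continuous fun p : SoPiece n N × C(UnitAddCircle, SO n) => etaMul p.1 p.2 := by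
  refine ContinuousMap.continuous_of_continuous_uncurry _ ?_
  change Continuous fun q : (SoPiece n N × C(UnitAddCircle, SO n)) × ℝ =>
    (⟨NormedSpace.exp (q.2 • q.1.1.1), exp_mem_SO (Submodule.smul_mem _ q.2 q.1.1.2.1)⟩ : SO n) *
      q.1.2 (q.2 : UnitAddCircle)
  refine Continuous.mul (Continuous.subtype_mk ?_ _) ?_
  · exact continuous_matrix_exp.comp
      (continuous_snd.smul (continuous_subtype_val.comp (continuous_fst.comp continuous_fst)))
  · exact (continuous_snd.comp continuous_fst).eval
      ((AddCircle.continuous_mk' 1).comp continuous_snd)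

theorem contDiff_exp_smul_apply {n : ℕ} {ξ : Matrix (Fin n) (Fin n) ℝ}
    (hξ : ξ ∈ LieAlgebra.Orthogonal.so (Fin n) ℝ) (i j : Fin n) :
    ContDiff ℝ ∞ fun t : ℝ => (NormedSpace.exp (t • ξ) : Matrix (Fin n) (Fin n) ℝ) i j := by
  obtain ⟨a, R, -, -, -, hR⟩ := exists_exp_decomposition hξ
  have h1 : (fun t : ℝ => (NormedSpace.exp (t • ξ) : Matrix (Fin n) (Fin n) ℝ) i j) = fun t : ℝ =>
      (∑ k, Complex.exp (a k * Complex.I * t) * R k i j).re := by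
    funext t
    have h2 := congrArg Complex.re (congrFun (congrFun (hR t) i) j)
    rw [Matrix.sum_apply] at h2
    exact h2
  rw [h1]
  refine Complex.reCLM.contDiff.comp (ContDiff.sum fun k _ => ContDiff.mul ?_ contDiff_const)
  exact (contDiff_const.mul Complex.ofRealCLM.contDiff).cexp

namespace FactorsAs

variable {n N : ℕ} {α : C(ℝ, SO n)} {ξ : Matrix (Fin n) (Fin n) ℝ} {γ : C(UnitAddCircle, SO n)}

/-- The periodic factor cancels, and what is left is `exp((t+1)ξ) exp(-tξ)`. -/
theorem apply_add_one_mul_inv (h : FactorsAs α ξ γ)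
    (hξ : ξ ∈ LieAlgebra.Orthogonal.so (Fin n) ℝ) (t : ℝ) :
    α (t + 1) * (α t)⁻¹ = ⟨NormedSpace.exp ξ, exp_mem_SO hξ⟩ := by
  have hα : ∀ t : ℝ, α t = (⟨NormedSpace.exp (t • ξ), exp_mem_SO (Submodule.smul_mem _ t hξ)⟩ : SO n) *
      γ (t : UnitAddCircle) := fun t => Subtype.ext (h t)
  have h1 : ((t + 1 : ℝ) : UnitAddCircle) = (t : UnitAddCircle) := AddCircle.coe_add_period 1 t
  have h2 : (⟨NormedSpace.exp ((t + 1) • ξ), exp_mem_SO (Submodule.smul_mem _ (t + 1) hξ)⟩ : SO n) =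
      ⟨NormedSpace.exp ξ, exp_mem_SO hξ⟩ *
        ⟨NormedSpace.exp (t • ξ), exp_mem_SO (Submodule.smul_mem _ t hξ)⟩ := by
    refine Subtype.ext ?_
    change NormedSpace.exp ((t + 1) • ξ) = NormedSpace.exp ξ * NormedSpace.exp (t • ξ)
    rw [add_comm t, add_smul, one_smul,
      Matrix.exp_add_of_commute _ _ ((Commute.refl ξ).smul_right t)]
  rw [hα, hα, h1, h2]
  group

/-- A factorization forces both conditions that define `P_per`. -/
theorem mem_Pper (h : FactorsAs α ξ γ) (hξ : ξ ∈ LieAlgebra.Orthogonal.so (Fin n) ℝ)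
    (hγ : IsLaurent N γ) : α ∈ Pper n := by
  refine ⟨fun i j => ?_, _, h.apply_add_one_mul_inv hξ⟩
  simp_rw [h _, Matrix.mul_apply]
  exact ContDiff.sum fun k _ => (contDiff_exp_smul_apply hξ i k).mul (hγ.contDiff k j)

end FactorsAs

/-! ### Compactness of the pieces -/

theorem isClosed_SO (n : ℕ) :
    IsClosed (Matrix.specialOrthogonalGroup (Fin n) ℝ : Set (Matrix (Fin n) (Fin n) ℝ)) := by
  have h : (Matrix.specialOrthogonalGroup (Fin n) ℝ : Set (Matrix (Fin n) (Fin n) ℝ)) =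
      {A | A * Aᵀ = 1 ∧ A.det = 1} := by
    ext A
    rw [SetLike.mem_coe, mem_specialOrthogonalGroup_iff, mem_orthogonalGroup_iff]
    rfl
  rw [h]
  exact (isClosed_eq (continuous_id.matrix_mul continuous_id.matrix_transpose)
    continuous_const).and (isClosed_eq continuous_id.matrix_det continuous_const)

theorem SO.abs_apply_le_one {n : ℕ} (g : SO n) (i j : Fin n) :
    |(g : Matrix (Fin n) (Fin n) ℝ) i j| ≤ 1 :=
  entry_norm_bound_of_unitary (mem_specialOrthogonalGroup_iff.1 g.2).1 i j

/-- The entries of an element of `SO_n`, as complex numbers. -/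
def SO.complexEntries (n : ℕ) : C(SO n, Fin n → Fin n → ℂ) where
  toFun g i j := ((g : Matrix (Fin n) (Fin n) ℝ) i j : ℂ)
  continuous_toFun := continuous_pi fun i => continuous_pi fun j =>
    Complex.continuous_ofReal.comp (continuous_subtype_val.matrix_elem i j)

/-- Taking real parts inverts the map on its range. Loops in `SO_n` can thus be studied inside a
normed space of complex functions, where Laurent polynomials of bounded degree form a
finite-dimensional subspace. -/
theorem SO.isClosedEmbedding_complexEntries (n : ℕ) :
    Topology.IsClosedEmbedding (SO.complexEntries n) := by
  have hre : Continuous fun A : Fin n → Fin n → ℂ => (Matrix.of fun i j => (A i j).re) :=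
    continuous_matrix fun i j => Complex.continuous_re.comp
      ((continuous_apply j).comp (continuous_apply i))
  have h1 : Topology.IsEmbedding (SO.complexEntries n) := by
    refine Topology.IsEmbedding.of_comp (g := fun A : Fin n → Fin n → ℂ => (Matrix.of fun i j => (A i j).re))
      (SO.complexEntries n).continuous hre ?_
    exact Topology.IsEmbedding.subtypeVal
  refine ⟨h1, ?_⟩
  have h2 : range (SO.complexEntries n) = {A | (∀ i j, ((A i j).re : ℂ) = A i j) ∧
      (Matrix.of fun i j => (A i j).re) ∈ Matrix.specialOrthogonalGroup (Fin n) ℝ} := by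
    ext A
    constructor
    · rintro ⟨g, rfl⟩
      exact ⟨fun i j => by simp [SO.complexEntries], g.2⟩
    · rintro ⟨hA, hA'⟩
      exact ⟨⟨_, hA'⟩, funext fun i => funext fun j => hA i j⟩
  rw [h2]
  refine IsClosed.and ?_ ((isClosed_SO n).preimage hre)
  simp_rw [ofPred_forall]
  refine isClosed_iInter fun i => isClosed_iInter fun j => isClosed_eq ?_ ?_
  · exact Complex.continuous_ofReal.comp (Complex.continuous_re.comp
      ((continuous_apply j).comp (continuous_apply i)))
  · exact (continuous_apply j).comp (continuous_apply i)

/-- The Laurent polynomials of degree at most `N` with coefficients in the complex matrices. -/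
def laurentMap (n N : ℕ) : (Finset.Icc (-(N : ℤ)) N → Fin n → Fin n → ℂ) →ₗ[ℂ]
    C(UnitAddCircle, Fin n → Fin n → ℂ) where
  toFun c := ∑ k : Finset.Icc (-(N : ℤ)) N,
    (⟨fun z => fourier k z • c k, (fourier (k : ℤ)).continuous.smul continuous_const⟩ :
      C(UnitAddCircle, Fin n → Fin n → ℂ))
  map_add' c d := by
    rw [← Finset.sum_add_distrib]
    refine Finset.sum_congr rfl fun k _ => ContinuousMap.ext fun z => ?_
    exact smul_add _ _ _
  map_smul' a c := by
    rw [Finset.smul_sum]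
    refine Finset.sum_congr rfl fun k _ => ContinuousMap.ext fun z => ?_
    exact smul_comm (fourier (k : ℤ) z : ℂ) a (c k)

theorem laurentMap_apply {n N : ℕ} (c : Finset.Icc (-(N : ℤ)) N → Fin n → Fin n → ℂ)
    (z : UnitAddCircle) : laurentMap n N c z = ∑ k : Finset.Icc (-(N : ℤ)) N, fourier k z • c k := by
  simp [laurentMap]

theorem isLaurent_iff_mem_range {n N : ℕ} {γ : C(UnitAddCircle, SO n)} :
    IsLaurent N γ ↔ (SO.complexEntries n).comp γ ∈ LinearMap.range (laurentMap n N) := by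
  constructor
  · rintro ⟨c, hc⟩
    refine ⟨fun k i j => c k i j, ContinuousMap.ext fun z => funext fun i => funext fun j => ?_⟩
    have h1 := congrFun (congrFun (hc z) i) j
    rw [Matrix.sum_apply] at h1
    refine Eq.trans ?_ h1.symm
    rw [laurentMap_apply, Finset.sum_apply, Finset.sum_apply]
    exact Finset.sum_coe_sort (Finset.Icc (-(N : ℤ)) N) fun k : ℤ => (fourier k z : ℂ) • c k i j
  · rintro ⟨c, hc⟩
    -- Coefficients outside the range of summation are never used and are set to `0`.
    refine ⟨fun k => Matrix.of fun i j => if h : k ∈ Finset.Icc (-(N : ℤ)) N then c ⟨k, h⟩ i j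
      else 0, fun z => ?_⟩
    ext i j
    have h1 := congrFun (congrFun (DFunLike.congr_fun hc z) i) j
    rw [laurentMap_apply, Finset.sum_apply, Finset.sum_apply] at h1
    refine Eq.trans h1.symm ?_
    have hd : ∀ k : Finset.Icc (-(N : ℤ)) N, (if h : (k : ℤ) ∈ Finset.Icc (-(N : ℤ)) N then
        c ⟨k, h⟩ i j else 0) = c k i j := fun k => dif_pos k.2
    rw [Matrix.sum_apply, ← Finset.sum_coe_sort (Finset.Icc (-(N : ℤ)) N)]
    exact Finset.sum_congr rfl fun k _ =>
      congrArg (fun x : ℂ => (fourier (k : ℤ) z : ℂ) * x) (hd k).symm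

/-- Orthogonal matrices have entries of modulus at most `1`, so the loops form a bounded subset of a
finite-dimensional space, and it is closed because `SO_n` is. -/
theorem isCompact_setOf_isLaurent (n N : ℕ) :
    IsCompact {γ : C(UnitAddCircle, SO n) | IsLaurent N γ} := by
  have hι := SO.isClosedEmbedding_complexEntries n
  refine ((SO.complexEntries n).isInducing_postcomp hι.isInducing).isCompact_iff.2 ?_
  set V := LinearMap.range (laurentMap n N) with hV
  have hball : IsCompact ((V : Set C(UnitAddCircle, Fin n → Fin n → ℂ)) ∩ Metric.closedBall 0 1) := by
    have h1 : IsCompact (Metric.closedBall (0 : V) 1) :=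
      haveI := FiniteDimensional.proper ℂ V
      isCompact_closedBall _ _
    convert h1.image continuous_subtype_val using 1
    ext f
    constructor
    · rintro ⟨hf, hf'⟩
      exact ⟨⟨f, hf⟩, mem_closedBall_zero_iff.2 (mem_closedBall_zero_iff.1 hf'), rfl⟩
    · rintro ⟨⟨f, hf⟩, hf', rfl⟩
      exact ⟨hf, mem_closedBall_zero_iff.2 (mem_closedBall_zero_iff.1 hf')⟩
  have himage : (ContinuousMap.comp (SO.complexEntries n)) ''
      {γ : C(UnitAddCircle, SO n) | IsLaurent N γ} =
      ((V : Set C(UnitAddCircle, Fin n → Fin n → ℂ)) ∩ Metric.closedBall 0 1) ∩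
        {f | ∀ z, f z ∈ range (SO.complexEntries n)} := by
    ext f
    constructor
    · rintro ⟨γ, hγ, rfl⟩
      refine ⟨⟨isLaurent_iff_mem_range.1 hγ, ?_⟩, fun z => ⟨γ z, rfl⟩⟩
      rw [mem_closedBall_zero_iff, ContinuousMap.norm_le _ zero_le_one]
      intro z
      refine (pi_norm_le_iff_of_nonneg zero_le_one).2 fun i =>
        (pi_norm_le_iff_of_nonneg zero_le_one).2 fun j => ?_
      change ‖(((γ z : SO n) : Matrix (Fin n) (Fin n) ℝ) i j : ℂ)‖ ≤ 1
      rw [Complex.norm_real]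
      exact SO.abs_apply_le_one _ _ _
    · rintro ⟨⟨hf, -⟩, hf'⟩
      choose g hg using hf'
      have hg' : Continuous g := by
        rw [hι.isEmbedding.continuous_iff]
        exact (f.continuous).congr fun z => (hg z).symm
      have h1 : (SO.complexEntries n).comp ⟨g, hg'⟩ = f := ContinuousMap.ext hg
      refine ⟨⟨g, hg'⟩, ?_, h1⟩
      change IsLaurent N _
      rw [isLaurent_iff_mem_range, h1]
      exact hf
  rw [himage]
  refine hball.inter_right ?_
  simp_rw [ofPred_forall]
  exact isClosed_iInter fun z => hι.isClosed_range.preimage (continuous_eval_const z)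

instance (n N : ℕ) : CompactSpace (LpolPiece n N) :=
  isCompact_iff_compactSpace.1 (isCompact_setOf_isLaurent n N)

/-- The piece is the continuous image of the compact space of pairs `(ξ, γ)`. -/
instance (n N : ℕ) : CompactSpace (PpolPiece n N) := by
  let f : SoPiece n N × LpolPiece n N → PpolPiece n N := fun p =>
    ⟨etaMul p.1 p.2.1, (etaMul_factorsAs p.1 p.2.1).mem_Pper p.1.2.1 p.2.2,
      p.1.1, p.1.2.1, p.1.2.2, p.2.1, p.2.2, etaMul_factorsAs p.1 p.2.1⟩
  have hf : Continuous f := by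
    refine Continuous.subtype_mk ?_ _
    exact continuous_etaMul.comp
      (continuous_fst.prodMk (continuous_subtype_val.comp continuous_snd))
  have hsurj : Function.Surjective f := by
    rintro ⟨α, hα, ξ, hξ, hξN, γ, hγ, h⟩
    refine ⟨(⟨ξ, hξ, hξN⟩, ⟨γ, hγ⟩), Subtype.ext (ContinuousMap.ext fun t => Subtype.ext ?_)⟩
    exact (h t).symm
  exact hsurj.compactSpace hf

/-! ### The direct limit topologies -/

theorem IsLaurent.mono {n N M : ℕ} {γ : C(UnitAddCircle, SO n)} (hγ : IsLaurent N γ)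
    (hNM : N ≤ M) : IsLaurent M γ := by
  obtain ⟨c, hc⟩ := hγ
  have hsub : Finset.Icc (-(N : ℤ)) N ⊆ Finset.Icc (-(M : ℤ)) M :=
    Finset.Icc_subset_Icc (by omega) (by omega)
  refine ⟨fun k => if k ∈ Finset.Icc (-(N : ℤ)) N then c k else 0, fun z => ?_⟩
  rw [hc, ← Finset.sum_subset hsub fun k _ hk => by simp only [if_neg hk, smul_zero]]
  exact Finset.sum_congr rfl fun k hk => by simp only [if_pos hk]

theorem LpolSO.isLimitOfPieces (n : ℕ) : IsLimitOfPieces (LpolPiece.incl n) where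
  eq_iSup := rfl
  injective _ _ _ h := Subtype.ext (congrArg (fun x : LpolSO n => x.1) h)
  exists_map _ _ h := ⟨fun γ => ⟨γ.1, γ.2.mono h⟩,
    Continuous.subtype_mk continuous_subtype_val _, fun _ => rfl⟩
  cover := fun ⟨γ, N, hγ⟩ => ⟨N, ⟨γ, hγ⟩, rfl⟩
  locallyCompact _ := inferInstance

theorem PpolSO.isLimitOfPieces (n : ℕ) : IsLimitOfPieces (PpolPiece.incl n) where
  eq_iSup := rfl
  injective _ _ _ h := Subtype.ext (congrArg PpolSO.path h)
  exists_map M N h := by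
    have hmem : ∀ α : PpolPiece n M, α.1 ∈ Pper n ∧ ∃ ξ ∈ LieAlgebra.Orthogonal.so (Fin n) ℝ,
        (∀ i j, |ξ i j| ≤ N) ∧ ∃ γ, IsLaurent N γ ∧ FactorsAs α.1 ξ γ := by
      intro α
      obtain ⟨hp, ξ, hξ, hM, γ, hγ, hα⟩ := α.2
      exact ⟨hp, ξ, hξ, fun i j => (hM i j).trans (by exact_mod_cast h), γ, hγ.mono h, hα⟩
    exact ⟨fun α => ⟨α.1, hmem α⟩, Continuous.subtype_mk continuous_subtype_val _, fun _ => rfl⟩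
  cover := by
    rintro ⟨α, hp, ξ, hξ, γ, ⟨N, hγ⟩, hα⟩
    obtain ⟨B, hB⟩ := (Set.finite_range fun p : Fin n × Fin n => |ξ p.1 p.2|).bddAbove
    refine ⟨max N ⌈B⌉₊, ⟨α, hp, ξ, hξ, fun i j => ?_, γ, hγ.mono (le_max_left _ _), hα⟩, rfl⟩
    refine (hB ⟨(i, j), rfl⟩).trans ((Nat.le_ceil B).trans ?_)
    exact_mod_cast le_max_right _ _
  locallyCompact _ := inferInstance

/-- Degrees add under multiplication, so pairs from piece `N` multiply into piece `N + N`; since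
products commute with these limits, this suffices. -/
theorem LpolSO.isTopologicalGroup (n : ℕ) : IsTopologicalGroup (LpolSO n) where
  continuous_mul := by
    refine (LpolSO.isLimitOfPieces n).continuous_prod (LpolSO.isLimitOfPieces n) fun N => ?_
    refine ((LpolSO.isLimitOfPieces n).continuous_incl (N + N)).comp
      (f := fun p : LpolPiece n N × LpolPiece n N => (⟨p.1.1 * p.2.1, p.1.2.mul p.2.2⟩ :
        LpolPiece n (N + N))) (Continuous.subtype_mk ?_ _)
    exact (continuous_subtype_val.comp continuous_fst).mul
      (continuous_subtype_val.comp continuous_snd)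
  continuous_inv := by
    have hinv : Continuous fun γ : C(UnitAddCircle, SO n) => γ⁻¹ :=
      ContinuousMap.continuous_postcomp ⟨_, continuous_inv⟩
    refine (LpolSO.isLimitOfPieces n).continuous_iff.2 fun N => ?_
    exact ((LpolSO.isLimitOfPieces n).continuous_incl N).comp
      (f := fun p : LpolPiece n N => (⟨p.1⁻¹, p.2.inv⟩ : LpolPiece n N))
      (Continuous.subtype_mk (hinv.comp continuous_subtype_val) _)

theorem continuous_mulLoop {n : ℕ} :
    Continuous fun p : C(ℝ, SO n) × C(UnitAddCircle, SO n) => mulLoop p.1 p.2 :=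
  continuous_fst.mul ((ContinuousMap.continuous_precomp
    (⟨_, AddCircle.continuous_mk' 1⟩ : C(ℝ, UnitAddCircle))).comp continuous_snd)

theorem PpolSO.continuousSMul (n : ℕ) : ContinuousSMul (LpolSO n)ᵐᵒᵖ (PpolSO n) where
  continuous_smul := by
    have h : Continuous fun p : PpolSO n × LpolSO n => MulOpposite.op p.2 • p.1 := by
      refine (PpolSO.isLimitOfPieces n).continuous_prod (LpolSO.isLimitOfPieces n) fun N => ?_
      have hmem : ∀ p : PpolPiece n N × LpolPiece n N, mulLoop p.1.1 p.2.1 ∈ Pper n ∧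
          ∃ ξ ∈ LieAlgebra.Orthogonal.so (Fin n) ℝ, (∀ i j, |ξ i j| ≤ ((N + N : ℕ) : ℝ)) ∧
            ∃ γ, IsLaurent (N + N) γ ∧ FactorsAs (mulLoop p.1.1 p.2.1) ξ γ := by
        intro p
        obtain ⟨hp, ξ, hξ, hN, γ, hγ, hα⟩ := p.1.2
        refine ⟨mulLoop_mem_Pper hp ⟨N, p.2.2⟩, ξ, hξ, fun i j => (hN i j).trans ?_, γ * p.2.1,
          hγ.mul p.2.2, fun t => ?_⟩
        · push_cast
          linarith [(Nat.cast_nonneg N : (0 : ℝ) ≤ N)]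
        · change (p.1.1 t : Matrix (Fin n) (Fin n) ℝ) * (p.2.1 (t : UnitAddCircle)).1 =
            NormedSpace.exp (t • ξ) * ((γ (t : UnitAddCircle)).1 * (p.2.1 (t : UnitAddCircle)).1)
          rw [hα t, Matrix.mul_assoc]
      refine ((PpolSO.isLimitOfPieces n).continuous_incl (N + N)).comp
        (f := fun p : PpolPiece n N × LpolPiece n N => (⟨mulLoop p.1.1 p.2.1, hmem p⟩ :
          PpolPiece n (N + N))) (Continuous.subtype_mk ?_ _)
      exact continuous_mulLoop.comp ((continuous_subtype_val.comp continuous_fst).prodMk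
        (continuous_subtype_val.comp continuous_snd))
    exact h.comp (continuous_snd.prodMk (MulOpposite.continuous_unop.comp continuous_fst))

theorem PpolSO.continuous_proj (n : ℕ) : Continuous (PpolSO.proj n) := by
  refine (PpolSO.isLimitOfPieces n).continuous_iff.2 fun N => ?_
  exact ((continuous_eval_const 1).comp continuous_subtype_val).mul
    ((continuous_eval_const 0).comp continuous_subtype_val).inv

theorem PpolSO.proj_eq_exp {n : ℕ} (α : PpolSO n) {ξ : Matrix (Fin n) (Fin n) ℝ}
    (hξ : ξ ∈ LieAlgebra.Orthogonal.so (Fin n) ℝ) {γ : C(UnitAddCircle, SO n)}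
    (h : FactorsAs α.path ξ γ) :
    (PpolSO.proj n α : Matrix (Fin n) (Fin n) ℝ) = NormedSpace.exp ξ := by
  have h1 := h.apply_add_one_mul_inv hξ 0
  rw [zero_add] at h1
  exact congrArg Subtype.val h1

theorem PpolSO.path_add_one {n : ℕ} (α : PpolSO n) (t : ℝ) :
    α.path (t + 1) = PpolSO.proj n α * α.path t := by
  obtain ⟨g, hg⟩ := α.mem.1.2
  have h1 := hg 0
  rw [zero_add] at h1
  rw [PpolSO.proj, h1, ← hg t, inv_mul_cancel_right]

theorem PpolSO.proj_smul {n : ℕ} (γ : LpolSO n) (α : PpolSO n) :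
    PpolSO.proj n (MulOpposite.op γ • α) = PpolSO.proj n α := by
  have h1 : ((1 : ℝ) : UnitAddCircle) = ((0 : ℝ) : UnitAddCircle) := by
    simp
  change α.path 1 * γ.loop ((1 : ℝ) : UnitAddCircle) *
    (α.path 0 * γ.loop ((0 : ℝ) : UnitAddCircle))⁻¹ = α.path 1 * (α.path 0)⁻¹
  rw [h1]
  group

end

noncomputable section

/-! ### The orthogonal part of an invertible matrix -/

section PolarPart

open scoped Matrix.Norms.L2Operator

variable {n : ℕ}

/-- Multiplying by `Dᵀ` and taking traces makes the nonnegative numbers `tr(DᵀBD)` and `tr(DCDᵀ)`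
add up to zero; then `DᵀBD = 0`, and `D = 0` because `B` is definite. This gives both uniqueness of
positive square roots and invertibility of the derivative of squaring. -/
theorem Matrix.PosDef.eq_zero_of_sylvester {B C D : Matrix (Fin n) (Fin n) ℝ} (hB : B.PosDef)
    (hC : C.PosDef) (h : B * D + D * C = 0) : D = 0 := by
  have h1 : (Dᵀ * B * D).PosSemidef := hB.posSemidef.conjTranspose_mul_mul_same D
  have h2 : (D * C * Dᵀ).PosSemidef := hC.posSemidef.mul_mul_conjTranspose_same D
  have h3 : (Dᵀ * B * D).trace + (D * C * Dᵀ).trace = 0 := by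
    rw [Matrix.trace_mul_comm (D * C), ← Matrix.trace_add, Matrix.mul_assoc, ← Matrix.mul_add, h,
      Matrix.mul_zero, Matrix.trace_zero]
  have h4 : (Dᵀ * B * D).trace = 0 := by
    linarith [h1.trace_nonneg, h2.trace_nonneg]
  have h5 : Dᵀ * B * D = 0 := h1.trace_eq_zero_iff.1 h4
  by_contra hD
  obtain ⟨v, hv⟩ : ∃ v, D *ᵥ v ≠ 0 := by
    by_contra! h6
    exact hD (Matrix.ext_of_mulVec_single fun i => by rw [h6, Matrix.zero_mulVec])
  have h6 := hB.dotProduct_mulVec_pos hv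
  have h7 : star (D *ᵥ v) ⬝ᵥ B *ᵥ D *ᵥ v = v ⬝ᵥ (Dᵀ * B * D) *ᵥ v := by
    rw [← mulVec_mulVec, ← mulVec_mulVec, dotProduct_mulVec v, vecMul_transpose, star_trivial]
  rw [h7, h5, zero_mulVec, dotProduct_zero] at h6
  exact lt_irrefl _ h6

/-- `B(B - C) + (B - C)C = B² - C²`. -/
theorem Matrix.PosDef.eq_of_mul_self_eq {B C : Matrix (Fin n) (Fin n) ℝ} (hB : B.PosDef)
    (hC : C.PosDef) (h : B * B = C * C) : B = C := by
  refine sub_eq_zero.1 (hB.eq_zero_of_sylvester hC ?_)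
  rw [Matrix.mul_sub, Matrix.sub_mul, h]
  abel

theorem Matrix.PosDef.exists_mul_self_eq {A : Matrix (Fin n) (Fin n) ℝ} (hA : A.PosDef) :
    ∃ B : Matrix (Fin n) (Fin n) ℝ, B.PosDef ∧ B * B = A := by
  open scoped MatrixOrder in
  have h1 : CFC.sqrt A * CFC.sqrt A = A := CFC.sqrt_mul_sqrt_self A hA.posSemidef.nonneg
  open scoped MatrixOrder in
  have h2 : (CFC.sqrt A).PosSemidef := (CFC.sqrt_nonneg A).posSemidef
  refine ⟨_, h2.posDef_iff_isUnit.2 ?_, h1⟩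
  have h3 := hA.isUnit
  rw [← h1] at h3
  exact isUnit_of_mul_isUnit_left h3

/-- The unit sphere is compact and the form is homogeneous. The nearby `F` need not be symmetric, so
this applies to values of a local inverse before their symmetry is known. -/
theorem Matrix.PosDef.eventually_dotProduct_pos {B : Matrix (Fin n) (Fin n) ℝ} (hB : B.PosDef) :
    ∀ᶠ F in 𝓝 B, ∀ x : Fin n → ℝ, x ≠ 0 → 0 < x ⬝ᵥ F *ᵥ x := by
  have h1 : ∀ᶠ F in 𝓝 B, ∀ x ∈ Metric.sphere (0 : Fin n → ℝ) 1, 0 < x ⬝ᵥ F *ᵥ x := by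
    refine (isCompact_sphere _ _).eventually_forall_of_forall_eventually fun x hx => ?_
    have hx0 : x ≠ 0 := by
      rintro rfl
      simp at hx
    have h2 : Continuous fun p : Matrix (Fin n) (Fin n) ℝ × (Fin n → ℝ) => p.2 ⬝ᵥ p.1 *ᵥ p.2 :=
      continuous_snd.dotProduct (continuous_fst.matrix_mulVec continuous_snd)
    exact h2.continuousAt.eventually_mem (isOpen_Ioi.mem_nhds (by
      simpa using hB.dotProduct_mulVec_pos hx0))
  filter_upwards [h1] with F hF x hx
  have hx' : 0 < ‖x‖ := norm_pos_iff.2 hx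
  have h2 := hF (‖x‖⁻¹ • x) (by simp [norm_smul, hx'.ne'])
  rw [mulVec_smul, smul_dotProduct, dotProduct_smul, smul_eq_mul, smul_eq_mul, ← mul_assoc] at h2
  exact pos_of_mul_pos_right h2 (by positivity)

/-- `Q` is the orthogonal part of the invertible matrix `T`, i.e. the orthogonal factor in its polar
decomposition. -/
def IsPolarPart (T Q : Matrix (Fin n) (Fin n) ℝ) : Prop := Qᵀ * Q = 1 ∧ (Qᵀ * T).PosDef

theorem IsPolarPart.mul_transpose {T Q : Matrix (Fin n) (Fin n) ℝ} (h : IsPolarPart T Q) :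
    Q * Qᵀ = 1 := mul_eq_one_comm.1 h.1

theorem IsPolarPart.transpose_mul_self {T Q : Matrix (Fin n) (Fin n) ℝ} (h : IsPolarPart T Q) :
    (Qᵀ * T) * (Qᵀ * T) = Tᵀ * T := by
  have h1 : (Qᵀ * T)ᵀ = Qᵀ * T := h.2.isHermitian
  calc (Qᵀ * T) * (Qᵀ * T) = (Qᵀ * T)ᵀ * (Qᵀ * T) := by rw [h1]
    _ = Tᵀ * (Q * Qᵀ) * T := by
      rw [Matrix.transpose_mul, Matrix.transpose_transpose]; simp only [Matrix.mul_assoc]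
    _ = Tᵀ * T := by rw [h.mul_transpose, Matrix.mul_one]

/-- `QᵀT` is the positive square root of `TᵀT`, hence determined by `T`, and `T` can be cancelled.
Through this uniqueness every orthogonal symmetry of `T` passes to `Q`. -/
theorem IsPolarPart.unique {T Q Q' : Matrix (Fin n) (Fin n) ℝ} (h : IsPolarPart T Q)
    (h' : IsPolarPart T Q') : Q = Q' := by
  have h1 : Qᵀ * T = Q'ᵀ * T :=
    h.2.eq_of_mul_self_eq h'.2 (by rw [h.transpose_mul_self, h'.transpose_mul_self])
  have hT : IsUnit T := isUnit_of_mul_isUnit_right h.2.isUnit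
  exact Matrix.transpose_injective (hT.mul_right_cancel h1)

theorem isPolarPart_of_mul_self_eq {T F : Matrix (Fin n) (Fin n) ℝ} (hF : F.PosDef)
    (h : F * F = Tᵀ * T) : IsPolarPart T (T * F⁻¹) := by
  have hu : IsUnit F.det := (Matrix.isUnit_iff_isUnit_det _).1 hF.isUnit
  have h1 : (T * F⁻¹)ᵀ = F⁻¹ * Tᵀ := by
    have h2 : Fᵀ = F := hF.isHermitian
    rw [Matrix.transpose_mul, Matrix.transpose_nonsing_inv, h2]
  have h2 : (T * F⁻¹)ᵀ * T = F := by
    rw [h1, Matrix.mul_assoc, ← h, ← Matrix.mul_assoc, Matrix.nonsing_inv_mul _ hu, Matrix.one_mul]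
  refine ⟨?_, by rwa [h2]⟩
  rw [← Matrix.mul_assoc, h2, Matrix.mul_nonsing_inv _ hu]

theorem posDef_transpose_mul_self {T : Matrix (Fin n) (Fin n) ℝ} (hT : IsUnit T) :
    (Tᵀ * T).PosDef :=
  Matrix.PosDef.conjTranspose_mul_self T (Matrix.mulVec_injective_iff_isUnit.2 hT)

theorem exists_isPolarPart {T : Matrix (Fin n) (Fin n) ℝ} (hT : IsUnit T) :
    ∃ Q, IsPolarPart T Q := by
  obtain ⟨F, hF, hFF⟩ := (posDef_transpose_mul_self hT).exists_mul_self_eq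
  exact ⟨_, isPolarPart_of_mul_self_eq hF hFF⟩

/-- The orthogonal part of a matrix. -/
def polarPart (T : Matrix (Fin n) (Fin n) ℝ) : Matrix (Fin n) (Fin n) ℝ :=
  Classical.epsilon (IsPolarPart T)

theorem isPolarPart_polarPart {T : Matrix (Fin n) (Fin n) ℝ} (hT : IsUnit T) :
    IsPolarPart T (polarPart T) := Classical.epsilon_spec (exists_isPolarPart hT)

theorem IsPolarPart.eq_polarPart {T Q : Matrix (Fin n) (Fin n) ℝ} (h : IsPolarPart T Q) :
    polarPart T = Q :=
  (isPolarPart_polarPart (isUnit_of_mul_isUnit_right h.2.isUnit)).unique h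

theorem contDiff_matrix_transpose :
    ContDiff ℝ ∞ (Matrix.transpose : Matrix (Fin n) (Fin n) ℝ → Matrix (Fin n) (Fin n) ℝ) :=
  (LinearMap.toContinuousLinearMap
    (Matrix.transposeLinearEquiv (Fin n) (Fin n) ℝ ℝ).toLinearMap).contDiff

theorem contDiffAt_matrix_inv {A : Matrix (Fin n) (Fin n) ℝ} (hA : IsUnit A) :
    ContDiffAt ℝ ∞ (fun X : Matrix (Fin n) (Fin n) ℝ => X⁻¹) A := by
  obtain ⟨u, rfl⟩ := hA
  have h1 := contDiffAt_ringInverse ℝ (n := ∞) u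
  refine h1.congr_of_eventuallyEq (Filter.Eventually.of_forall fun X => ?_)
  exact Matrix.nonsing_inv_eq_ringInverse X

/-- Near a positive definite matrix, the square root of a positive definite matrix is given by a
smooth function. -/
theorem exists_contDiffAt_sqrt {B : Matrix (Fin n) (Fin n) ℝ} (hB : B.PosDef) :
    ∃ F : Matrix (Fin n) (Fin n) ℝ → Matrix (Fin n) (Fin n) ℝ, ContDiffAt ℝ ∞ F (B * B) ∧
      F (B * B) = B ∧
      ∀ᶠ C in 𝓝 (B * B), C.IsHermitian → (F C).PosDef ∧ F C * F C = C := by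
  let sq : Matrix (Fin n) (Fin n) ℝ → Matrix (Fin n) (Fin n) ℝ := fun X => X * X
  have hsq : ContDiffAt ℝ ∞ sq B := contDiffAt_id.mul contDiffAt_id
  let L : Matrix (Fin n) (Fin n) ℝ →ₗ[ℝ] Matrix (Fin n) (Fin n) ℝ :=
    LinearMap.mulLeft ℝ B + LinearMap.mulRight ℝ B
  -- `L` is the derivative of squaring at `B`; its injectivity makes the inverse function theorem
  -- available.
  have hL : Function.Injective L := by
    refine (injective_iff_map_eq_zero L).2 fun D hD => hB.eq_zero_of_sylvester hB ?_
    simpa [L] using hD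
  let e := (LinearEquiv.ofInjectiveEndo L hL).toContinuousLinearEquiv
  have he : HasFDerivAt sq (e : Matrix (Fin n) (Fin n) ℝ →L[ℝ] Matrix (Fin n) (Fin n) ℝ) B := by
    refine (HasFDerivAt.mul' (hasFDerivAt_id B) (hasFDerivAt_id B)).congr_fderiv ?_
    ext1 D
    change B * D + D * B = L D
    simp [L]
  have hn : (∞ : WithTop ℕ∞) ≠ 0 := by simp
  let F := hsq.localInverse he hn
  have hFc : ContDiffAt ℝ ∞ F (B * B) := hsq.to_localInverse he hn
  have hFB : F (B * B) = B := hsq.localInverse_apply_image he hn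
  have hright : ∀ᶠ C in 𝓝 (B * B), sq (F C) = C :=
    (hsq.hasStrictFDerivAt' he hn).eventually_right_inverse
  have hleft : ∀ᶠ X in 𝓝 B, F (sq X) = X :=
    (hsq.hasStrictFDerivAt' he hn).eventually_left_inverse
  have hFt : Filter.Tendsto F (𝓝 (B * B)) (𝓝 B) := by
    have := hFc.continuousAt.tendsto
    rwa [hFB] at this
  have hBt : Bᵀ = B := hB.isHermitian
  have hFt' : Filter.Tendsto (fun C => (F C)ᵀ) (𝓝 (B * B)) (𝓝 B) := by
    have h1 := (contDiff_matrix_transpose (n := n)).continuous.tendsto B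
    rw [hBt] at h1
    exact h1.comp hFt
  refine ⟨F, hFc, hFB, ?_⟩
  filter_upwards [hright, hFt'.eventually hleft, hFt.eventually hleft,
    hFt.eventually hB.eventually_dotProduct_pos] with C h1 h2 h3 h4 hC
  have hCt : Cᵀ = C := hC
  -- The transpose of `F C` is also close to `B` and has square `Cᵀ = C`, so the local inverse
  -- identifies it with `F C`.
  have h5 : (F C)ᵀ = F C := by
    rw [← h2]
    change F ((F C)ᵀ * (F C)ᵀ) = F C
    rw [← Matrix.transpose_mul]
    change F (sq (F C))ᵀ = F C
    rw [h1, hCt]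
  exact ⟨Matrix.PosDef.of_dotProduct_mulVec_pos h5 fun x hx => by simpa using h4 x hx, h1⟩

/-- Near `T` the orthogonal part of `X` is `X (XᵀX)^{-1/2}`, with the smooth local square root. -/
theorem contDiffAt_polarPart {T : Matrix (Fin n) (Fin n) ℝ} (hT : IsUnit T) :
    ContDiffAt ℝ ∞ polarPart T := by
  obtain ⟨B, hB, hBB⟩ := (posDef_transpose_mul_self hT).exists_mul_self_eq
  obtain ⟨F, hF, hFB, hF'⟩ := exists_contDiffAt_sqrt hB
  have h1 : ContDiff ℝ ∞ fun X : Matrix (Fin n) (Fin n) ℝ => Xᵀ * X :=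
    contDiff_matrix_transpose.mul contDiff_id
  have h2 : ContDiffAt ℝ ∞ (fun X : Matrix (Fin n) (Fin n) ℝ => X * (F (Xᵀ * X))⁻¹) T := by
    rw [hBB] at hF hFB
    refine contDiffAt_id.mul ?_
    refine ContDiffAt.comp T (g := fun Y : Matrix (Fin n) (Fin n) ℝ => Y⁻¹)
      (contDiffAt_matrix_inv ?_) 
      (ContDiffAt.comp (f := fun X : Matrix (Fin n) (Fin n) ℝ => Xᵀ * X) T hF h1.contDiffAt)
    rw [hFB]
    exact hB.isUnit
  refine h2.congr_of_eventuallyEq ?_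
  have h3 := h1.continuous.tendsto T
  rw [← hBB] at h3
  filter_upwards [h3.eventually hF'] with X hX
  obtain ⟨h4, h5⟩ := hX (Matrix.isHermitian_conjTranspose_mul_self X)
  exact (isPolarPart_of_mul_self_eq h4 h5).eq_polarPart

end PolarPart

end

noncomputable section

/-! ### Eigenvalues and exponentials -/

section Eigen

variable {n : ℕ}

/-- The matrix `M` with all columns equal to `v` intertwines `lam • 1` and `A`, and intertwining
passes to exponentials. -/
theorem exp_mulVec_of_mulVec_eq_smul {A : Matrix (Fin n) (Fin n) ℂ} {v : Fin n → ℂ} {lam : ℂ}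
    (h : A *ᵥ v = lam • v) : NormedSpace.exp A *ᵥ v = Complex.exp lam • v := by
  let M : Matrix (Fin n) (Fin n) ℂ := Matrix.of fun i _ => v i
  have hcol : ∀ B : Matrix (Fin n) (Fin n) ℂ, ∀ i j, (B * M) i j = (B *ᵥ v) i := fun B i j => rfl
  have h1 : SemiconjBy M (lam • (1 : Matrix (Fin n) (Fin n) ℂ)) A := by
    ext i j
    rw [hcol, h, mul_smul_comm, Matrix.mul_one]
    rfl
  have h2 : NormedSpace.exp (lam • (1 : Matrix (Fin n) (Fin n) ℂ)) = Complex.exp lam • 1 := by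
    rw [← Matrix.diagonal_one, ← Matrix.diagonal_smul, Matrix.exp_diagonal,
      ← Matrix.diagonal_smul]
    congr 1
    funext i
    rw [Pi.coe_exp, Complex.exp_eq_exp_ℂ]
    simp
  have h3 : SemiconjBy M (NormedSpace.exp (lam • (1 : Matrix (Fin n) (Fin n) ℂ)))
      (NormedSpace.exp A) := by
    open scoped Matrix.Norms.Operator in
    exact h1.exp_right
  funext i
  have h4 := congrFun (congrFun h3 i) i
  rw [hcol, h2, mul_smul_comm, Matrix.mul_one] at h4
  exact h4.symm

theorem cplx_mulVec_re {A : Matrix (Fin n) (Fin n) ℝ} (v : Fin n → ℂ) (i : Fin n) :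
    ((cplx A *ᵥ v) i).re = (A *ᵥ fun j => (v j).re) i := by
  simp [mulVec, dotProduct, cplx]

theorem cplx_mulVec_im {A : Matrix (Fin n) (Fin n) ℝ} (v : Fin n → ℂ) (i : Fin n) :
    ((cplx A *ᵥ v) i).im = (A *ᵥ fun j => (v j).im) i := by
  simp [mulVec, dotProduct, cplx]

/-- The real and imaginary parts of an eigenvector for a real eigenvalue are eigenvectors. -/
theorem exists_real_eigenvector {A : Matrix (Fin n) (Fin n) ℝ} {v : Fin n → ℂ} (hv : v ≠ 0) {c : ℝ}
    (h : cplx A *ᵥ v = (c : ℂ) • v) : ∃ x : Fin n → ℝ, x ≠ 0 ∧ A *ᵥ x = c • x := by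
  have hre : A *ᵥ (fun j => (v j).re) = c • fun j => (v j).re := by
    funext i
    rw [← cplx_mulVec_re, h]
    simp
  have him : A *ᵥ (fun j => (v j).im) = c • fun j => (v j).im := by
    funext i
    rw [← cplx_mulVec_im, h]
    simp
  by_cases h0 : (fun j => (v j).re) = 0
  · refine ⟨_, fun h1 => hv ?_, him⟩
    funext j
    exact Complex.ext (congrFun h0 j) (congrFun h1 j)
  · exact ⟨_, h0, hre⟩

theorem isCEigenvalue_of_real {A : Matrix (Fin n) (Fin n) ℝ} {x : Fin n → ℝ} (hx : x ≠ 0) {c : ℝ}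
    (h : A *ᵥ x = c • x) : IsCEigenvalue A c := by
  refine isCEigenvalue_iff.2 ⟨fun i => (x i : ℂ), fun h0 => hx ?_, ?_⟩
  · funext i
    exact Complex.ofReal_injective (congrFun h0 i)
  · funext i
    refine Complex.ext ?_ ?_
    · rw [cplx_mulVec_re]
      simpa using congrFun h i
    · rw [cplx_mulVec_im]
      simp [mulVec, dotProduct]

theorem isCEigenvalue_neg_one_iff {A : Matrix (Fin n) (Fin n) ℝ} :
    IsCEigenvalue A (-1) ↔ ¬ IsUnit (1 + A) := by
  rw [Matrix.isUnit_iff_isUnit_det, isUnit_iff_ne_zero, not_not, ← Matrix.exists_mulVec_eq_zero_iff]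
  constructor
  · intro h
    obtain ⟨v, hv, h⟩ := isCEigenvalue_iff.1 h
    obtain ⟨x, hx, h⟩ := exists_real_eigenvector (c := -1) hv (by simpa using h)
    exact ⟨x, hx, by rw [add_mulVec, h, one_mulVec, neg_one_smul, add_neg_cancel]⟩
  · rintro ⟨x, hx, h⟩
    have := isCEigenvalue_of_real (c := -1) hx (by
      rw [add_mulVec, one_mulVec] at h
      rw [neg_one_smul]
      exact eq_neg_of_add_eq_zero_right h)
    simpa using this

/-- Compare the sup norms of the two sides of the eigenvector equation. This turns bounds on entries
into bounds on frequencies. -/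
theorem IsCEigenvalue.norm_le {A : Matrix (Fin n) (Fin n) ℝ} {lam : ℂ} (h : IsCEigenvalue A lam)
    {K : ℝ} (hK : ∀ i j, |A i j| ≤ K) : ‖lam‖ ≤ n * K := by
  obtain ⟨v, hv, h⟩ := isCEigenvalue_iff.1 h
  have hv' : 0 < ‖v‖ := norm_pos_iff.2 hv
  refine le_of_mul_le_mul_right ?_ hv'
  rw [← norm_smul, ← h]
  have hK0 : 0 ≤ n * K * ‖v‖ := by
    rcases Nat.eq_zero_or_pos n with rfl | hn
    · simp
    · have : 0 ≤ K := (abs_nonneg _).trans (hK ⟨0, hn⟩ ⟨0, hn⟩)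
      positivity
  refine (pi_norm_le_iff_of_nonneg hK0).2 fun i => ?_
  calc ‖(cplx A *ᵥ v) i‖ ≤ ∑ j, ‖cplx A i j * v j‖ :=
        norm_sum_le Finset.univ fun j => cplx A i j * v j
    _ ≤ ∑ _j : Fin n, K * ‖v‖ := by
      refine Finset.sum_le_sum fun j _ => ?_
      rw [norm_mul]
      refine mul_le_mul ?_ (norm_le_pi_norm v j) (norm_nonneg _) ((abs_nonneg _).trans (hK i j))
      simpa [cplx] using hK i j
    _ = n * K * ‖v‖ := by simp [mul_assoc]

theorem IsCEigenvalue.re_eq_zero {X : Matrix (Fin n) (Fin n) ℝ}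
    (hX : X ∈ LieAlgebra.Orthogonal.so (Fin n) ℝ) {lam : ℂ} (h : IsCEigenvalue X lam) :
    lam.re = 0 := by
  rw [LieAlgebra.Orthogonal.mem_so] at hX
  obtain ⟨v, hv, h⟩ := isCEigenvalue_iff.1 h
  have h1 : star v ⬝ᵥ cplx X *ᵥ v = lam * (star v ⬝ᵥ v) := by
    rw [h, dotProduct_smul, smul_eq_mul]
  have h2 : star v ⬝ᵥ cplx X *ᵥ v = -star lam * (star v ⬝ᵥ v) := by
    have h3 : cplx X = -(cplx X)ᴴ := by rw [cplx_conjTranspose, hX, cplx_neg, neg_neg]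
    rw [h3, neg_mulVec, dotProduct_neg, dotProduct_mulVec, ← star_mulVec, h, star_smul,
      smul_dotProduct, smul_eq_mul, neg_mul]
  have h3 : star v ⬝ᵥ v ≠ 0 := by
    open scoped ComplexOrder in
    exact fun h0 => hv (dotProduct_star_self_eq_zero.1 h0)
  have h4 : lam = -star lam := mul_right_cancel₀ h3 (h1.symm.trans h2)
  have h5 := congrArg Complex.re h4
  simp at h5
  linarith

end Eigen

/-! ### Square roots of orthogonal matrices without eigenvalue `-1` -/

section SquareRoot

open scoped Matrix.Norms.L2Operator

variable {n : ℕ}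

/-- The orthogonal matrices without eigenvalue `-1`. -/
def regularOrthogonal (n : ℕ) : Set (Matrix (Fin n) (Fin n) ℝ) :=
  {A | Aᵀ * A = 1 ∧ IsUnit (1 + A)}

/-- Both conditions on `Q` are invariant under orthogonal factors on either side. -/
theorem IsPolarPart.mul_mul {T Q U V : Matrix (Fin n) (Fin n) ℝ} (h : IsPolarPart T Q)
    (hU : Uᵀ * U = 1) (hV : Vᵀ * V = 1) : IsPolarPart (U * T * V) (U * Q * V) := by
  have hV' : IsUnit V := IsUnit.of_mul_eq_one_right _ hV
  have h1 : ∀ S : Matrix (Fin n) (Fin n) ℝ, (U * Q * V)ᵀ * (U * S * V) = Vᵀ * (Qᵀ * S) * V := by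
    intro S
    calc (U * Q * V)ᵀ * (U * S * V) = Vᵀ * (Qᵀ * (Uᵀ * U) * S) * V := by
          simp only [Matrix.transpose_mul, Matrix.mul_assoc]
      _ = Vᵀ * (Qᵀ * S) * V := by rw [hU, Matrix.mul_one]
  refine ⟨?_, ?_⟩
  · rw [h1, h.1, Matrix.mul_one, hV]
  · rw [h1]
    exact h.2.conjTranspose_mul_mul_same (Matrix.mulVec_injective_iff_isUnit.2 hV')

section

variable {A : Matrix (Fin n) (Fin n) ℝ}

/-- Conjugation by `A` fixes `1 + A`, hence its orthogonal part. -/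
theorem polarPart_commute (hA : A ∈ regularOrthogonal n) : polarPart (1 + A) * A =
    A * polarPart (1 + A) := by
  have hA' : A * Aᵀ = 1 := mul_eq_one_comm.1 hA.1
  have h1 := (isPolarPart_polarPart hA.2).mul_mul (U := A) (V := Aᵀ) hA.1
    (by rwa [Matrix.transpose_transpose])
  rw [Matrix.mul_add, Matrix.mul_one, Matrix.add_mul, Matrix.mul_assoc A A, hA',
    Matrix.mul_one] at h1
  have h2 := h1.eq_polarPart
  nth_rw 1 [h2]
  rw [Matrix.mul_assoc, hA.1, Matrix.mul_one]

/-- For `|θ| < π` one has `1 + e^{iθ} = 2 cos(θ/2) e^{iθ/2}`: the phase of `1 + A` is a square root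
of `A`. Algebraically, symmetry of `Qᵀ(1 + A)` and commutation of `Q` with `A` give `Qᵀ = AᵀQ`. -/
theorem polarPart_one_add_mul_self (hA : A ∈ regularOrthogonal n) :
    polarPart (1 + A) * polarPart (1 + A) = A := by
  have hQ := isPolarPart_polarPart hA.2
  have hc := polarPart_commute hA
  set Q := polarPart (1 + A)
  have hA' : A * Aᵀ = 1 := mul_eq_one_comm.1 hA.1
  have h1 : (Qᵀ * (1 + A))ᵀ = Qᵀ * (1 + A) := hQ.2.isHermitian
  have h2 : Qᵀ * (1 + A) = Aᵀ * Q * (1 + A) := by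
    rw [← h1, Matrix.transpose_mul, Matrix.transpose_transpose, Matrix.transpose_add,
      Matrix.transpose_one, Matrix.mul_add, Matrix.mul_assoc _ Q A, hc, ← Matrix.mul_assoc, hA.1,
      Matrix.mul_one, Matrix.one_mul, Matrix.add_mul, Matrix.one_mul, add_comm]
  have h3 : Qᵀ = Aᵀ * Q := hA.2.mul_right_cancel h2
  calc Q * Q = A * (Aᵀ * Q) * Q := by rw [← Matrix.mul_assoc, hA', Matrix.one_mul]
    _ = A := by rw [← h3, Matrix.mul_assoc, hQ.1, Matrix.mul_one]

/-- Because `A = Q²`, the positive factor `Qᵀ(1 + A)` equals `Q + Qᵀ`. So `Q` has only eigenvalues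
of positive real part. -/
theorem posDef_polarPart_add_transpose (hA : A ∈ regularOrthogonal n) :
    (polarPart (1 + A) + (polarPart (1 + A))ᵀ).PosDef := by
  have hQ := isPolarPart_polarPart hA.2
  have h := polarPart_one_add_mul_self hA
  have h1 := hQ.2
  set Q := polarPart (1 + A)
  rw [Matrix.mul_add, Matrix.mul_one, ← h, ← Matrix.mul_assoc, hQ.1, Matrix.one_mul, add_comm] at h1
  exact h1

theorem polarPart_mem_regularOrthogonal (hA : A ∈ regularOrthogonal n) :
    polarPart (1 + A) ∈ regularOrthogonal n := by
  have hQ := isPolarPart_polarPart hA.2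
  have h1 := posDef_polarPart_add_transpose hA
  set Q := polarPart (1 + A)
  refine ⟨hQ.1, ?_⟩
  have h2 : (1 + Q)ᵀ * (1 + Q) = (Q + Qᵀ) + (1 + 1) := by
    rw [Matrix.transpose_add, Matrix.transpose_one, Matrix.mul_add, Matrix.mul_one, Matrix.add_mul,
      hQ.1, Matrix.one_mul]
    abel
  have h3 : ((1 + Q)ᵀ * (1 + Q)).PosDef := by
    rw [h2]
    exact h1.add (Matrix.PosDef.one.add Matrix.PosDef.one)
  exact isUnit_of_mul_isUnit_right h3.isUnit

theorem norm_sq_toEuclideanCLM (B : Matrix (Fin n) (Fin n) ℝ) (x : EuclideanSpace ℝ (Fin n)) :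
    ‖toEuclideanCLM (𝕜 := ℝ) B x‖ ^ 2 = x.ofLp ⬝ᵥ (Bᵀ * B) *ᵥ x.ofLp := by
  rw [← real_inner_self_eq_norm_sq, inner_toEuclideanCLM, ofLp_toEuclideanCLM, ← mulVec_mulVec,
    dotProduct_mulVec x.ofLp, vecMul_transpose]

/-- With `A = Q²`, `A - 1 = (Q + 1)(Q - 1)`, and `‖(Q + 1)y‖² = y · (Q + Qᵀ)y + 2‖y‖² ≥ 2‖y‖²`. -/
theorem norm_polarPart_sub_one_le (hA : A ∈ regularOrthogonal n) :
    Real.sqrt 2 * ‖polarPart (1 + A) - 1‖ ≤ ‖A - 1‖ := by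
  have hQ := isPolarPart_polarPart hA.2
  have h1 := posDef_polarPart_add_transpose hA
  have h2 := polarPart_one_add_mul_self hA
  set Q := polarPart (1 + A)
  have hs : 0 < Real.sqrt 2 := by positivity
  have hfac : A - 1 = (Q + 1) * (Q - 1) := by rw [← h2]; noncomm_ring
  have hkey : ∀ x : EuclideanSpace ℝ (Fin n), Real.sqrt 2 * ‖toEuclideanCLM (𝕜 := ℝ) (Q - 1) x‖ ≤
      ‖A - 1‖ * ‖x‖ := by
    intro x
    refine le_trans ?_ (l2_opNorm_mulVec (A - 1) x)
    refine le_of_sq_le_sq ?_ (norm_nonneg _)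
    set y := toEuclideanCLM (𝕜 := ℝ) (Q - 1) x with hy
    have h3 : (WithLp.toLp 2 ((A - 1) *ᵥ x.ofLp) : EuclideanSpace ℝ (Fin n)) =
        toEuclideanCLM (𝕜 := ℝ) (Q + 1) y := by
      rw [hy, ← mul_apply_eq_comp, ← map_mul, ← hfac]
      rfl
    have h3' := congrArg (fun z : EuclideanSpace ℝ (Fin n) => ‖z‖ ^ 2) h3
    refine le_of_le_of_eq ?_ h3'.symm
    rw [norm_sq_toEuclideanCLM, mul_pow, Real.sq_sqrt zero_le_two]
    have h4 : (Q + 1)ᵀ * (Q + 1) = (Q + Qᵀ) + (2 : ℝ) • (1 : Matrix (Fin n) (Fin n) ℝ) := by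
      rw [Matrix.transpose_add, Matrix.transpose_one, Matrix.mul_add, Matrix.mul_one,
        Matrix.add_mul, hQ.1, Matrix.one_mul, two_smul]
      abel
    have h5 : ‖y‖ ^ 2 = y.ofLp ⬝ᵥ y.ofLp := by
      rw [EuclideanSpace.real_norm_sq_eq, dotProduct]
      exact Finset.sum_congr rfl fun i _ => sq _
    have h6 : 0 ≤ y.ofLp ⬝ᵥ (Q + Qᵀ) *ᵥ y.ofLp := by
      simpa using h1.posSemidef.dotProduct_mulVec_nonneg y.ofLp
    rw [h4, add_mulVec, dotProduct_add, smul_mulVec, one_mulVec, dotProduct_smul, smul_eq_mul, h5]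
    linarith
  rw [mul_comm, ← le_div_iff₀ hs]
  refine ContinuousLinearMap.opNorm_le_bound _ (by positivity) fun x => ?_
  rw [div_mul_eq_mul_div, le_div_iff₀ hs, mul_comm]
  exact hkey x

end

/-! ### The logarithm -/

theorem contDiff_matrix_exp :
    ContDiff ℝ ω (NormedSpace.exp : Matrix (Fin n) (Fin n) ℝ → Matrix (Fin n) (Fin n) ℝ) :=
  contDiff_iff_contDiffAt.2 fun X => (NormedSpace.exp_analytic (𝕂 := ℝ) X).contDiffAt

theorem logZero_exp {X : Matrix (Fin n) (Fin n) ℝ} (hX : X ∈ logRange n) :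
    logZero n (NormedSpace.exp X) = X :=
  exp_injOn_logRange.leftInvOn_invFunOn hX

/-- Eigenvalues are at most `n / (n + 1) ≤ 1 < π` in modulus. -/
theorem mem_logRange_of_abs_lt {X : Matrix (Fin n) (Fin n) ℝ}
    (hX : X ∈ LieAlgebra.Orthogonal.so (Fin n) ℝ) (h : ∀ i j : Fin n, |X i j| < 1 / ((n : ℝ) + 1)) :
    X ∈ logRange n := by
  refine ⟨hX, fun lam hlam => ?_⟩
  have h1 := hlam.norm_le fun i j => (h i j).le
  have h2 : (n : ℝ) * (1 / (n + 1)) ≤ 1 := by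
    rw [mul_one_div, div_le_one (by positivity)]
    linarith
  have h3 := Complex.abs_im_le_norm lam
  have h4 := Real.pi_gt_three
  rw [mem_Ioo, ← abs_lt]
  linarith

/-- `L` is the local inverse of `exp` at `0`. For orthogonal `A` near `1`, `-(L A)ᵀ` is small and
also has exponential `A`, so it equals `L A`: the logarithm is skew-symmetric. -/
theorem exists_local_log : ∃ L : Matrix (Fin n) (Fin n) ℝ → Matrix (Fin n) (Fin n) ℝ,
    ∀ᶠ A in 𝓝 (1 : Matrix (Fin n) (Fin n) ℝ), ContDiffAt ℝ ∞ L A ∧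
      (Aᵀ * A = 1 → L A ∈ logRange n ∧ NormedSpace.exp (L A) = A) := by
  -- Regularity of class `ω` at a point spreads to a neighbourhood, which class `∞` at a point does
  -- not guarantee.
  have hexp : ContDiffAt ℝ ω (NormedSpace.exp : Matrix (Fin n) (Fin n) ℝ → _) 0 :=
    contDiff_matrix_exp.contDiffAt
  have he : HasFDerivAt (NormedSpace.exp : Matrix (Fin n) (Fin n) ℝ → _)
      ((ContinuousLinearEquiv.refl ℝ (Matrix (Fin n) (Fin n) ℝ) :
        Matrix (Fin n) (Fin n) ℝ ≃L[ℝ] _) : Matrix (Fin n) (Fin n) ℝ →L[ℝ] _) 0 :=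
    hasStrictFDerivAt_exp_zero.hasFDerivAt
  have hn : (ω : WithTop ℕ∞) ≠ 0 := by simp
  let L := hexp.localInverse he hn
  have h1 : ContDiffAt ℝ ω L 1 := by
    have := hexp.to_localInverse he hn
    rwa [NormedSpace.exp_zero] at this
  have hL1 : L 1 = 0 := by
    have := hexp.localInverse_apply_image he hn
    rwa [NormedSpace.exp_zero] at this
  have hright : ∀ᶠ A in 𝓝 (1 : Matrix (Fin n) (Fin n) ℝ), NormedSpace.exp (L A) = A := by
    have := (hexp.hasStrictFDerivAt' he hn).eventually_right_inverse
    rwa [NormedSpace.exp_zero] at this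
  have hleft : ∀ᶠ X in 𝓝 (0 : Matrix (Fin n) (Fin n) ℝ), L (NormedSpace.exp X) = X :=
    (hexp.hasStrictFDerivAt' he hn).eventually_left_inverse
  have ht : Filter.Tendsto L (𝓝 1) (𝓝 0) := by
    have := h1.continuousAt.tendsto
    rwa [hL1] at this
  have ht' : Filter.Tendsto (fun A => -(L A)ᵀ) (𝓝 1) (𝓝 0) := by
    have h2 : Filter.Tendsto (fun A : Matrix (Fin n) (Fin n) ℝ => -Aᵀ) (𝓝 0) (𝓝 (-0ᵀ)) :=
      (contDiff_matrix_transpose (n := n)).continuous.neg.tendsto 0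
    rw [Matrix.transpose_zero, neg_zero] at h2
    exact h2.comp ht
  have hsmall : ∀ᶠ X in 𝓝 (0 : Matrix (Fin n) (Fin n) ℝ), ∀ i j : Fin n, |X i j| < 1 / ((n : ℝ) + 1) := by
    refine Filter.eventually_all.2 fun i => Filter.eventually_all.2 fun j => ?_
    have h2 : Continuous fun X : Matrix (Fin n) (Fin n) ℝ => |X i j| :=
      (continuous_id.matrix_elem i j).abs
    refine h2.continuousAt.eventually_mem (isOpen_Iio.mem_nhds ?_)
    simp only [Matrix.zero_apply, abs_zero, mem_Iio]
    positivity
  refine ⟨L, ?_⟩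
  filter_upwards [h1.eventually (by simp), hright, ht'.eventually hleft, ht.eventually hsmall] with
    A h2 h3 h4 h5
  refine ⟨h2.of_le le_top, fun hA => ⟨mem_logRange_of_abs_lt ?_ h5, h3⟩⟩
  have h6 : NormedSpace.exp (-(L A)ᵀ) = A := by
    rw [Matrix.exp_neg, Matrix.exp_transpose, h3]
    exact Matrix.inv_eq_right_inv hA
  rw [h6] at h4
  rw [LieAlgebra.Orthogonal.mem_so]
  nth_rw 2 [h4]
  rw [neg_neg]

/-- An eigenvalue `iθ` of `Y` gives the eigenvalue `2 cos θ` of `exp Y + (exp Y)ᵀ`. Positivity then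
sharpens `|θ| < π` to `|θ| < π/2`, leaving room to double. -/
theorem two_smul_mem_logRange {Y : Matrix (Fin n) (Fin n) ℝ} (hY : Y ∈ logRange n)
    (hpos : (NormedSpace.exp Y + (NormedSpace.exp Y)ᵀ).PosDef) : (2 : ℝ) • Y ∈ logRange n := by
  refine ⟨Submodule.smul_mem _ _ hY.1, fun mu hmu => ?_⟩
  obtain ⟨v, hv, h⟩ := isCEigenvalue_iff.1 hmu
  have h1 : cplx Y *ᵥ v = (mu / 2) • v := by
    rw [cplx_smul, smul_mulVec] at h
    rw [div_eq_inv_mul, mul_smul, ← h, smul_smul]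
    norm_num
  have h2 : IsCEigenvalue Y (mu / 2) := isCEigenvalue_iff.2 ⟨v, hv, h1⟩
  have h3 := h2.re_eq_zero hY.1
  have h4 := hY.2 _ h2
  obtain ⟨th, hth⟩ : ∃ th : ℝ, mu / 2 = th * Complex.I :=
    ⟨(mu / 2).im, Complex.ext (by simp [h3]) (by simp)⟩
  rw [hth] at h1 h4
  have h5 : cplx (-Y) *ᵥ v = (-(th * Complex.I)) • v := by
    rw [cplx_neg, neg_mulVec, h1, neg_smul]
  have h6 : cplx (NormedSpace.exp Y + (NormedSpace.exp Y)ᵀ) *ᵥ v =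
      ((2 * Real.cos th : ℝ) : ℂ) • v := by
    have hYt : Yᵀ = -Y := (LieAlgebra.Orthogonal.mem_so _ _ _).1 hY.1
    rw [← Matrix.exp_transpose, hYt, cplx_add, add_mulVec, cplx_exp, cplx_exp,
      exp_mulVec_of_mulVec_eq_smul h1, exp_mulVec_of_mulVec_eq_smul h5, ← add_smul]
    congr 1
    push_cast
    rw [Complex.two_cos, neg_mul]
  obtain ⟨x, hx, h7⟩ := exists_real_eigenvector hv h6
  have h8 := hpos.dotProduct_mulVec_pos hx
  have h9 : 0 < x ⬝ᵥ x := by simpa using dotProduct_star_self_pos_iff.2 hx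
  rw [h7, dotProduct_smul, smul_eq_mul, star_trivial] at h8
  have hcos : 0 < Real.cos th := by
    have := pos_of_mul_pos_left h8 h9.le
    linarith
  have h10 : |th| < Real.pi / 2 := by
    by_contra! h11
    have h12 : |th| ≤ Real.pi := by
      simp only [Complex.mul_I_im, Complex.ofReal_re, mem_Ioo] at h4
      exact abs_le.2 ⟨h4.1.le, h4.2.le⟩
    have := Real.cos_nonpos_of_pi_div_two_le_of_le h11 (by linarith [Real.pi_pos])
    rw [Real.cos_abs] at this
    linarith
  have h11 : mu = 2 * (th * Complex.I) := by rw [← hth]; ring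
  have h12 : mu.im = 2 * th := by rw [h11]; simp
  rw [h12, mem_Ioo, ← abs_lt, abs_mul, abs_two]
  linarith

/-- Induction with `log A = 2 log Q`, `Q` the square root `polarPart (1 + A)`: passing to `Q`
shrinks the distance to `1` by `√2`, so each step enlarges the radius by that factor. -/
theorem exists_log_contDiffWithinAt_aux {L : Matrix (Fin n) (Fin n) ℝ → Matrix (Fin n) (Fin n) ℝ}
    {δ : ℝ} (hL : ∀ A : Matrix (Fin n) (Fin n) ℝ, ‖A - 1‖ < δ → ContDiffAt ℝ ∞ L A ∧
      (Aᵀ * A = 1 → L A ∈ logRange n ∧ NormedSpace.exp (L A) = A)) (k : ℕ) :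
    ∀ A ∈ regularOrthogonal n, ‖A - 1‖ < Real.sqrt 2 ^ k * δ →
      (logZero n A ∈ logRange n ∧ NormedSpace.exp (logZero n A) = A) ∧
        ContDiffWithinAt ℝ ∞ (logZero n) (regularOrthogonal n) A := by
  have hopen : ∀ r : ℝ, ∀ A : Matrix (Fin n) (Fin n) ℝ, ‖A - 1‖ < r →
      ∀ᶠ B in 𝓝[regularOrthogonal n] A, ‖B - 1‖ < r ∧ B ∈ regularOrthogonal n := by
    intro r A hA
    have h1 : Continuous fun B : Matrix (Fin n) (Fin n) ℝ => ‖B - 1‖ :=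
      (continuous_id.sub continuous_const).norm
    exact (h1.continuousAt.eventually_mem (isOpen_Iio.mem_nhds hA)).filter_mono
      nhdsWithin_le_nhds |>.and self_mem_nhdsWithin
  induction k with
  | zero =>
    intro A hA hA'
    rw [pow_zero, one_mul] at hA'
    have hlog : ∀ B ∈ regularOrthogonal n, ‖B - 1‖ < δ → logZero n B = L B := by
      intro B hB hB'
      obtain ⟨h1, h2⟩ := (hL B hB').2 hB.1
      rw [← logZero_exp h1, h2]
    refine ⟨?_, ?_⟩
    · rw [hlog A hA hA']
      exact (hL A hA').2 hA.1
    · refine (hL A hA').1.contDiffWithinAt.congr_of_eventuallyEq ?_ (hlog A hA hA')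
      filter_upwards [hopen δ A hA'] with B hB
      exact hlog B hB.2 hB.1
  | succ k ih =>
    have hs : 0 < Real.sqrt 2 := by positivity
    have hnext : ∀ A ∈ regularOrthogonal n, ‖A - 1‖ < Real.sqrt 2 ^ (k + 1) * δ →
        ‖polarPart (1 + A) - 1‖ < Real.sqrt 2 ^ k * δ := by
      intro A hA hA'
      have h1 := (norm_polarPart_sub_one_le hA).trans_lt hA'
      rw [pow_succ', mul_assoc] at h1
      exact lt_of_mul_lt_mul_left h1 hs.le
    have hlog : ∀ A ∈ regularOrthogonal n, ‖A - 1‖ < Real.sqrt 2 ^ (k + 1) * δ →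
        (2 : ℝ) • logZero n (polarPart (1 + A)) ∈ logRange n ∧
          NormedSpace.exp ((2 : ℝ) • logZero n (polarPart (1 + A))) = A ∧
          logZero n A = (2 : ℝ) • logZero n (polarPart (1 + A)) := by
      intro A hA hA'
      obtain ⟨⟨h1, h2⟩, -⟩ := ih _ (polarPart_mem_regularOrthogonal hA) (hnext A hA hA')
      have h3 : (2 : ℝ) • logZero n (polarPart (1 + A)) ∈ logRange n :=
        two_smul_mem_logRange h1 (by rw [h2]; exact posDef_polarPart_add_transpose hA)
      have h4 : NormedSpace.exp ((2 : ℝ) • logZero n (polarPart (1 + A))) = A := by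
        rw [two_smul, Matrix.exp_add_of_commute _ _ (Commute.refl _), h2,
          polarPart_one_add_mul_self hA]
      refine ⟨h3, h4, ?_⟩
      rw [← logZero_exp h3, h4]
    intro A hA hA'
    obtain ⟨h1, h2, h3⟩ := hlog A hA hA'
    refine ⟨by rw [h3]; exact ⟨h1, h2⟩, ?_⟩
    have h4 : ContDiffWithinAt ℝ ∞ (fun B => (2 : ℝ) • logZero n (polarPart (1 + B)))
        (regularOrthogonal n) A := by
      refine ContDiffWithinAt.const_smul _ ?_
      refine ContDiffWithinAt.comp (t := regularOrthogonal n) A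
        (ih _ (polarPart_mem_regularOrthogonal hA) (hnext A hA hA')).2 ?_
        fun B hB => polarPart_mem_regularOrthogonal hB
      exact ((contDiffAt_polarPart hA.2).comp A
        (contDiffAt_const.add contDiffAt_id)).contDiffWithinAt
    refine h4.congr_of_eventuallyEq ?_ h3
    filter_upwards [hopen _ A hA'] with B hB
    exact (hlog B hB.2 hB.1).2.2

/-- The logarithm is defined and smooth on the orthogonal matrices without eigenvalue `-1`. -/
theorem logZero_spec {A : Matrix (Fin n) (Fin n) ℝ} (hA : A ∈ regularOrthogonal n) :
    (logZero n A ∈ logRange n ∧ NormedSpace.exp (logZero n A) = A) ∧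
      ContDiffWithinAt ℝ ∞ (logZero n) (regularOrthogonal n) A := by
  obtain ⟨L, hL⟩ := exists_local_log (n := n)
  obtain ⟨δ, hδ, hL⟩ := Metric.eventually_nhds_iff.1 hL
  have h1 : Filter.Tendsto (fun k : ℕ => Real.sqrt 2 ^ k) Filter.atTop Filter.atTop :=
    tendsto_pow_atTop_atTop_of_one_lt (Real.lt_sqrt_of_sq_lt (by norm_num))
  obtain ⟨k, hk⟩ := ((h1.atTop_mul_const hδ).eventually_gt_atTop ‖A - 1‖).exists
  exact exists_log_contDiffWithinAt_aux (fun B hB => hL (by rwa [dist_eq_norm])) k A hA hk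

end SquareRoot

end

noncomputable section

/-! ### Spectral reflections -/

section SpectralReflection

variable {n : ℕ}

theorem SO.transpose_mul_self (h : SO n) :
    (h : Matrix (Fin n) (Fin n) ℝ)ᵀ * (h : Matrix (Fin n) (Fin n) ℝ) = 1 :=
  mul_eq_one_comm.1 ((mem_orthogonalGroup_iff _ _).1 (mem_specialOrthogonalGroup_iff.1 h.2).1)

theorem SO.mul_transpose_self (h : SO n) :
    (h : Matrix (Fin n) (Fin n) ℝ) * (h : Matrix (Fin n) (Fin n) ℝ)ᵀ = 1 :=
  mul_eq_one_comm.1 h.transpose_mul_self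

/-- The symmetric part of a matrix. -/
def symPart (A : Matrix (Fin n) (Fin n) ℝ) : Matrix (Fin n) (Fin n) ℝ := (2⁻¹ : ℝ) • (A + Aᵀ)

theorem symPart_transpose (A : Matrix (Fin n) (Fin n) ℝ) : (symPart A)ᵀ = symPart A := by
  rw [symPart, transpose_smul, transpose_add, transpose_transpose, add_comm]

/-- An orthogonal symmetric matrix with the properties of the orthogonal part of a symmetric
invertible matrix. -/
theorem IsPolarPart.of_symmetric {T Q : Matrix (Fin n) (Fin n) ℝ} (hT : Tᵀ = T)
    (h : IsPolarPart T Q) : Qᵀ = Q ∧ Q * Q = 1 ∧ Q * T = T * Q := by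
  have h1 : Qᵀ * T = T * Q := by
    have h2 : (Qᵀ * T)ᵀ = Qᵀ * T := h.2.isHermitian
    rw [← h2, transpose_mul, transpose_transpose, hT]
  -- For symmetric `T` the matrix `QT` is congruent to `QᵀT`, so `Qᵀ` is an orthogonal part too and
  -- equals `Q` by uniqueness.
  have h3 : IsPolarPart T Qᵀ := by
    refine ⟨by rw [transpose_transpose, h.mul_transpose], ?_⟩
    have h4 : Qᵀᵀ * T = Qᵀᵀ * (Qᵀ * T) * Qᵀ := by
      rw [h1, Matrix.mul_assoc, Matrix.mul_assoc, h.mul_transpose, Matrix.mul_one]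
    rw [h4]
    refine h.2.conjTranspose_mul_mul_same (B := Qᵀ) (Matrix.mulVec_injective_iff_isUnit.2 ?_)
    exact IsUnit.of_mul_eq_one _ h.1
  have h4 : Qᵀ = Q := h3.unique h
  rw [h4] at h1
  exact ⟨h4, by rw [← h.1, h4], h1⟩

/-- The reflection which is `-1` on `E_{-1}^r(h)` and `1` on `E_r^1(h)`. -/
def spectralReflection (r : ℝ) (A : Matrix (Fin n) (Fin n) ℝ) : Matrix (Fin n) (Fin n) ℝ :=
  polarPart (symPart A - r • (1 : Matrix (Fin n) (Fin n) ℝ))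

/-- The spectral gap, in terms of the symmetric part. -/
def HasGap (r : ℝ) (A : Matrix (Fin n) (Fin n) ℝ) : Prop :=
  IsUnit (symPart A - r • (1 : Matrix (Fin n) (Fin n) ℝ))

theorem symPart_sub_transpose (r : ℝ) (A : Matrix (Fin n) (Fin n) ℝ) :
    (symPart A - r • (1 : Matrix (Fin n) (Fin n) ℝ))ᵀ =
      symPart A - r • (1 : Matrix (Fin n) (Fin n) ℝ) := by
  rw [transpose_sub, transpose_smul, transpose_one, symPart_transpose]

namespace HasGap

variable {r : ℝ} {A : Matrix (Fin n) (Fin n) ℝ}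

theorem isPolarPart (hA : HasGap r A) :
    IsPolarPart (symPart A - r • (1 : Matrix (Fin n) (Fin n) ℝ)) (spectralReflection r A) :=
  isPolarPart_polarPart hA

theorem reflection_transpose (hA : HasGap r A) :
    (spectralReflection r A)ᵀ = spectralReflection r A :=
  (hA.isPolarPart.of_symmetric (symPart_sub_transpose r A)).1

theorem reflection_mul_self (hA : HasGap r A) :
    spectralReflection r A * spectralReflection r A = 1 :=
  (hA.isPolarPart.of_symmetric (symPart_sub_transpose r A)).2.1

theorem reflection_mulVec_self (hA : HasGap r A) (x : Fin n → ℝ) :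
    spectralReflection r A *ᵥ spectralReflection r A *ᵥ x = x := by
  rw [mulVec_mulVec, hA.reflection_mul_self, one_mulVec]

theorem dotProduct_reflection (hA : HasGap r A) (x y : Fin n → ℝ) :
    x ⬝ᵥ spectralReflection r A *ᵥ y = (spectralReflection r A *ᵥ x) ⬝ᵥ y := by
  rw [dotProduct_mulVec, ← mulVec_transpose, hA.reflection_transpose]

theorem reflection_commute (hA : HasGap r A) (hAo : A * Aᵀ = 1) :
    A * spectralReflection r A = spectralReflection r A * A := by
  have hAo' : Aᵀ * A = 1 := mul_eq_one_comm.1 hAo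
  have h1 := hA.isPolarPart.mul_mul (U := A) (V := Aᵀ) hAo' (by rwa [transpose_transpose])
  have h2 : A * (symPart A - r • (1 : Matrix (Fin n) (Fin n) ℝ)) * Aᵀ =
      symPart A - r • (1 : Matrix (Fin n) (Fin n) ℝ) := by
    rw [Matrix.mul_sub, Matrix.sub_mul, symPart]
    congr 1
    · rw [mul_smul_comm, smul_mul_assoc, Matrix.mul_add, Matrix.add_mul, Matrix.mul_assoc A A, hAo,
        Matrix.mul_one, Matrix.one_mul]
    · rw [mul_smul_comm, smul_mul_assoc, Matrix.mul_one, hAo]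
  rw [h2] at h1
  have h3 := h1.unique hA.isPolarPart
  nth_rw 2 [← h3]
  rw [Matrix.mul_assoc, hAo', Matrix.mul_one]

/-- This is positive definiteness of `R(S - r)`, for the reflection `R` and the symmetric part `S`.
The sign of `R` on an eigenvector of `S` is read off from it. -/
theorem dotProduct_pos (hA : HasGap r A) {x : Fin n → ℝ} (hx : x ≠ 0) :
    0 < (spectralReflection r A *ᵥ x) ⬝ᵥ (symPart A *ᵥ x - r • x) := by
  have h1 := hA.isPolarPart.2.dotProduct_mulVec_pos hx
  rw [hA.reflection_transpose, star_trivial, ← mulVec_mulVec, hA.dotProduct_reflection, sub_mulVec,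
    smul_mulVec, one_mulVec] at h1
  exact h1

theorem symPart_reflection_mulVec (hA : HasGap r A) {x : Fin n → ℝ} {c : ℝ}
    (hx : symPart A *ᵥ x = c • x) :
    symPart A *ᵥ spectralReflection r A *ᵥ x = c • spectralReflection r A *ᵥ x := by
  have h1 := (hA.isPolarPart.of_symmetric (symPart_sub_transpose r A)).2.2
  rw [Matrix.mul_sub, Matrix.sub_mul, mul_smul_comm, smul_mul_assoc, Matrix.mul_one, Matrix.one_mul,
    sub_left_inj] at h1
  rw [mulVec_mulVec, ← h1, ← mulVec_mulVec, hx, mulVec_smul]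

/-- `Rx + x` is fixed by `R` and is again in the `c`-eigenspace of `S`. Were it nonzero, positivity
would force `c > r`. -/
theorem reflection_mulVec_of_lt (hA : HasGap r A) {x : Fin n → ℝ} {c : ℝ}
    (hx : symPart A *ᵥ x = c • x) (hc : c < r) : spectralReflection r A *ᵥ x = -x := by
  by_contra h0
  have hz : spectralReflection r A *ᵥ x + x ≠ 0 := fun h => h0 (eq_neg_of_add_eq_zero_left h)
  have h1 := hA.dotProduct_pos hz
  have h2 : 0 < (spectralReflection r A *ᵥ x + x) ⬝ᵥ (spectralReflection r A *ᵥ x + x) := by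
    simpa using dotProduct_star_self_pos_iff.2 hz
  rw [mulVec_add, mulVec_add, hA.reflection_mulVec_self, hA.symPart_reflection_mulVec hx, hx,
    ← smul_add, ← sub_smul, add_comm x, dotProduct_smul, smul_eq_mul] at h1
  nlinarith

theorem reflection_mulVec_of_gt (hA : HasGap r A) {x : Fin n → ℝ} {c : ℝ}
    (hx : symPart A *ᵥ x = c • x) (hc : r < c) : spectralReflection r A *ᵥ x = x := by
  by_contra h0
  have hz : spectralReflection r A *ᵥ x - x ≠ 0 := fun h => h0 (sub_eq_zero.1 h)
  have h1 := hA.dotProduct_pos hz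
  have h2 : 0 < (spectralReflection r A *ᵥ x - x) ⬝ᵥ (spectralReflection r A *ᵥ x - x) := by
    simpa using dotProduct_star_self_pos_iff.2 hz
  rw [mulVec_sub, mulVec_sub, hA.reflection_mulVec_self, hA.symPart_reflection_mulVec hx, hx,
    ← smul_sub, ← sub_smul, ← neg_sub (spectralReflection r A *ᵥ x) x, dotProduct_smul,
    neg_dotProduct, smul_eq_mul] at h1
  nlinarith

theorem ne_of_symPart_mulVec (hA : HasGap r A) {x : Fin n → ℝ} {c : ℝ} (hx0 : x ≠ 0)
    (hx : symPart A *ᵥ x = c • x) : c ≠ r := by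
  rintro rfl
  have h1 := hA.dotProduct_pos hx0
  rw [hx, sub_self, dotProduct_zero] at h1
  exact lt_irrefl _ h1

end HasGap

/-! ### Spectral spaces and eigenvectors of the symmetric part -/

theorem SO.dotProduct_mulVec_self (h : SO n) (x : Fin n → ℝ) :
    ((h : Matrix (Fin n) (Fin n) ℝ) *ᵥ x) ⬝ᵥ ((h : Matrix (Fin n) (Fin n) ℝ) *ᵥ x) = x ⬝ᵥ x := by
  rw [dotProduct_mulVec, ← mulVec_transpose, mulVec_mulVec, h.transpose_mul_self, one_mulVec]

theorem dotProduct_symPart (A : Matrix (Fin n) (Fin n) ℝ) (x : Fin n → ℝ) :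
    x ⬝ᵥ symPart A *ᵥ x = x ⬝ᵥ A *ᵥ x := by
  have h1 : x ⬝ᵥ Aᵀ *ᵥ x = x ⬝ᵥ A *ᵥ x := by
    rw [mulVec_transpose, dotProduct_comm, dotProduct_mulVec]
  rw [symPart, smul_mulVec, dotProduct_smul, add_mulVec, dotProduct_add, h1, smul_eq_mul]
  ring

/-- Expand, using `‖hx‖ = ‖x‖` and `x · hx = x · Sx = c ‖x‖²`. It yields `|c| ≤ 1`, and `hx = cx`
when `c = ±1`. -/
theorem SO.dotProduct_sub_smul (h : SO n) {x : Fin n → ℝ} {c : ℝ}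
    (hx : symPart (h : Matrix (Fin n) (Fin n) ℝ) *ᵥ x = c • x) :
    ((h : Matrix (Fin n) (Fin n) ℝ) *ᵥ x - c • x) ⬝ᵥ
      ((h : Matrix (Fin n) (Fin n) ℝ) *ᵥ x - c • x) = (1 - c ^ 2) * (x ⬝ᵥ x) := by
  have h1 := dotProduct_symPart (h : Matrix (Fin n) (Fin n) ℝ) x
  rw [hx, dotProduct_smul, smul_eq_mul] at h1
  have h2 := h.dotProduct_mulVec_self x
  have h3 := dotProduct_comm ((h : Matrix (Fin n) (Fin n) ℝ) *ᵥ x) x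
  simp only [sub_dotProduct, dotProduct_sub, smul_dotProduct, dotProduct_smul, smul_eq_mul]
  rw [h2, h3, ← h1]
  ring

theorem SO.abs_le_one_of_symPart_mulVec (h : SO n) {x : Fin n → ℝ} (hx0 : x ≠ 0) {c : ℝ}
    (hx : symPart (h : Matrix (Fin n) (Fin n) ℝ) *ᵥ x = c • x) : c ∈ Icc (-1 : ℝ) 1 := by
  have h1 := h.dotProduct_sub_smul hx
  have h2 : 0 < x ⬝ᵥ x := by simpa using dotProduct_star_self_pos_iff.2 hx0
  have h3 : 0 ≤ (1 - c ^ 2) * (x ⬝ᵥ x) := by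
    rw [← h1]
    simpa using dotProduct_star_self_nonneg ((h : Matrix (Fin n) (Fin n) ℝ) *ᵥ x - c • x)
  have h4 : 0 ≤ 1 - c ^ 2 := nonneg_of_mul_nonneg_left h3 h2
  exact abs_le.1 (abs_le_one_iff_mul_self_le_one.2 (by nlinarith))

theorem vecCplx_apply (v : EuclideanSpace ℝ (Fin n)) : vecCplx n v = fun i => (v.ofLp i : ℂ) := rfl

theorem cplx_mulVec_vecCplx (A : Matrix (Fin n) (Fin n) ℝ) (x : Fin n → ℝ) :
    cplx A *ᵥ (fun i => (x i : ℂ)) = fun i => ((A *ᵥ x) i : ℂ) := by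
  funext i
  simp [mulVec, dotProduct, cplx]

theorem mem_spectralSpace_iff {a b : ℝ} {h : SO n} {v : EuclideanSpace ℝ (Fin n)} :
    v ∈ spectralSpace a b h ↔ vecCplx n v ∈ ⨆ lam ∈ {lam : ℂ | lam.re ∈ Icc a b},
      Module.End.eigenspace (Matrix.toLin' (cplx (h : Matrix (Fin n) (Fin n) ℝ))) lam := Iff.rfl

/-- From `Sx = cx` follows `h²x = 2c hx - x`, so `h` acts on the span of `x, hx` with roots `c ± is`
of `λ² - 2cλ + 1`, where `s² = 1 - c²`. If `s ≠ 0`, then `x` is a combination of `(h - μ)x` for the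
two roots `μ`, and these vectors satisfy the eigenvector equation for the other root. If `s = 0`,
then `hx = cx`. -/
theorem mem_spectralSpace_of_symPart {a b : ℝ} {h : SO n} {x : Fin n → ℝ} {c : ℝ}
    (hx : symPart (h : Matrix (Fin n) (Fin n) ℝ) *ᵥ x = c • x) (hc : c ∈ Icc a b) :
    WithLp.toLp 2 x ∈ spectralSpace a b h := by
  by_cases hx0 : x = 0
  · subst hx0
    exact zero_mem _
  set H := (h : Matrix (Fin n) (Fin n) ℝ) with hH
  have hmem : ∀ (lam : ℂ) (u : Fin n → ℂ), lam.re = c → cplx H *ᵥ u = lam • u →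
      u ∈ ⨆ lam ∈ {lam : ℂ | lam.re ∈ Icc a b},
        Module.End.eigenspace (Matrix.toLin' (cplx H)) lam := by
    intro lam u hlam hu
    refine Submodule.mem_iSup_of_mem lam (Submodule.mem_iSup_of_mem ?_ ?_)
    · change lam.re ∈ Icc a b
      rwa [hlam]
    · rw [Module.End.mem_eigenspace_iff, Matrix.toLin'_apply, hu]
  rw [mem_spectralSpace_iff, vecCplx_apply]
  change (fun i => (x i : ℂ)) ∈ _
  set X : Fin n → ℂ := fun i => (x i : ℂ) with hX
  have hc1 := h.abs_le_one_of_symPart_mulVec hx0 hx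
  have hsq : 0 ≤ 1 - c ^ 2 := by nlinarith [hc1.1, hc1.2]
  have hHH : H *ᵥ H *ᵥ x = (2 * c) • H *ᵥ x - x := by
    have h1 : H *ᵥ symPart H *ᵥ x = (2⁻¹ : ℝ) • (H *ᵥ H *ᵥ x + x) := by
      rw [symPart, smul_mulVec, mulVec_smul, add_mulVec, mulVec_add, mulVec_mulVec _ H Hᵀ,
        h.mul_transpose_self, one_mulVec]
    rw [hx, mulVec_smul] at h1
    have h2 : (2 * c) • H *ᵥ x = H *ᵥ H *ᵥ x + x := by
      rw [mul_smul, h1, smul_smul]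
      norm_num
    rw [h2, add_sub_cancel_right]
  have hHHc : cplx H *ᵥ cplx H *ᵥ X = (2 * c : ℂ) • cplx H *ᵥ X - X := by
    rw [hX, cplx_mulVec_vecCplx, cplx_mulVec_vecCplx, hHH]
    funext i
    simp
  obtain ⟨s, hs⟩ : ∃ s : ℝ, s ^ 2 = 1 - c ^ 2 := ⟨_, Real.sq_sqrt hsq⟩
  have heig : ∀ lam mu : ℂ, lam + mu = 2 * c → lam * mu = 1 →
      cplx H *ᵥ (cplx H *ᵥ X - mu • X) = lam • (cplx H *ᵥ X - mu • X) := by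
    intro lam mu h1 h2
    rw [mulVec_sub, mulVec_smul, hHHc, ← h1, smul_sub, smul_smul, h2, one_smul, add_smul]
    abel
  have hsc : (s : ℂ) ^ 2 = 1 - (c : ℂ) ^ 2 := by exact_mod_cast congrArg (fun x : ℝ => (x : ℂ)) hs
  by_cases hs0 : s = 0
  · have h1 : H *ᵥ x - c • x = 0 := by
      rw [← dotProduct_star_self_eq_zero, star_trivial, h.dotProduct_sub_smul hx, ← hs, hs0]
      simp
    refine hmem c X (Complex.ofReal_re c) ?_
    rw [hX, cplx_mulVec_vecCplx, sub_eq_zero.1 h1]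
    funext i
    simp
  · have hsc0 : (s : ℂ) * Complex.I ≠ 0 :=
      mul_ne_zero (by exact_mod_cast hs0) Complex.I_ne_zero
    have h1 := hmem (c + s * Complex.I) _ (by simp) (heig (c + s * Complex.I) (c - s * Complex.I)
      (by ring) (by ring_nf; rw [Complex.I_sq, hsc]; ring))
    have h2 := hmem (c - s * Complex.I) _ (by simp) (heig (c - s * Complex.I) (c + s * Complex.I)
      (by ring) (by ring_nf; rw [Complex.I_sq, hsc]; ring))
    have h3 : X = (2 * (s * Complex.I))⁻¹ • ((cplx H *ᵥ X - (c - s * Complex.I : ℂ) • X) -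
        (cplx H *ᵥ X - (c + s * Complex.I : ℂ) • X)) := by
      rw [sub_sub_sub_cancel_left, ← sub_smul, smul_smul]
      have h4 : (2 * (s * Complex.I))⁻¹ * (c + s * Complex.I - (c - s * Complex.I)) = 1 := by
        rw [show (c + s * Complex.I - (c - s * Complex.I) : ℂ) = 2 * (s * Complex.I) by ring]
        exact inv_mul_cancel₀ (mul_ne_zero two_ne_zero hsc0)
      rw [h4, one_smul]
    rw [h3]
    exact Submodule.smul_mem _ _ (Submodule.sub_mem _ h1 h2)

/-- For a nonzero `w` orthogonality gives `|lam| = 1` and `hᵀw = conj(lam) w`; average with `hw =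
lam w`. -/
theorem SO.symPart_mulVec_of_eigenvector (h : SO n) {w : Fin n → ℂ} {lam : ℂ}
    (hw : cplx (h : Matrix (Fin n) (Fin n) ℝ) *ᵥ w = lam • w) :
    cplx (symPart (h : Matrix (Fin n) (Fin n) ℝ)) *ᵥ w = (lam.re : ℂ) • w := by
  by_cases hw0 : w = 0
  · subst hw0
    simp
  set H := (h : Matrix (Fin n) (Fin n) ℝ) with hH
  have h1 : cplx Hᵀ * cplx H = 1 := by rw [← cplx_mul, h.transpose_mul_self, cplx_one]
  have h2 : lam • cplx Hᵀ *ᵥ w = w := by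
    rw [← mulVec_smul, ← hw, mulVec_mulVec, h1, one_mulVec]
  have h3 : (star lam * lam) • (star w ⬝ᵥ w) = star w ⬝ᵥ w := by
    have h4 : star (cplx H *ᵥ w) ⬝ᵥ (cplx H *ᵥ w) = star w ⬝ᵥ w := by
      rw [dotProduct_mulVec, star_mulVec, cplx_conjTranspose, vecMul_vecMul, h1, vecMul_one]
    rw [hw, star_smul, smul_dotProduct, dotProduct_smul, smul_smul] at h4
    exact h4
  have h5 : star w ⬝ᵥ w ≠ 0 := by
    open scoped ComplexOrder in
    exact fun h0 => hw0 (dotProduct_star_self_eq_zero.1 h0)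
  have h6 : star lam * lam = 1 := by
    rw [smul_eq_mul] at h3
    exact mul_right_cancel₀ h5 (by rw [h3, one_mul])
  have h7 : cplx Hᵀ *ᵥ w = star lam • w := by
    nth_rw 2 [← h2]
    rw [smul_smul, h6, one_smul]
  rw [symPart, cplx_smul, cplx_add, smul_mulVec, add_mulVec, hw, h7, ← add_smul, smul_smul]
  congr 1
  have h8 := Complex.add_conj lam
  rw [Complex.star_def, h8]
  push_cast
  ring

/-- Real subspaces containing the eigenvectors of the symmetric part contain the spectral space. -/
theorem spectralSpace_induction {a b : ℝ} {h : SO n} (W : Submodule ℝ (Fin n → ℝ))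
    (hW : ∀ (x : Fin n → ℝ), ∀ c ∈ Icc a b,
      symPart (h : Matrix (Fin n) (Fin n) ℝ) *ᵥ x = c • x → x ∈ W)
    {v : EuclideanSpace ℝ (Fin n)} (hv : v ∈ spectralSpace a b h) : v.ofLp ∈ W := by
  -- The complexification of `W`. It contains the eigenspaces of `h` in question, since the real and
  -- imaginary parts of an eigenvector are eigenvectors of the symmetric part.
  let W' : Submodule ℂ (Fin n → ℂ) :=
    { carrier := {w | (fun i => (w i).re) ∈ W ∧ (fun i => (w i).im) ∈ W}
      add_mem' := fun {u w} hu hw => ⟨W.add_mem hu.1 hw.1, W.add_mem hu.2 hw.2⟩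
      zero_mem' := ⟨W.zero_mem, W.zero_mem⟩
      smul_mem' := fun z w hw => by
        constructor
        · convert W.sub_mem (W.smul_mem z.re hw.1) (W.smul_mem z.im hw.2) using 1
          funext i
          simp
        · convert W.add_mem (W.smul_mem z.re hw.2) (W.smul_mem z.im hw.1) using 1
          funext i
          simp }
  have h1 : (⨆ lam ∈ {lam : ℂ | lam.re ∈ Icc a b},
      Module.End.eigenspace (Matrix.toLin' (cplx (h : Matrix (Fin n) (Fin n) ℝ))) lam) ≤ W' := by
    refine iSup₂_le fun lam hlam w hw => ?_
    rw [Module.End.mem_eigenspace_iff, Matrix.toLin'_apply] at hw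
    have h2 := h.symPart_mulVec_of_eigenvector hw
    constructor
    · refine hW _ lam.re hlam ?_
      funext i
      rw [← cplx_mulVec_re, h2]
      simp
    · refine hW _ lam.re hlam ?_
      funext i
      rw [← cplx_mulVec_im, h2]
      simp
  have h2 := (h1 (mem_spectralSpace_iff.1 hv)).1
  exact h2

/-- The eigenvalues of the symmetric part are the real parts of those of `h`. The gap becomes
invertibility of one matrix, an open condition suited to the polar decomposition. -/
theorem mem_specGap_iff {r : ℝ} {h : SO n} :
    h ∈ specGap n r ↔ HasGap r (h : Matrix (Fin n) (Fin n) ℝ) := by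
  have h0 : HasGap r (h : Matrix (Fin n) (Fin n) ℝ) ↔ ¬ ∃ x : Fin n → ℝ, x ≠ 0 ∧
      symPart (h : Matrix (Fin n) (Fin n) ℝ) *ᵥ x = r • x := by
    rw [HasGap, Matrix.isUnit_iff_isUnit_det, isUnit_iff_ne_zero, ne_eq,
      ← Matrix.exists_mulVec_eq_zero_iff]
    simp only [sub_mulVec, smul_mulVec, one_mulVec, sub_eq_zero]
  rw [h0]
  constructor
  · rintro hgap ⟨x, hx, hx'⟩
    have h1 := mem_spectralSpace_of_symPart hx' (left_mem_Icc.2 le_rfl)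
    have h2 : (⨆ lam ∈ {lam : ℂ | lam.re ∈ Icc r r},
        Module.End.eigenspace (Matrix.toLin' (cplx (h : Matrix (Fin n) (Fin n) ℝ))) lam) = ⊥ := by
      refine iSup₂_eq_bot.2 fun lam hlam => ?_
      by_contra h3
      refine hgap lam (Module.End.hasEigenvalue_iff.2 h3) ?_
      exact le_antisymm hlam.2 hlam.1
    rw [mem_spectralSpace_iff, h2, Submodule.mem_bot, vecCplx_apply] at h1
    refine hx (funext fun i => ?_)
    exact Complex.ofReal_injective (congrFun h1 i)
  · intro h1 lam hlam hre
    obtain ⟨w, hw, hw'⟩ := isCEigenvalue_iff.1 hlam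
    refine h1 (exists_real_eigenvector hw ?_)
    rw [h.symPart_mulVec_of_eigenvector hw', hre]

theorem exists_eigenbasis {S : Matrix (Fin n) (Fin n) ℝ} (hS : Sᵀ = S) :
    ∃ (b : Module.Basis (Fin n) ℝ (Fin n → ℝ)) (c : Fin n → ℝ), ∀ i, S *ᵥ b i = c i • b i := by
  have hS' : S.IsHermitian := hS
  refine ⟨hS'.eigenvectorBasis.toBasis.map (WithLp.linearEquiv 2 ℝ (Fin n → ℝ)), hS'.eigenvalues,
    fun i => ?_⟩
  simpa using hS'.mulVec_eigenvectorBasis i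

/-- The kernel of `R - e`. -/
def reflectionEigenspace (R : Matrix (Fin n) (Fin n) ℝ) (e : ℝ) : Submodule ℝ (Fin n → ℝ) where
  carrier := {x | R *ᵥ x = e • x}
  add_mem' {x y} hx hy := by
    change R *ᵥ (x + y) = e • (x + y)
    rw [mulVec_add, smul_add, show R *ᵥ x = e • x from hx, show R *ᵥ y = e • y from hy]
  zero_mem' := by
    change R *ᵥ 0 = e • 0
    rw [mulVec_zero, smul_zero]
  smul_mem' c x hx := by
    change R *ᵥ (c • x) = e • (c • x)
    rw [mulVec_smul, show R *ᵥ x = e • x from hx, smul_comm]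

theorem reflection_of_mem_lower {r : ℝ} {h : SO n}
    (hh : HasGap r (h : Matrix (Fin n) (Fin n) ℝ)) {v : EuclideanSpace ℝ (Fin n)}
    (hv : v ∈ spectralSpace (-1) r h) :
    spectralReflection r (h : Matrix (Fin n) (Fin n) ℝ) *ᵥ v.ofLp = -v.ofLp := by
  have h1 := spectralSpace_induction
    (reflectionEigenspace (spectralReflection r (h : Matrix (Fin n) (Fin n) ℝ)) (-1))
    (fun x c hc hx => ?_) hv
  · exact h1.trans (neg_one_smul ℝ _)
  · change _ = (-1 : ℝ) • x
    rw [neg_one_smul]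
    by_cases hx0 : x = 0
    · rw [hx0, mulVec_zero, neg_zero]
    · exact hh.reflection_mulVec_of_lt hx (lt_of_le_of_ne hc.2 (hh.ne_of_symPart_mulVec hx0 hx))

theorem reflection_of_mem_upper {r : ℝ} {h : SO n}
    (hh : HasGap r (h : Matrix (Fin n) (Fin n) ℝ)) {v : EuclideanSpace ℝ (Fin n)}
    (hv : v ∈ spectralSpace r 1 h) :
    spectralReflection r (h : Matrix (Fin n) (Fin n) ℝ) *ᵥ v.ofLp = v.ofLp := by
  have h1 := spectralSpace_induction
    (reflectionEigenspace (spectralReflection r (h : Matrix (Fin n) (Fin n) ℝ)) 1)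
    (fun x c hc hx => ?_) hv
  · exact h1.trans (one_smul ℝ _)
  · change _ = (1 : ℝ) • x
    rw [one_smul]
    by_cases hx0 : x = 0
    · rw [hx0, mulVec_zero]
    · exact hh.reflection_mulVec_of_gt hx
        (lt_of_le_of_ne hc.1 (hh.ne_of_symPart_mulVec hx0 hx).symm)

theorem exists_spectral_decomposition (r : ℝ) (h : SO n) (v : EuclideanSpace ℝ (Fin n)) :
    ∃ x ∈ spectralSpace (-1) r h, ∃ y ∈ spectralSpace r 1 h, v = x + y := by
  obtain ⟨b, c, hb⟩ := exists_eigenbasis (symPart_transpose (h : Matrix (Fin n) (Fin n) ℝ))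
  have h1 : ∀ i, WithLp.toLp 2 (b i) ∈ spectralSpace (-1) r h ⊔ spectralSpace r 1 h := by
    intro i
    have hc := h.abs_le_one_of_symPart_mulVec (b.ne_zero i) (hb i)
    rcases le_total (c i) r with hr | hr
    · exact Submodule.mem_sup_left (mem_spectralSpace_of_symPart (hb i) ⟨hc.1, hr⟩)
    · exact Submodule.mem_sup_right (mem_spectralSpace_of_symPart (hb i) ⟨hr, hc.2⟩)
  have h2 : v ∈ spectralSpace (-1) r h ⊔ spectralSpace r 1 h := by
    have h3 : v = ∑ i, b.repr v.ofLp i • WithLp.toLp 2 (b i) := by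
      refine (WithLp.linearEquiv 2 ℝ (Fin n → ℝ)).injective ?_
      rw [map_sum]
      simp_rw [map_smul]
      exact (b.sum_repr v.ofLp).symm
    rw [h3]
    exact Submodule.sum_mem _ fun i _ => Submodule.smul_mem _ _ (h1 i)
  obtain ⟨x, hx, y, hy, hxy⟩ := Submodule.mem_sup.1 h2
  exact ⟨x, hx, y, hy, hxy.symm⟩

/-- If `R` negates `v`, the upper component `y` of `v` satisfies `y = -y`. From here on the spectral
spaces are handled by matrix identities for `R`. -/
theorem mem_spectralSpace_lower_iff {r : ℝ} {h : SO n}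
    (hh : HasGap r (h : Matrix (Fin n) (Fin n) ℝ)) {v : EuclideanSpace ℝ (Fin n)} :
    v ∈ spectralSpace (-1) r h ↔
      spectralReflection r (h : Matrix (Fin n) (Fin n) ℝ) *ᵥ v.ofLp = -v.ofLp := by
  refine ⟨reflection_of_mem_lower hh, fun hv => ?_⟩
  obtain ⟨x, hx, y, hy, rfl⟩ := exists_spectral_decomposition r h v
  rw [WithLp.ofLp_add, mulVec_add, reflection_of_mem_lower hh hx, reflection_of_mem_upper hh hy,
    neg_add, add_right_inj] at hv
  have hy0 : y = 0 := by
    refine (WithLp.linearEquiv 2 ℝ (Fin n → ℝ)).injective ?_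
    exact self_eq_neg.1 hv
  rw [hy0, add_zero]
  exact hx

theorem mem_spectralSpace_upper_iff {r : ℝ} {h : SO n}
    (hh : HasGap r (h : Matrix (Fin n) (Fin n) ℝ)) {v : EuclideanSpace ℝ (Fin n)} :
    v ∈ spectralSpace r 1 h ↔
      spectralReflection r (h : Matrix (Fin n) (Fin n) ℝ) *ᵥ v.ofLp = v.ofLp := by
  refine ⟨reflection_of_mem_upper hh, fun hv => ?_⟩
  obtain ⟨x, hx, y, hy, rfl⟩ := exists_spectral_decomposition r h v
  rw [WithLp.ofLp_add, mulVec_add, reflection_of_mem_lower hh hx, reflection_of_mem_upper hh hy,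
    add_left_inj] at hv
  have hx0 : x = 0 := by
    refine (WithLp.linearEquiv 2 ℝ (Fin n → ℝ)).injective ?_
    exact neg_eq_self.1 hv
  rw [hx0, zero_add]
  exact hy

theorem inner_eq_dotProduct_ofLp (x y : EuclideanSpace ℝ (Fin n)) :
    inner ℝ x y = x.ofLp ⬝ᵥ y.ofLp := by
  rw [EuclideanSpace.inner_eq_star_dotProduct, star_trivial, dotProduct_comm]

theorem spectralSpace_upper_eq_orthogonal {r : ℝ} {h : SO n}
    (hh : HasGap r (h : Matrix (Fin n) (Fin n) ℝ)) :
    spectralSpace r 1 h = (spectralSpace (-1) r h)ᗮ := by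
  ext v
  rw [mem_spectralSpace_upper_iff hh, Submodule.mem_orthogonal]
  set R := spectralReflection r (h : Matrix (Fin n) (Fin n) ℝ) with hR
  constructor
  · intro hv u hu
    rw [mem_spectralSpace_lower_iff hh] at hu
    rw [inner_eq_dotProduct_ofLp]
    have h1 := hh.dotProduct_reflection u.ofLp v.ofLp
    rw [hu, hv, neg_dotProduct] at h1
    linarith
  · intro hv
    have h1 : WithLp.toLp 2 (v.ofLp - R *ᵥ v.ofLp) ∈ spectralSpace (-1) r h := by
      rw [mem_spectralSpace_lower_iff hh]
      change R *ᵥ (v.ofLp - R *ᵥ v.ofLp) = -(v.ofLp - R *ᵥ v.ofLp)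
      rw [mulVec_sub, hh.reflection_mulVec_self, neg_sub]
    have h2 := hv _ h1
    rw [inner_eq_dotProduct_ofLp] at h2
    change (v.ofLp - R *ᵥ v.ofLp) ⬝ᵥ v.ofLp = 0 at h2
    have h3 : (v.ofLp - R *ᵥ v.ofLp) ⬝ᵥ (v.ofLp - R *ᵥ v.ofLp) = 0 := by
      have h4 : (v.ofLp - R *ᵥ v.ofLp) ⬝ᵥ (R *ᵥ v.ofLp) = -((v.ofLp - R *ᵥ v.ofLp) ⬝ᵥ v.ofLp) := by
        rw [hh.dotProduct_reflection, mulVec_sub, hh.reflection_mulVec_self, ← neg_dotProduct,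
          neg_sub]
      rw [dotProduct_sub, h4, h2, neg_zero, sub_zero]
    have h4 : v.ofLp - R *ᵥ v.ofLp = 0 := dotProduct_star_self_eq_zero.1 (by rwa [star_trivial])
    exact (sub_eq_zero.1 h4).symm

/-- The spectrum of the symmetric part is finite, so it avoids `(a, r]` for `r` slightly above `a`.
The last clause, with `a = -1`, makes the lower space the eigenspace of `-1`. -/
theorem SO.exists_gap_near (h : SO n) {a b : ℝ} (hab : a < b) :
    ∃ r ∈ Ioo a b, HasGap r (h : Matrix (Fin n) (Fin n) ℝ) ∧
      ∀ c x, x ≠ 0 → symPart (h : Matrix (Fin n) (Fin n) ℝ) *ᵥ x = c • x → c ≤ r → c ≤ a := by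
  set S := symPart (h : Matrix (Fin n) (Fin n) ℝ)
  have hfin : (spectrum ℝ S \ {a}).Finite := (Matrix.finite_real_spectrum (𝕜 := ℝ)).sdiff
  have hspec : ∀ c x, x ≠ 0 → S *ᵥ x = c • x → c ∈ spectrum ℝ S := by
    intro c x hx hcx hu
    have h1 : (algebraMap ℝ (Matrix (Fin n) (Fin n) ℝ) c - S) *ᵥ x = 0 := by
      rw [Algebra.algebraMap_eq_smul_one, sub_mulVec, smul_mulVec, one_mulVec, hcx, sub_self]
    exact hx ((Matrix.mulVec_injective_iff_isUnit.2 hu) (by rw [h1, mulVec_zero]))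
  have h1 : (spectrum ℝ S \ {a})ᶜ ∈ 𝓝 a := hfin.isClosed.isOpen_compl.mem_nhds (by simp)
  obtain ⟨ε, hε, hball⟩ := Metric.mem_nhds_iff.1 h1
  set r := a + min ε (b - a) / 2
  have hm : 0 < min ε (b - a) := lt_min hε (sub_pos.2 hab)
  have hm1 : min ε (b - a) ≤ ε := min_le_left _ _
  have hm2 : min ε (b - a) ≤ b - a := min_le_right _ _
  have hnot : ∀ c, a < c → c ≤ r → c ∉ spectrum ℝ S := by
    intro c hac hcr hc
    have h2 : c ∈ Metric.ball a ε → False := fun h2 => hball h2 ⟨hc, hac.ne'⟩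
    refine h2 ?_
    rw [Metric.mem_ball, Real.dist_eq, abs_of_pos (sub_pos.2 hac)]
    simp only [r] at hcr
    linarith
  refine ⟨r, ⟨by simp only [r]; linarith, by simp only [r]; linarith⟩, ?_, ?_⟩
  · have h2 := hnot r (by simp only [r]; linarith) le_rfl
    rw [spectrum.notMem_iff] at h2
    have h3 := h2.neg
    rwa [neg_sub, Algebra.algebraMap_eq_smul_one] at h3
  · intro c x hx hcx hcr
    by_contra! hac
    exact hnot c hac hcr (hspec c x hx hcx)

end SpectralReflection

end

noncomputable section

/-! ### Unitary structures on the negative space of a reflection -/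

section ComplexStructure

variable {n : ℕ}

/-- Take determinants in `Aᵀ(1 + A) = (1 + A)ᵀ`. -/
theorem det_eq_one_of_mem_regularOrthogonal {A : Matrix (Fin n) (Fin n) ℝ} (hA : A ∈ regularOrthogonal n) :
    A.det = 1 := by
  have h1 : Aᵀ * (1 + A) = (1 + A)ᵀ := by
    rw [Matrix.mul_add, Matrix.mul_one, hA.1, transpose_add, transpose_one, add_comm]
  have h2 := congrArg Matrix.det h1
  rw [det_mul, det_transpose, det_transpose] at h2
  exact mul_right_cancel₀ ((Matrix.isUnit_iff_isUnit_det _).1 hA.2).ne_zero (by rw [h2, one_mul])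

/-- If `hRv = -v`, then `hv` and `hᵀv` both equal `-Rv`, so `Sv = -Rv`. The positivity in
`dotProduct_pos` becomes `-‖v‖² - r (Rv · v) > 0`, contradicting Cauchy-Schwarz for `|r| ≤ 1`. -/
theorem HasGap.mul_reflection_mem_regularOrthogonal {r : ℝ} {h : SO n} (hr : r ∈ Icc (-1 : ℝ) 1)
    (hh : HasGap r (h : Matrix (Fin n) (Fin n) ℝ)) :
    (h : Matrix (Fin n) (Fin n) ℝ) * spectralReflection r (h : Matrix (Fin n) (Fin n) ℝ) ∈
      regularOrthogonal n := by
  set H := (h : Matrix (Fin n) (Fin n) ℝ) with hH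
  set R := spectralReflection r H with hR
  refine ⟨?_, ?_⟩
  · rw [transpose_mul, hh.reflection_transpose, Matrix.mul_assoc, ← Matrix.mul_assoc Hᵀ,
      h.transpose_mul_self, Matrix.one_mul, hh.reflection_mul_self]
  · rw [Matrix.isUnit_iff_isUnit_det, isUnit_iff_ne_zero, ne_eq, ← Matrix.exists_mulVec_eq_zero_iff]
    rintro ⟨v, hv0, hv⟩
    rw [add_mulVec, one_mulVec, ← mulVec_mulVec] at hv
    have h1 : H *ᵥ R *ᵥ v = -v := eq_neg_of_add_eq_zero_right hv
    have h2 : Hᵀ *ᵥ v = -(R *ᵥ v) := by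
      have h3 : Hᵀ *ᵥ H *ᵥ R *ᵥ v = Hᵀ *ᵥ -v := by rw [h1]
      rw [mulVec_mulVec (R *ᵥ v), h.transpose_mul_self, one_mulVec, mulVec_neg] at h3
      rw [h3, neg_neg]
    have h3 : H *ᵥ v = -(R *ᵥ v) := by
      have h4 : R *ᵥ H *ᵥ v = -v := by
        rw [mulVec_mulVec, ← hh.reflection_commute h.mul_transpose_self, ← mulVec_mulVec, h1]
      rw [← hh.reflection_mulVec_self (H *ᵥ v), h4, mulVec_neg]
    have h4 : symPart H *ᵥ v = -(R *ᵥ v) := by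
      rw [symPart, smul_mulVec, add_mulVec, h2, h3, ← two_smul ℝ, smul_smul]
      norm_num
    have h5 := hh.dotProduct_pos hv0
    have hRR : (R *ᵥ v) ⬝ᵥ (R *ᵥ v) = v ⬝ᵥ v := by
      rw [hh.dotProduct_reflection, hh.reflection_mulVec_self]
    have h6 : 0 ≤ (R *ᵥ v + v) ⬝ᵥ (R *ᵥ v + v) := by
      simpa using dotProduct_star_self_nonneg (R *ᵥ v + v)
    have h7 : 0 ≤ (R *ᵥ v - v) ⬝ᵥ (R *ᵥ v - v) := by
      simpa using dotProduct_star_self_nonneg (R *ᵥ v - v)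
    rw [← hR, h4] at h5
    have hc := dotProduct_comm v (R *ᵥ v)
    simp only [dotProduct_sub, dotProduct_neg, dotProduct_smul, smul_eq_mul, add_dotProduct,
      sub_dotProduct, dotProduct_add, hRR, hc] at h5 h6 h7
    obtain ⟨hr1, hr2⟩ := hr
    nlinarith

theorem HasGap.det_reflection {r : ℝ} {h : SO n} (hr : r ∈ Icc (-1 : ℝ) 1)
    (hh : HasGap r (h : Matrix (Fin n) (Fin n) ℝ)) :
    (spectralReflection r (h : Matrix (Fin n) (Fin n) ℝ)).det = 1 := by
  have h1 := det_eq_one_of_mem_regularOrthogonal (hh.mul_reflection_mem_regularOrthogonal hr)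
  rwa [det_mul, (mem_specialOrthogonalGroup_iff.1 h.2).2, one_mul] at h1

/-- For a reflection `R`, the matrix `J` is an orthogonal complex structure on the subspace where
`R` is `-1`, and zero where `R` is `1`. -/
structure IsComplexStructure (R J : Matrix (Fin n) (Fin n) ℝ) : Prop where
  transpose : Jᵀ = -J
  mul_self : J * J = -((2⁻¹ : ℝ) • (1 - R))
  reflection_mul : R * J = -J

/-- Determinant `1` makes the multiplicity `2m` of the eigenvalue `-1` even. An orthonormal basis
`B` of that eigenspace transports the standard structure `Matrix.J`, and `B Bᵀ` is the projection
`(1 - R)/2`. -/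
theorem exists_isComplexStructure {R : Matrix (Fin n) (Fin n) ℝ} (hRt : Rᵀ = R) (hRR : R * R = 1)
    (hdet : R.det = 1) : ∃ J, IsComplexStructure R J := by
  have hS : R.IsHermitian := hRt
  set ev := hS.eigenvalues with hev
  set U : Matrix (Fin n) (Fin n) ℝ := (hS.eigenvectorUnitary : Matrix (Fin n) (Fin n) ℝ) with hU
  have hUU : Uᵀ * U = 1 := by
    have h1 := Unitary.coe_star_mul_self hS.eigenvectorUnitary
    rwa [star_eq_conjTranspose, conjTranspose_eq_transpose_of_trivial] at h1
  have hUU' : U * Uᵀ = 1 := mul_eq_one_comm.1 hUU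
  have hspec : R = U * diagonal ev * Uᵀ := by
    have h1 := hS.spectral_theorem
    rw [Unitary.conjStarAlgAut_apply, star_eq_conjTranspose,
      conjTranspose_eq_transpose_of_trivial] at h1
    exact h1
  have hRU : R * U = U * diagonal ev := by
    conv_lhs => rw [hspec]
    rw [Matrix.mul_assoc, hUU, Matrix.mul_one]
  have hev2 : ∀ i, ev i = -1 ∨ ev i = 1 := by
    intro i
    have h1 : diagonal ev * diagonal ev = (1 : Matrix (Fin n) (Fin n) ℝ) := by
      have h2 : diagonal ev = Uᵀ * R * U := by
        rw [Matrix.mul_assoc, hRU, ← Matrix.mul_assoc, hUU, Matrix.one_mul]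
      calc diagonal ev * diagonal ev = Uᵀ * R * (U * Uᵀ) * R * U := by
            rw [h2]; simp only [Matrix.mul_assoc]
        _ = Uᵀ * (R * R) * U := by rw [hUU', Matrix.mul_one, Matrix.mul_assoc Uᵀ]
        _ = 1 := by rw [hRR, Matrix.mul_one, hUU]
    have h2 := congrFun (congrFun h1 i) i
    rw [diagonal_mul_diagonal, diagonal_apply_eq, one_apply_eq] at h2
    rcases mul_self_eq_one_iff.1 h2 with h3 | h3
    · exact Or.inr h3
    · exact Or.inl h3
  set S : Finset (Fin n) := Finset.univ.filter fun i => ev i = -1 with hSdef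
  have heven : Even S.card := by
    have h1 := hS.det_eq_prod_eigenvalues
    rw [hdet] at h1
    have h2 : ∀ i, (hS.eigenvalues i : ℝ) = if ev i = -1 then -1 else 1 := by
      intro i
      rcases hev2 i with h | h
      · rw [if_pos h]; exact h
      · rw [if_neg (by rw [h]; norm_num)]; exact h
    have h3 : (1 : ℝ) = ∏ i, if ev i = -1 then (-1 : ℝ) else 1 := by
      exact h1.trans (Finset.prod_congr rfl fun i _ => h2 i)
    rw [Finset.prod_ite, Finset.prod_const, Finset.prod_const_one, mul_one] at h3
    by_contra hodd
    rw [Nat.not_even_iff_odd] at hodd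
    rw [hodd.neg_one_pow] at h3
    norm_num at h3
  obtain ⟨m, hm⟩ := heven
  have hcard : Fintype.card (Fin m ⊕ Fin m) = Fintype.card S := by
    rw [Fintype.card_sum, Fintype.card_fin, Fintype.card_coe, hm]
  let e : Fin m ⊕ Fin m ≃ S := Fintype.equivOfCardEq hcard
  let B : Matrix (Fin n) (Fin m ⊕ Fin m) ℝ := U.submatrix id fun k => (e k : Fin n)
  have hBB : Bᵀ * B = 1 := by
    ext k l
    have h1 : (Bᵀ * B) k l = (Uᵀ * U) (e k) (e l) := by
      simp only [Matrix.mul_apply, transpose_apply, B, submatrix_apply, id]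
    rw [h1, hUU, one_apply, one_apply]
    simp only [Subtype.coe_inj, EmbeddingLike.apply_eq_iff_eq]
  have hRB : R * B = -B := by
    ext i k
    have h1 : (R * B) i k = (R * U) i (e k) := by
      simp only [Matrix.mul_apply, B, submatrix_apply, id]
    have h2 : ev (e k) = -1 := (Finset.mem_filter.1 (e k).2).2
    rw [h1, hRU, mul_diagonal, h2, mul_neg_one]
    rfl
  have hBB' : B * Bᵀ = (2⁻¹ : ℝ) • (1 - R) := by
    have h1 : (2⁻¹ : ℝ) • (1 - R) = U * diagonal (fun i => if ev i = -1 then (1 : ℝ) else 0) * Uᵀ := by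
      have h2 : diagonal (fun i => if ev i = -1 then (1 : ℝ) else 0) =
          (2⁻¹ : ℝ) • (1 - diagonal ev : Matrix (Fin n) (Fin n) ℝ) := by
        rw [← diagonal_one, diagonal_sub, ← diagonal_smul]
        congr 1
        funext i
        rcases hev2 i with h | h <;> simp [h] <;> norm_num
      rw [h2, mul_smul_comm, smul_mul_assoc, Matrix.mul_sub, Matrix.mul_one, Matrix.sub_mul, hUU',
        ← hspec]
    rw [h1]
    ext i j
    rw [Matrix.mul_apply, Matrix.mul_apply]
    simp only [mul_diagonal, mul_ite, mul_one, mul_zero, ite_mul, zero_mul, transpose_apply, B,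
      submatrix_apply, id]
    rw [e.sum_comp (fun k : S => U i k * U j k), Finset.sum_coe_sort S fun k => U i k * U j k,
      hSdef, Finset.sum_filter]
  refine ⟨B * Matrix.J (Fin m) ℝ * Bᵀ, ?_, ?_, ?_⟩
  · rw [transpose_mul, transpose_mul, transpose_transpose, J_transpose, Matrix.neg_mul,
      Matrix.mul_neg, Matrix.mul_assoc]
  · calc B * Matrix.J (Fin m) ℝ * Bᵀ * (B * Matrix.J (Fin m) ℝ * Bᵀ)
        = B * Matrix.J (Fin m) ℝ * (Bᵀ * B) * Matrix.J (Fin m) ℝ * Bᵀ := by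
          simp only [Matrix.mul_assoc]
      _ = B * (Matrix.J (Fin m) ℝ * Matrix.J (Fin m) ℝ) * Bᵀ := by
          rw [hBB, Matrix.mul_one, Matrix.mul_assoc B]
      _ = -((2⁻¹ : ℝ) • (1 - R)) := by
          rw [J_squared, Matrix.mul_neg, Matrix.mul_one, Matrix.neg_mul, hBB']
  · rw [← Matrix.mul_assoc, ← Matrix.mul_assoc, hRB, Matrix.neg_mul, Matrix.neg_mul]

namespace IsComplexStructure

variable {R J : Matrix (Fin n) (Fin n) ℝ}

theorem neg (hJ : IsComplexStructure R J) : IsComplexStructure R (-J) where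
  transpose := by rw [transpose_neg, hJ.transpose]
  mul_self := by rw [neg_mul_neg, hJ.mul_self]
  reflection_mul := by rw [Matrix.mul_neg, hJ.reflection_mul]

theorem mul_reflection (hJ : IsComplexStructure R J) (hR : Rᵀ = R) : J * R = -J := by
  have h1 := congrArg Matrix.transpose hJ.reflection_mul
  rwa [transpose_mul, transpose_neg, hJ.transpose, hR, Matrix.neg_mul, neg_inj] at h1

theorem mem_so (hJ : IsComplexStructure R J) (t : ℝ) :
    t • J ∈ LieAlgebra.Orthogonal.so (Fin n) ℝ := by
  rw [LieAlgebra.Orthogonal.mem_so, transpose_smul, hJ.transpose, smul_neg]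

/-- Where `R` is `-1`, `x - iJx` satisfies the eigenvector equation of `J` for `i`, so `exp(πJ)`
multiplies it by `e^{iπ} = -1`; its real part is `x`. Where `R` is `1`, `J` vanishes. -/
theorem exp_pi (hJ : IsComplexStructure R J) (hR : Rᵀ = R) (hRR : R * R = 1) :
    NormedSpace.exp (Real.pi • J) = R := by
  refine Matrix.ext_of_mulVec_single fun i => ?_
  set v : Fin n → ℝ := Pi.single i 1
  have hlow : ∀ x : Fin n → ℝ, R *ᵥ x = -x → NormedSpace.exp (Real.pi • J) *ᵥ x = -x := by
    intro x hx
    have hJJ : J *ᵥ J *ᵥ x = -x := by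
      rw [mulVec_mulVec, hJ.mul_self, neg_mulVec, smul_mulVec, sub_mulVec, one_mulVec, hx,
        sub_neg_eq_add, ← two_smul ℝ, smul_smul]
      norm_num
    set w : Fin n → ℂ := fun k => (x k : ℂ) - Complex.I * ((J *ᵥ x) k : ℂ) with hw
    have hwsub : w = (fun k => (x k : ℂ)) - Complex.I • fun k => ((J *ᵥ x) k : ℂ) := rfl
    have h1 : cplx (Real.pi • J) *ᵥ w = (Real.pi * Complex.I : ℂ) • w := by
      rw [cplx_smul, smul_mulVec, hwsub, mulVec_sub, mulVec_smul, cplx_mulVec_vecCplx,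
        cplx_mulVec_vecCplx, hJJ]
      funext k
      simp only [Pi.smul_apply, Pi.sub_apply, smul_eq_mul, Pi.neg_apply, Complex.ofReal_neg]
      linear_combination ((Real.pi : ℂ) * ((J *ᵥ x) k : ℂ)) * Complex.I_mul_I
    have h2 := exp_mulVec_of_mulVec_eq_smul h1
    rw [Complex.exp_pi_mul_I, ← cplx_exp] at h2
    funext k
    have h3 := congrArg Complex.re (congrFun h2 k)
    rw [cplx_mulVec_re] at h3
    have h4 : (fun j => (w j).re) = x := by
      funext j
      simp [hw]
    rw [h4] at h3
    rw [h3]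
    simp [hw]
  have hupp : ∀ y : Fin n → ℝ, R *ᵥ y = y → NormedSpace.exp (Real.pi • J) *ᵥ y = y := by
    intro y hy
    have h0 : J *ᵥ y = 0 := by
      have h1 : J *ᵥ y = -(J *ᵥ y) := by
        conv_lhs => rw [← hy]
        rw [mulVec_mulVec, hJ.mul_reflection hR, neg_mulVec]
      exact self_eq_neg.1 h1
    have h1 : cplx (Real.pi • J) *ᵥ (fun k => (y k : ℂ)) = (0 : ℂ) • fun k => (y k : ℂ) := by
      rw [cplx_mulVec_vecCplx, smul_mulVec, h0, smul_zero, zero_smul]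
      funext k
      simp
    have h2 := exp_mulVec_of_mulVec_eq_smul h1
    rw [Complex.exp_zero, one_smul, ← cplx_exp, cplx_mulVec_vecCplx] at h2
    funext k
    exact Complex.ofReal_injective (congrFun h2 k)
  have hv : v = (2⁻¹ : ℝ) • (v - R *ᵥ v) + (2⁻¹ : ℝ) • (v + R *ᵥ v) := by
    rw [← smul_add, sub_add_add_cancel, ← two_smul ℝ, smul_smul]
    norm_num
  have hRv : R *ᵥ R *ᵥ v = v := by rw [mulVec_mulVec, hRR, one_mulVec]
  rw [hv, mulVec_add, mulVec_add, hlow, hupp, mulVec_smul, mulVec_smul, mulVec_sub, mulVec_add, hRv,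
    ← smul_neg, neg_sub, add_comm v]
  · rw [mulVec_smul, mulVec_add, hRv, add_comm]
  · rw [mulVec_smul, mulVec_sub, hRv, ← smul_neg, neg_sub]

end IsComplexStructure

end ComplexStructure

end

noncomputable section

/-! ### Smoothness in the two matrix norms -/

section Norms

/-- Applied with identity maps between two norms on the same space, this passes between the
entrywise norm of the definitions and the operator norm used in the analysis. -/
theorem ContDiffOn.of_linearMap {E E' F F' : Type*}
    [NormedAddCommGroup E] [NormedSpace ℝ E] [NormedAddCommGroup E'] [NormedSpace ℝ E']
    [NormedAddCommGroup F] [NormedSpace ℝ F] [NormedAddCommGroup F'] [NormedSpace ℝ F']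
    [FiniteDimensional ℝ E'] [FiniteDimensional ℝ F] (a : E' →ₗ[ℝ] E) (b : F →ₗ[ℝ] F')
    {f : E → F} {S : Set E} (hf : ContDiffOn ℝ ∞ f S) {f' : E' → F'} {S' : Set E'}
    (hS : MapsTo a S' S) (hff : ∀ x, f' x = b (f (a x))) : ContDiffOn ℝ ∞ f' S' := by
  have h1 : f' = fun x => LinearMap.toContinuousLinearMap b
      (f (LinearMap.toContinuousLinearMap a x)) := funext hff
  rw [h1]
  exact (LinearMap.toContinuousLinearMap b).contDiff.comp_contDiffOn
    (hf.comp (LinearMap.toContinuousLinearMap a).contDiff.contDiffOn hS)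

open scoped Matrix.Norms.L2Operator

variable {n : ℕ}

theorem matSmoothOn_iff {f : Matrix (Fin n) (Fin n) ℝ → Matrix (Fin n) (Fin n) ℝ}
    {S : Set (Matrix (Fin n) (Fin n) ℝ)} : MatSmoothOn f S ↔ ContDiffOn ℝ ∞ f S := by
  constructor
  · intro hf
    refine @ContDiffOn.of_linearMap (Matrix (Fin n) (Fin n) ℝ) (Matrix (Fin n) (Fin n) ℝ)
      (Matrix (Fin n) (Fin n) ℝ) (Matrix (Fin n) (Fin n) ℝ) Matrix.normedAddCommGroup
      Matrix.normedSpace _ _ Matrix.normedAddCommGroup Matrix.normedSpace _ _ _ ?_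
      { toFun := id, map_add' := fun _ _ => rfl, map_smul' := fun _ _ => rfl }
      { toFun := id, map_add' := fun _ _ => rfl, map_smul' := fun _ _ => rfl }
      f S hf f S (fun x hx => hx) fun x => rfl
    exact inferInstanceAs (FiniteDimensional ℝ (Matrix (Fin n) (Fin n) ℝ))
  · intro hf
    refine @ContDiffOn.of_linearMap (Matrix (Fin n) (Fin n) ℝ) (Matrix (Fin n) (Fin n) ℝ)
      (Matrix (Fin n) (Fin n) ℝ) (Matrix (Fin n) (Fin n) ℝ) _ _ Matrix.normedAddCommGroup
      Matrix.normedSpace _ _ Matrix.normedAddCommGroup Matrix.normedSpace ?_ _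
      { toFun := id, map_add' := fun _ _ => rfl, map_smul' := fun _ _ => rfl }
      { toFun := id, map_add' := fun _ _ => rfl, map_smul' := fun _ _ => rfl }
      f S hf f S (fun x hx => hx) fun x => rfl
    exact inferInstanceAs (FiniteDimensional ℝ (Matrix (Fin n) (Fin n) ℝ))

theorem matPathSmoothOn_of_contDiffOn
    {f : Matrix (Fin n) (Fin n) ℝ → ℝ → Matrix (Fin n) (Fin n) ℝ}
    {S : Set (Matrix (Fin n) (Fin n) ℝ)}
    (hf : ContDiffOn ℝ ∞ (fun p : Matrix (Fin n) (Fin n) ℝ × ℝ => f p.1 p.2) (S ×ˢ univ)) :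
    MatPathSmoothOn f S := by
  refine @ContDiffOn.of_linearMap (Matrix (Fin n) (Fin n) ℝ × ℝ) (Matrix (Fin n) (Fin n) ℝ × ℝ)
    (Matrix (Fin n) (Fin n) ℝ) (Matrix (Fin n) (Fin n) ℝ) _ _
    (@Prod.normedAddCommGroup _ _ Matrix.normedAddCommGroup _)
    (@Prod.normedSpace ℝ _ _ _ (@NormedAddCommGroup.toSeminormedAddCommGroup _
      Matrix.normedAddCommGroup) _ Matrix.normedSpace _)
    _ _ Matrix.normedAddCommGroup Matrix.normedSpace ?_ _
    { toFun := id, map_add' := fun _ _ => rfl, map_smul' := fun _ _ => rfl }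
    { toFun := id, map_add' := fun _ _ => rfl, map_smul' := fun _ _ => rfl }
    _ _ hf _ _ (fun x hx => hx) fun x => rfl
  exact inferInstanceAs (FiniteDimensional ℝ (Matrix (Fin n) (Fin n) ℝ × ℝ))

end Norms

/-! ### Families of unitary structures -/

section Family

variable {n : ℕ} {r : ℝ} {g h : SO n}

theorem HasGap.projection_eq (hg : HasGap r (g : Matrix (Fin n) (Fin n) ℝ))
    (v : EuclideanSpace ℝ (Fin n)) :
    (((spectralSpace (-1) r g).orthogonalProjectionOnto v : EuclideanSpace ℝ (Fin n))).ofLp =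
      (2⁻¹ : ℝ) • (v.ofLp - spectralReflection r (g : Matrix (Fin n) (Fin n) ℝ) *ᵥ v.ofLp) := by
  set R := spectralReflection r (g : Matrix (Fin n) (Fin n) ℝ) with hR
  have h1 : (spectralSpace (-1) r g).starProjection v =
      WithLp.toLp 2 ((2⁻¹ : ℝ) • (v.ofLp - R *ᵥ v.ofLp)) := by
    refine Submodule.eq_starProjection_of_mem_of_inner_eq_zero ?_ fun w hw => ?_
    · rw [mem_spectralSpace_lower_iff hg, ← hR]
      simp only
      rw [mulVec_smul, mulVec_sub, hg.reflection_mulVec_self, ← smul_neg, neg_sub]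
    · rw [mem_spectralSpace_lower_iff hg, ← hR] at hw
      rw [inner_eq_dotProduct_ofLp]
      have h2 : (v - WithLp.toLp 2 ((2⁻¹ : ℝ) • (v.ofLp - R *ᵥ v.ofLp))).ofLp =
          (2⁻¹ : ℝ) • (v.ofLp + R *ᵥ v.ofLp) := by
        rw [WithLp.ofLp_sub]
        simp only
        module
      have h3 := hg.dotProduct_reflection v.ofLp w.ofLp
      rw [← hR, hw, dotProduct_neg] at h3
      rw [h2, smul_dotProduct, add_dotProduct, ← h3, add_neg_cancel, smul_zero]
  exact congrArg WithLp.ofLp h1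

/-- Up to a factor, the matrix which compares the splittings of `g` and `h`. -/
def comparison (r : ℝ) (A B : Matrix (Fin n) (Fin n) ℝ) : Matrix (Fin n) (Fin n) ℝ :=
  1 + spectralReflection r A * spectralReflection r B

/-- Both sides equal `R_g + R_h`. -/
theorem comparison_mul_reflection (hg : HasGap r (g : Matrix (Fin n) (Fin n) ℝ))
    (hh : HasGap r (h : Matrix (Fin n) (Fin n) ℝ)) :
    comparison r (g : Matrix (Fin n) (Fin n) ℝ) h * spectralReflection r h =
      spectralReflection r g * comparison r (g : Matrix (Fin n) (Fin n) ℝ) h := by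
  rw [comparison, Matrix.add_mul, Matrix.one_mul, Matrix.mul_assoc, hh.reflection_mul_self,
    Matrix.mul_one, Matrix.mul_add, Matrix.mul_one, ← Matrix.mul_assoc, hg.reflection_mul_self,
    Matrix.one_mul, add_comm]

/-- On the lower space of `h` the projection is `M/2`, and `M` intertwines the reflections, so an
invertible `M` restricts to an isomorphism of lower spaces. Conversely, if `Mx = 0`, injectivity on
`x - R_h x` gives `R_h x = x`, hence `R_g x = -x`. By surjectivity `x` is the projection of some `w`
in the lower space of `h`; since `x ⟂ w`, `x · x = x · w = 0`. -/
theorem mem_specGapNear_iff (hg : HasGap r (g : Matrix (Fin n) (Fin n) ℝ)) :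
    h ∈ specGapNear r g ↔ HasGap r (h : Matrix (Fin n) (Fin n) ℝ) ∧
      IsUnit (comparison r (g : Matrix (Fin n) (Fin n) ℝ) h) := by
  rw [specGapNear, mem_ofPred_eq, mem_specGap_iff]
  refine and_congr_right fun hh => ?_
  set M := comparison r (g : Matrix (Fin n) (Fin n) ℝ) h with hM
  have hMR := comparison_mul_reflection hg hh
  have hproj : ∀ v ∈ spectralSpace (-1) r h,
      ((spectralSpace (-1) r g).orthogonalProjectionOnto v : EuclideanSpace ℝ (Fin n)).ofLp =
        (2⁻¹ : ℝ) • M *ᵥ v.ofLp := by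
    intro v hv
    rw [mem_spectralSpace_lower_iff hh] at hv
    rw [hg.projection_eq, hM, comparison, add_mulVec, one_mulVec, ← mulVec_mulVec, hv, mulVec_neg,
      sub_eq_add_neg]
  constructor
  · rintro ⟨hinj, hsurj⟩
    rw [Matrix.isUnit_iff_isUnit_det, isUnit_iff_ne_zero, ne_eq, ← Matrix.exists_mulVec_eq_zero_iff]
    rintro ⟨x, hx0, hx⟩
    set R := spectralReflection r (h : Matrix (Fin n) (Fin n) ℝ) with hR
    have hMRx : M *ᵥ R *ᵥ x = 0 := by
      rw [mulVec_mulVec, hMR, ← mulVec_mulVec, hx, mulVec_zero]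
    have hlow : WithLp.toLp 2 (x - R *ᵥ x) ∈ spectralSpace (-1) r h := by
      rw [mem_spectralSpace_lower_iff hh, ← hR]
      simp only
      rw [mulVec_sub, hh.reflection_mulVec_self, neg_sub]
    have h1 : x - R *ᵥ x = 0 := by
      have h2 : (⟨WithLp.toLp 2 (x - R *ᵥ x), hlow⟩ : spectralSpace (-1) r h) = 0 := by
        refine hinj (Subtype.ext (WithLp.ofLp_injective 2 ?_))
        refine (hproj _ hlow).trans (Eq.trans ?_ (hproj _ (Submodule.zero_mem _)).symm)
        simp only
        rw [mulVec_sub, hx, hMRx, sub_zero, WithLp.ofLp_zero, mulVec_zero]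
      exact congrArg (fun v : spectralSpace (-1) r h => (v : EuclideanSpace ℝ (Fin n)).ofLp) h2
    have hRx : R *ᵥ x = x := (sub_eq_zero.1 h1).symm
    have hgx : WithLp.toLp 2 x ∈ spectralSpace (-1) r g := by
      rw [mem_spectralSpace_lower_iff hg]
      simp only
      rw [hM, comparison, add_mulVec, one_mulVec, ← mulVec_mulVec, ← hR, hRx] at hx
      exact eq_neg_of_add_eq_zero_right hx
    obtain ⟨⟨w, hw⟩, hwx⟩ := hsurj ⟨WithLp.toLp 2 x, hgx⟩
    have h2 := congrArg (fun v : spectralSpace (-1) r g => (v : EuclideanSpace ℝ (Fin n)).ofLp) hwx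
    simp only at h2
    rw [hg.projection_eq] at h2
    rw [mem_spectralSpace_lower_iff hh, ← hR] at hw
    rw [mem_spectralSpace_lower_iff hg] at hgx
    simp only at hgx
    have h3 : x ⬝ᵥ w.ofLp = 0 := by
      have h4 := hh.dotProduct_reflection x w.ofLp
      rw [← hR, hw, hRx, dotProduct_neg] at h4
      exact self_eq_neg.1 h4.symm
    have h4 : x ⬝ᵥ x = 0 := by
      conv_lhs => rw [← h2]
      conv_lhs => arg 1; rw [h2]
      rw [dotProduct_smul, dotProduct_sub, hg.dotProduct_reflection, hgx, neg_dotProduct, h3]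
      simp
    exact hx0 (dotProduct_star_self_eq_zero.1 (by rwa [star_trivial]))
  · intro hu
    have hinj := Matrix.mulVec_injective_iff_isUnit.2 hu
    constructor
    · intro v w hvw
      have h1 := congrArg (fun v : spectralSpace (-1) r g => (v : EuclideanSpace ℝ (Fin n)).ofLp) hvw
      simp only at h1
      rw [hproj _ v.2, hproj _ w.2] at h1
      refine Subtype.ext (WithLp.ofLp_injective 2 (hinj ?_))
      exact smul_right_injective _ (by norm_num : (2⁻¹ : ℝ) ≠ 0) h1
    · intro u
      obtain ⟨w, hw⟩ := (Matrix.mulVec_surjective_iff_isUnit.2 hu) ((2 : ℝ) • (u : EuclideanSpace ℝ (Fin n)).ofLp)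
      simp only at hw
      have hu1 := (mem_spectralSpace_lower_iff hg).1 u.2
      have h1 : WithLp.toLp 2 w ∈ spectralSpace (-1) r h := by
        rw [mem_spectralSpace_lower_iff hh]
        refine hinj ?_
        simp only
        rw [mulVec_mulVec, hMR, ← mulVec_mulVec, hw, mulVec_smul, hu1, mulVec_neg, hw, smul_neg]
      refine ⟨⟨WithLp.toLp 2 w, h1⟩, Subtype.ext (WithLp.ofLp_injective 2 ?_)⟩
      simp only
      rw [hproj _ h1]
      simp only
      rw [hw, smul_smul]
      norm_num

/-- The point is skewness. For `x` in the lower space, `‖J(x + Jx)‖ = ‖x + Jx‖` gives `x · Jx = 0`;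
this extends to all `x` through `x - Rx`, and polarization finishes. -/
theorem isComplexStructure_iff (hh : HasGap r (h : Matrix (Fin n) (Fin n) ℝ))
    {J : Matrix (Fin n) (Fin n) ℝ} :
    (IsUnitaryStructureOn J (spectralSpace (-1) r h) ∧
      ∀ v ∈ spectralSpace r 1 h, Matrix.toEuclideanLin J v = 0) ↔
    IsComplexStructure (spectralReflection r (h : Matrix (Fin n) (Fin n) ℝ)) J := by
  set R := spectralReflection r (h : Matrix (Fin n) (Fin n) ℝ) with hR
  have hRR := hh.reflection_mulVec_self
  rw [← hR] at hRR
  have happ : ∀ v, (Matrix.toEuclideanLin J v).ofLp = J *ᵥ v.ofLp := fun v => rfl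
  have hnorm : ∀ v w : EuclideanSpace ℝ (Fin n), ‖v‖ = ‖w‖ ↔ v.ofLp ⬝ᵥ v.ofLp = w.ofLp ⬝ᵥ w.ofLp := by
    intro v w
    rw [← inner_eq_dotProduct_ofLp, ← inner_eq_dotProduct_ofLp, real_inner_self_eq_norm_sq,
      real_inner_self_eq_norm_sq, sq_eq_sq₀ (norm_nonneg _) (norm_nonneg _)]
  constructor
  · rintro ⟨hu, hz⟩
    have hlow : ∀ x, R *ᵥ x = -x → R *ᵥ J *ᵥ x = -(J *ᵥ x) ∧
        (J *ᵥ x) ⬝ᵥ (J *ᵥ x) = x ⬝ᵥ x ∧ J *ᵥ J *ᵥ x = -x := by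
      intro x hx
      obtain ⟨h1, h2, h3⟩ := hu (WithLp.toLp 2 x) ((mem_spectralSpace_lower_iff hh).2 hx)
      exact ⟨(mem_spectralSpace_lower_iff hh).1 h1, (hnorm _ _).1 h2, congrArg WithLp.ofLp h3⟩
    have hupp : ∀ x, R *ᵥ x = x → J *ᵥ x = 0 := fun x hx =>
      congrArg WithLp.ofLp (hz (WithLp.toLp 2 x) ((mem_spectralSpace_upper_iff hh).2 hx))
    have hm : ∀ x, R *ᵥ (x - R *ᵥ x) = -(x - R *ᵥ x) := fun x => by
      rw [mulVec_sub, hRR, neg_sub]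
    have hp : ∀ x, J *ᵥ (x + R *ᵥ x) = 0 := fun x => hupp _ (by rw [mulVec_add, hRR, add_comm])
    have hJR : ∀ x, J *ᵥ R *ᵥ x = -(J *ᵥ x) := fun x => by
      have h1 := hp x
      rw [mulVec_add] at h1
      exact eq_neg_of_add_eq_zero_right h1
    have hJm : ∀ x, J *ᵥ (x - R *ᵥ x) = (2 : ℝ) • J *ᵥ x := fun x => by
      rw [mulVec_sub, hJR, sub_neg_eq_add, two_smul]
    have hRJ : ∀ x, R *ᵥ J *ᵥ x = -(J *ᵥ x) := fun x => by
      have h1 := (hlow _ (hm x)).1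
      rw [hJm, mulVec_smul, ← smul_neg] at h1
      exact smul_right_injective _ (two_ne_zero (α := ℝ)) h1
    have hJJ : ∀ x, (2 : ℝ) • J *ᵥ J *ᵥ x = -(x - R *ᵥ x) := fun x => by
      rw [← (hlow _ (hm x)).2.2, hJm, mulVec_smul]
    have hxJx : ∀ x, R *ᵥ x = -x → x ⬝ᵥ J *ᵥ x = 0 := fun x hx => by
      have h1 := (hlow (x + J *ᵥ x) (by rw [mulVec_add, hx, hRJ, neg_add])).2.1
      rw [mulVec_add, (hlow x hx).2.2] at h1
      simp only [add_dotProduct, dotProduct_add, dotProduct_neg, neg_dotProduct] at h1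
      have hc := dotProduct_comm x (J *ᵥ x)
      linarith
    have hall : ∀ x, x ⬝ᵥ J *ᵥ x = 0 := fun x => by
      have h1 := hxJx _ (hm x)
      rw [hJm, dotProduct_smul, sub_dotProduct] at h1
      have h2 := hh.dotProduct_reflection x (J *ᵥ x)
      rw [← hR, hRJ, dotProduct_neg] at h2
      rw [← h2, sub_neg_eq_add, smul_eq_mul] at h1
      linarith
    refine ⟨?_, ?_, ?_⟩
    · ext i j
      have h1 := hall (Pi.single i 1 + Pi.single j 1)
      have h2 := hall (Pi.single i 1)
      have h3 := hall (Pi.single j 1)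
      simp only [mulVec_add, add_dotProduct, dotProduct_add, mulVec_single_one, single_one_dotProduct,
        col_apply] at h1 h2 h3
      rw [transpose_apply, Matrix.neg_apply]
      linarith
    · refine Matrix.ext_of_mulVec_single fun i => ?_
      rw [← mulVec_mulVec, neg_mulVec, smul_mulVec, sub_mulVec, one_mulVec]
      refine smul_right_injective _ (two_ne_zero (α := ℝ)) ?_
      simp only
      rw [hJJ, smul_neg, smul_smul]
      norm_num
    · refine Matrix.ext_of_mulVec_single fun i => ?_
      rw [← mulVec_mulVec, neg_mulVec, hRJ]
  · intro hJ
    refine ⟨fun v hv => ?_, fun v hv => ?_⟩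
    · rw [mem_spectralSpace_lower_iff hh, ← hR] at hv
      have hJJ : J *ᵥ J *ᵥ v.ofLp = -v.ofLp := by
        rw [mulVec_mulVec, hJ.mul_self, neg_mulVec, smul_mulVec, sub_mulVec, one_mulVec, hv,
          sub_neg_eq_add, ← two_smul ℝ, smul_smul]
        norm_num
      refine ⟨?_, ?_, WithLp.ofLp_injective 2 hJJ⟩
      · rw [mem_spectralSpace_lower_iff hh, happ, mulVec_mulVec, ← hR, hJ.reflection_mul, neg_mulVec]
      · rw [hnorm, happ, dotProduct_mulVec, ← mulVec_transpose, hJ.transpose, neg_mulVec, hJJ, neg_neg]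
    · rw [mem_spectralSpace_upper_iff hh, ← hR] at hv
      refine WithLp.ofLp_injective 2 ?_
      have h1 : J *ᵥ v.ofLp = -(J *ᵥ v.ofLp) := by
        conv_lhs => rw [← hv]
        rw [mulVec_mulVec, hJ.mul_reflection hh.reflection_transpose, neg_mulVec]
      exact self_eq_neg.1 h1

theorem IsComplexStructure.conj_of_mul_eq {R R' J Q : Matrix (Fin n) (Fin n) ℝ}
    (hJ : IsComplexStructure R J) (hR : Rᵀ = R) (hR' : R'ᵀ = R') (hQ : Qᵀ * Q = 1)
    (hQR : Q * R' = R * Q) : IsComplexStructure R' (Qᵀ * J * Q) := by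
  have hQQ : Q * Qᵀ = 1 := mul_eq_one_comm.1 hQ
  have hRQ : R' * Qᵀ = Qᵀ * R := by
    have h1 := congrArg Matrix.transpose hQR
    rwa [transpose_mul, transpose_mul, hR, hR'] at h1
  refine ⟨?_, ?_, ?_⟩
  · rw [transpose_mul, transpose_mul, transpose_transpose, hJ.transpose, Matrix.neg_mul,
      Matrix.mul_neg, Matrix.mul_assoc]
  · calc Qᵀ * J * Q * (Qᵀ * J * Q) = Qᵀ * (J * (Q * Qᵀ) * J) * Q := by simp only [Matrix.mul_assoc]
      _ = -((2⁻¹ : ℝ) • (1 - R')) := by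
        rw [hQQ, Matrix.mul_one, hJ.mul_self, Matrix.mul_neg, Matrix.neg_mul, mul_smul_comm,
          smul_mul_assoc, Matrix.mul_sub, Matrix.sub_mul, Matrix.mul_one, hQ, ← hRQ,
          Matrix.mul_assoc, hQ, Matrix.mul_one]
  · rw [← Matrix.mul_assoc, ← Matrix.mul_assoc, hRQ, Matrix.mul_assoc Qᵀ, hJ.reflection_mul,
      Matrix.mul_neg, Matrix.neg_mul]

end Family

end

noncomputable section

/-! ### Existence of families of unitary structures, and the sections they define -/

section Section

open scoped Matrix.Norms.L2Operator

variable {n : ℕ} {r : ℝ}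

theorem contDiffAt_spectralReflection {A : Matrix (Fin n) (Fin n) ℝ} (hA : HasGap r A) :
    ContDiffAt ℝ ∞ (spectralReflection r) A := by
  have h1 : ContDiff ℝ ∞ fun X : Matrix (Fin n) (Fin n) ℝ =>
      symPart X - r • (1 : Matrix (Fin n) (Fin n) ℝ) :=
    (contDiff_const_smul (2⁻¹ : ℝ) |>.comp (contDiff_id.add contDiff_matrix_transpose)).sub
      contDiff_const
  exact (contDiffAt_polarPart hA).comp A h1.contDiffAt

theorem continuous_symPart : Continuous (symPart : Matrix (Fin n) (Fin n) ℝ → _) :=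
  (continuous_id.add continuous_id.matrix_transpose).const_smul (2⁻¹ : ℝ)

theorem isOpen_setOf_hasGap (n : ℕ) (r : ℝ) : IsOpen {A : Matrix (Fin n) (Fin n) ℝ | HasGap r A} :=
  Units.isOpen.preimage (continuous_symPart.sub continuous_const)

theorem isOpen_specGapNear {g : SO n} (hg : HasGap r (g : Matrix (Fin n) (Fin n) ℝ)) :
    IsOpen (specGapNear r g) := by
  have h1 : IsOpen ({A : Matrix (Fin n) (Fin n) ℝ | HasGap r A} ∩
      comparison r (g : Matrix (Fin n) (Fin n) ℝ) ⁻¹' {A | IsUnit A}) := by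
    refine ContinuousOn.isOpen_inter_preimage (fun A hA => ?_) (isOpen_setOf_hasGap n r) Units.isOpen
    exact (continuousAt_const.add (continuousAt_const.mul
      (contDiffAt_spectralReflection hA).continuousAt)).continuousWithinAt
  have h2 : specGapNear r g = (fun h : SO n => (h : Matrix (Fin n) (Fin n) ℝ)) ⁻¹'
      ({A : Matrix (Fin n) (Fin n) ℝ | HasGap r A} ∩
        comparison r (g : Matrix (Fin n) (Fin n) ℝ) ⁻¹' {A | IsUnit A}) := by
    ext h
    exact mem_specGapNear_iff hg
  rw [h2]
  exact h1.preimage continuous_subtype_val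

theorem mem_specGapNear_self {g : SO n} (hg : HasGap r (g : Matrix (Fin n) (Fin n) ℝ)) :
    g ∈ specGapNear r g := by
  rw [mem_specGapNear_iff hg]
  refine ⟨hg, ?_⟩
  rw [comparison, hg.reflection_mul_self, one_add_one_eq_two]
  exact (IsUnit.mk0 (2 : ℝ) two_ne_zero).map (algebraMap ℝ (Matrix (Fin n) (Fin n) ℝ))

/-- A structure `Jg` at `g` is transported by the orthogonal part `Q h` of the comparison matrix
`M`. From `R_g M R_h = M` and uniqueness, `Q h` also intertwines the reflections, and it is smooth
in `h`. -/
theorem exists_isUnitaryFamily (hr : r ∈ Icc (-1 : ℝ) 1) {g : SO n}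
    (hg : HasGap r (g : Matrix (Fin n) (Fin n) ℝ)) :
    ∃ J, IsUnitaryFamily r (specGapNear r g) J := by
  obtain ⟨Jg, hJg⟩ := exists_isComplexStructure hg.reflection_transpose hg.reflection_mul_self
    (hg.det_reflection hr)
  set Q : Matrix (Fin n) (Fin n) ℝ → Matrix (Fin n) (Fin n) ℝ :=
    fun X => polarPart (comparison r (g : Matrix (Fin n) (Fin n) ℝ) X) with hQ
  have hstruct : ∀ h ∈ specGapNear r g, IsComplexStructure
      (spectralReflection r (h : Matrix (Fin n) (Fin n) ℝ)) ((Q h)ᵀ * Jg * Q h) := by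
    intro h hh
    obtain ⟨hh, hu⟩ := (mem_specGapNear_iff hg).1 hh
    have hpol := isPolarPart_polarPart hu
    refine hJg.conj_of_mul_eq hg.reflection_transpose hh.reflection_transpose hpol.1 ?_
    have h1 := hpol.mul_mul (U := spectralReflection r (g : Matrix (Fin n) (Fin n) ℝ))
      (V := spectralReflection r (h : Matrix (Fin n) (Fin n) ℝ))
      (by rw [hg.reflection_transpose, hg.reflection_mul_self])
      (by rw [hh.reflection_transpose, hh.reflection_mul_self])
    rw [← comparison_mul_reflection hg hh, Matrix.mul_assoc, hh.reflection_mul_self,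
      Matrix.mul_one] at h1
    have h2 := h1.unique hpol
    change Q h * _ = _ * Q h
    conv_lhs => rw [hQ]; simp only; rw [← h2]
    rw [Matrix.mul_assoc, hh.reflection_mul_self, Matrix.mul_one]
  refine ⟨fun X => (Q X)ᵀ * Jg * Q X, ?_, fun h hh => ?_, fun h hh => ?_⟩
  · rw [matSmoothOn_iff]
    rintro _ ⟨h, hh, rfl⟩
    obtain ⟨hh, hu⟩ := (mem_specGapNear_iff hg).1 hh
    have h1 : ContDiffAt ℝ ∞ Q (h : Matrix (Fin n) (Fin n) ℝ) :=
      (contDiffAt_polarPart hu).comp _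
        (contDiffAt_const.add (contDiffAt_const.mul (contDiffAt_spectralReflection hh)))
    exact (((contDiff_matrix_transpose.contDiffAt.comp _ h1).mul contDiffAt_const).mul
      h1).contDiffWithinAt
  · exact ((isComplexStructure_iff ((mem_specGapNear_iff hg).1 hh).1).2 (hstruct h hh)).1
  · exact ((isComplexStructure_iff ((mem_specGapNear_iff hg).1 hh).1).2 (hstruct h hh)).2

theorem SO.exists_mem_specGap (g : SO n) : ∃ r ∈ Icc (-1 : ℝ) 1, g ∈ specGap n r := by
  obtain ⟨r, hr, hg, -⟩ := g.exists_gap_near (a := -1) (b := 1) (by norm_num)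
  exact ⟨r, Ioo_subset_Icc_self hr, mem_specGap_iff.2 hg⟩

namespace IsUnitaryFamily

variable {U : Set (SO n)} {J : Matrix (Fin n) (Fin n) ℝ → Matrix (Fin n) (Fin n) ℝ}
  {h : SO n}

theorem isComplexStructure (hJ : IsUnitaryFamily r U J) (hU : U ⊆ specGap n r) (hh : h ∈ U) :
    IsComplexStructure (spectralReflection r (h : Matrix (Fin n) (Fin n) ℝ)) (J h) :=
  (isComplexStructure_iff (mem_specGap_iff.1 (hU hh))).1 ⟨hJ.unitary h hh, hJ.zero h hh⟩

theorem exp_pi (hJ : IsUnitaryFamily r U J) (hU : U ⊆ specGap n r) (hh : h ∈ U) :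
    NormedSpace.exp (Real.pi • J h) = spectralReflection r (h : Matrix (Fin n) (Fin n) ℝ) :=
  have hg := mem_specGap_iff.1 (hU hh)
  (hJ.isComplexStructure hU hh).exp_pi hg.reflection_transpose hg.reflection_mul_self

/-- `-J_h` is a complex structure for the same reflection, so `exp(-πJ_h)` is `R_h` as well. In
particular `ε(h)` does not depend on the choice of `J`. -/
theorem twist_eq (hJ : IsUnitaryFamily r U J) (hU : U ⊆ specGap n r) (hh : h ∈ U) :
    twist J h = h * spectralReflection r (h : Matrix (Fin n) (Fin n) ℝ) := by
  have hg := mem_specGap_iff.1 (hU hh)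
  rw [twist, ← smul_neg,
    (hJ.isComplexStructure hU hh).neg.exp_pi hg.reflection_transpose hg.reflection_mul_self]

theorem twist_mem (hJ : IsUnitaryFamily r U J) (hr : r ∈ Icc (-1 : ℝ) 1) (hU : U ⊆ specGap n r)
    (hh : h ∈ U) : twist J h ∈ regularOrthogonal n := by
  rw [hJ.twist_eq hU hh]
  exact (mem_specGap_iff.1 (hU hh)).mul_reflection_mem_regularOrthogonal hr

theorem contDiffOn_sectionPath (hJ : IsUnitaryFamily r U J) (hr : r ∈ Icc (-1 : ℝ) 1)
    (hU : U ⊆ specGap n r) :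
    ContDiffOn ℝ ∞ (fun p : Matrix (Fin n) (Fin n) ℝ × ℝ => sectionPath J p.1 p.2)
      (matSet U ×ˢ univ) := by
  have hs := matSmoothOn_iff.1 hJ.smooth
  have hexp : ContDiff ℝ ∞ (NormedSpace.exp : Matrix (Fin n) (Fin n) ℝ → _) :=
    contDiff_matrix_exp.of_le le_top
  have htw : ContDiffOn ℝ ∞ (twist J) (matSet U) :=
    contDiffOn_id.mul (hexp.comp_contDiffOn (hs.const_smul Real.pi).neg)
  have hlog : ContDiffOn ℝ ∞ (fun X => logZero n (twist J X)) (matSet U) := by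
    -- The logarithm is known to be smooth only within `regularOrthogonal n`, so the twist has to
    -- stay there.
    refine ContDiffOn.comp (t := regularOrthogonal n) (fun A hA => (logZero_spec hA).2) htw ?_
    rintro _ ⟨h, hh, rfl⟩
    exact hJ.twist_mem hr hU hh
  have hmaps : MapsTo Prod.fst (matSet U ×ˢ (univ : Set ℝ)) (matSet U) := fun p hp => hp.1
  have hfst : ContDiffOn ℝ ∞ (Prod.fst : Matrix (Fin n) (Fin n) ℝ × ℝ → _)
      (matSet U ×ˢ (univ : Set ℝ)) := contDiff_fst.contDiffOn
  have hsnd : ContDiffOn ℝ ∞ (Prod.snd : Matrix (Fin n) (Fin n) ℝ × ℝ → _)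
      (matSet U ×ˢ (univ : Set ℝ)) := contDiff_snd.contDiffOn
  exact (hexp.comp_contDiffOn (hsnd.smul (hlog.comp hfst hmaps))).mul
    (hexp.comp_contDiffOn (hsnd.smul ((hs.comp hfst hmaps).const_smul Real.pi)))

theorem continuousOn_sectionPath (hJ : IsUnitaryFamily r U J) (hr : r ∈ Icc (-1 : ℝ) 1)
    (hU : U ⊆ specGap n r) :
    ContinuousOn (fun p : Matrix (Fin n) (Fin n) ℝ × ℝ => sectionPath J p.1 p.2)
      (matSet U ×ˢ univ) :=
  (hJ.contDiffOn_sectionPath hr hU).continuousOn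

end IsUnitaryFamily

end Section

end

noncomputable section

/-! ### Bounded logarithms -/

section Logarithm

variable {n : ℕ}

theorem IsCEigenvalue.of_conj {X Q : Matrix (Fin n) (Fin n) ℝ} (hQ : Qᵀ * Q = 1) {lam : ℂ}
    (h : IsCEigenvalue (Q * X * Qᵀ) lam) : IsCEigenvalue X lam := by
  obtain ⟨v, hv0, hv⟩ := isCEigenvalue_iff.1 h
  have hQQ : cplx Q * cplx Qᵀ = 1 := by rw [← cplx_mul, mul_eq_one_comm.1 hQ, cplx_one]
  have hQQ' : cplx Qᵀ * cplx Q = 1 := by rw [← cplx_mul, hQ, cplx_one]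
  refine isCEigenvalue_iff.2 ⟨cplx Qᵀ *ᵥ v, fun h0 => hv0 ?_, ?_⟩
  · rw [← one_mulVec v, ← hQQ, ← mulVec_mulVec, h0, mulVec_zero]
  · rw [← mulVec_smul, ← hv, cplx_mul, cplx_mul, mulVec_mulVec, mulVec_mulVec, ← Matrix.mul_assoc,
      ← Matrix.mul_assoc, hQQ', Matrix.one_mul]

theorem exp_orthogonal_conj {X Q : Matrix (Fin n) (Fin n) ℝ} (hQ : Qᵀ * Q = 1) :
    NormedSpace.exp (Q * X * Qᵀ) = Q * NormedSpace.exp X * Qᵀ := by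
  have hinv : Q⁻¹ = Qᵀ := Matrix.inv_eq_left_inv hQ
  rw [← hinv]
  exact Matrix.exp_conj Q X (IsUnit.of_mul_eq_one_right _ hQ)

/-- `Q (log E) Qᵀ` lies in `logRange` and has exponential `Q E Qᵀ = E`, so injectivity applies. -/
theorem logZero_commute {E Q : Matrix (Fin n) (Fin n) ℝ} (hE : E ∈ regularOrthogonal n)
    (hQ : Qᵀ * Q = 1) (hQE : Q * E = E * Q) : Q * logZero n E = logZero n E * Q := by
  obtain ⟨⟨h1, h2⟩, -⟩ := logZero_spec hE
  have h3 : Q * logZero n E * Qᵀ ∈ logRange n := by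
    refine ⟨?_, fun lam hlam => h1.2 lam (hlam.of_conj hQ)⟩
    have h4 := (LieAlgebra.Orthogonal.mem_so _ _ _).1 h1.1
    rw [LieAlgebra.Orthogonal.mem_so, transpose_mul, transpose_mul, transpose_transpose, h4,
      Matrix.neg_mul, Matrix.mul_neg, Matrix.mul_assoc]
  have h4 : Q * logZero n E * Qᵀ = logZero n E := by
    refine exp_injOn_logRange h3 h1 ?_
    rw [exp_orthogonal_conj hQ, h2, hQE, Matrix.mul_assoc, mul_eq_one_comm.1 hQ, Matrix.mul_one]
  conv_rhs => rw [← h4]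
  rw [Matrix.mul_assoc, hQ, Matrix.mul_one]

theorem abs_apply_le_one_of_orthogonal {Q : Matrix (Fin n) (Fin n) ℝ} (hQ : Qᵀ * Q = 1)
    (i j : Fin n) : |Q i j| ≤ 1 := by
  have h1 : Q ∈ Matrix.unitaryGroup (Fin n) ℝ := by
    rw [Matrix.mem_unitaryGroup_iff', star_eq_conjTranspose, conjTranspose_eq_transpose_of_trivial]
    exact hQ
  simpa using entry_norm_bound_of_unitary h1 i j

theorem abs_apply_le_of_mem_logRange {X : Matrix (Fin n) (Fin n) ℝ} (hX : X ∈ logRange n)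
    (i j : Fin n) : |X i j| ≤ n * Real.pi := by
  obtain ⟨a, R, hR, ha, hXR, -⟩ := exists_exp_decomposition hX.1
  have h1 : (X i j : ℂ) = ∑ k, (a k * Complex.I) * R k i j := by
    have h2 := congrFun (congrFun hXR i) j
    simpa [cplx, Matrix.sum_apply] using h2
  have h2 : |X i j| = ‖(X i j : ℂ)‖ := by simp
  rw [h2, h1]
  refine (norm_sum_le _ _).trans ?_
  have h3 : ∀ k ∈ Finset.univ, ‖(a k * Complex.I) * R k i j‖ ≤ Real.pi := by
    intro k _
    have h4 := hX.2 _ (ha k)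
    simp only [Complex.mul_im, Complex.ofReal_re, Complex.I_im, mul_one, Complex.ofReal_im,
      Complex.I_re, mul_zero, add_zero] at h4
    have h5 : |a k| ≤ Real.pi := (abs_lt.2 h4).le
    rw [norm_mul, norm_mul, Complex.norm_I, mul_one, Complex.norm_real, Real.norm_eq_abs]
    exact (mul_le_mul h5 (hR k i j) (norm_nonneg _) Real.pi_pos.le).trans_eq (mul_one _)
  refine (Finset.sum_le_card_nsmul _ _ _ h3).trans_eq ?_
  simp

namespace IsComplexStructure

variable {R J : Matrix (Fin n) (Fin n) ℝ}

theorem mul_mul_self (hJ : IsComplexStructure R J) : J * (J * J) = -J := by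
  rw [← Matrix.mul_assoc, hJ.mul_self, Matrix.neg_mul, smul_mul_assoc, Matrix.sub_mul, Matrix.one_mul,
    hJ.reflection_mul, sub_neg_eq_add, ← two_smul ℝ, smul_smul]
  norm_num

/-- `1 + J² + J` is `J` on the lower space and `1` on the upper one. It allows facts about
orthogonal matrices to be used for `J`. -/
theorem transpose_mul_self_one_add (hJ : IsComplexStructure R J) :
    (1 + J * J + J)ᵀ * (1 + J * J + J) = 1 := by
  have h1 : (1 + J * J + J)ᵀ = 1 + J * J - J := by
    rw [transpose_add, transpose_add, transpose_mul, hJ.transpose, transpose_one, neg_mul_neg,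
      sub_eq_add_neg]
  have h2 := hJ.mul_mul_self
  have h3 : J * J * (J * J) = -(J * J) := by
    rw [Matrix.mul_assoc, h2, Matrix.mul_neg]
  have h4 : J * J * J = -J := by rw [Matrix.mul_assoc, h2]
  rw [h1]
  simp only [Matrix.add_mul, Matrix.sub_mul, Matrix.mul_add, Matrix.one_mul, Matrix.mul_one, h2, h3,
    h4]
  abel

theorem abs_apply_le_one (hJ : IsComplexStructure R J) (i j : Fin n) : |J i j| ≤ 1 := by
  set Q := 1 + J * J + J with hQ
  have h1 : Q - Qᵀ = (2 : ℝ) • J := by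
    rw [hQ, transpose_add, transpose_add, transpose_mul, hJ.transpose, transpose_one, neg_mul_neg,
      two_smul]
    abel
  have h2 := congrFun (congrFun h1 i) j
  rw [Matrix.sub_apply, transpose_apply, Matrix.smul_apply, smul_eq_mul] at h2
  have h3 := abs_le.1 (abs_apply_le_one_of_orthogonal hJ.transpose_mul_self_one_add i j)
  have h4 := abs_le.1 (abs_apply_le_one_of_orthogonal hJ.transpose_mul_self_one_add j i)
  rw [← hQ] at h3 h4
  rw [abs_le]
  constructor <;> linarith [h3.1, h3.2, h4.1, h4.2]

/-- `J` is half the difference of the orthogonal matrices `1 + J² ± J`, which both commute with `E`.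
-/
theorem logZero_mul (hJ : IsComplexStructure R J) {E : Matrix (Fin n) (Fin n) ℝ}
    (hE : E ∈ regularOrthogonal n) (hEJ : J * E = E * J) : J * logZero n E = logZero n E * J := by
  have h1 : ∀ K : Matrix (Fin n) (Fin n) ℝ, IsComplexStructure R K → K * E = E * K →
      (1 + K * K + K) * logZero n E = logZero n E * (1 + K * K + K) := fun K hK hKE =>
    logZero_commute hE hK.transpose_mul_self_one_add (by
      rw [Matrix.add_mul, Matrix.add_mul, Matrix.mul_add, Matrix.mul_add, Matrix.one_mul,
        Matrix.mul_one, hKE, Matrix.mul_assoc, hKE, ← Matrix.mul_assoc, hKE, Matrix.mul_assoc])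
  have h2 := h1 J hJ hEJ
  have h3 := h1 (-J) hJ.neg (by rw [Matrix.neg_mul, hEJ, Matrix.mul_neg])
  rw [neg_mul_neg] at h3
  have h4 : (2 : ℝ) • (J * logZero n E) = (2 : ℝ) • (logZero n E * J) := by
    have h5 : (2 : ℝ) • J = (1 + J * J + J) - (1 + J * J + -J) := by
      rw [two_smul]
      abel
    rw [← smul_mul_assoc, ← mul_smul_comm, h5, Matrix.sub_mul, Matrix.mul_sub, h2, h3]
  exact smul_right_injective _ (two_ne_zero (α := ℝ)) h4

end IsComplexStructure

/-- Every element of `SO_n` has a logarithm with uniformly bounded entries. -/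
theorem SO.exists_bounded_log (h : SO n) : ∃ C ∈ LieAlgebra.Orthogonal.so (Fin n) ℝ,
    NormedSpace.exp C = (h : Matrix (Fin n) (Fin n) ℝ) ∧ ∀ i j, |C i j| ≤ (n + 1) * Real.pi := by
  -- With the gap just above `-1` the lower space is the `-1`-eigenspace of `h`. Then `J` commutes
  -- with `h`, hence with `log_0(hR)`, and `log_0(hR) + πJ` is a logarithm of `h`, with entries at
  -- most `nπ + π`.
  obtain ⟨r, ⟨hr1, hr2⟩, hh, hgap⟩ := h.exists_gap_near (a := -1) (b := 1) (by norm_num)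
  have hr : r ∈ Icc (-1 : ℝ) 1 := ⟨hr1.le, hr2.le⟩
  set H := (h : Matrix (Fin n) (Fin n) ℝ) with hH
  set R := spectralReflection r H with hR
  obtain ⟨J, hJ⟩ := exists_isComplexStructure hh.reflection_transpose hh.reflection_mul_self
    (hh.det_reflection hr)
  have hlow : ∀ x : Fin n → ℝ, R *ᵥ x = -x → H *ᵥ x = -x := by
    intro x hx
    have h1 : WithLp.toLp 2 x ∈ spectralSpace (-1) r h := (mem_spectralSpace_lower_iff hh).2 hx
    have h2 := spectralSpace_induction (reflectionEigenspace H (-1)) (fun x c hc hx => ?_) h1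
    · rw [← neg_one_smul ℝ]
      exact h2
    · by_cases hx0 : x = 0
      · subst hx0
        exact zero_mem _
      · have hc1 : c = -1 := le_antisymm (hgap c x hx0 hx hc.2) hc.1
        subst hc1
        have h3 := h.dotProduct_sub_smul hx
        rw [neg_one_sq, sub_self, zero_mul] at h3
        exact sub_eq_zero.1 (dotProduct_star_self_eq_zero.1 (by rwa [star_trivial]))
  have hHJ : H * J = -J := by
    refine Matrix.ext_of_mulVec_single fun i => ?_
    rw [← mulVec_mulVec, neg_mulVec]
    refine hlow _ ?_
    rw [mulVec_mulVec, hJ.reflection_mul, neg_mulVec]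
  have hJH : J * H = -J := by
    have h1 : Hᵀ * J = -J := by
      have h2 : Hᵀ * (H * J) = J := by rw [← Matrix.mul_assoc, h.transpose_mul_self, Matrix.one_mul]
      rw [hHJ, Matrix.mul_neg] at h2
      rw [← h2, neg_neg, h2]
    have h2 := congrArg Matrix.transpose h1
    rw [transpose_mul, transpose_transpose, transpose_neg, hJ.transpose, Matrix.neg_mul, neg_inj] at h2
    exact h2
  have hE := hh.mul_reflection_mem_regularOrthogonal hr
  rw [← hH, ← hR] at hE
  have hEJ : J * (H * R) = H * R * J := by
    rw [← Matrix.mul_assoc, hJH, Matrix.neg_mul, hJ.mul_reflection hh.reflection_transpose,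
      Matrix.mul_assoc, hJ.reflection_mul, Matrix.mul_neg, hHJ]
  obtain ⟨⟨hL1, hL2⟩, -⟩ := logZero_spec hE
  refine ⟨logZero n (H * R) + Real.pi • J, add_mem hL1.1 (hJ.mem_so _), ?_, fun i j => ?_⟩
  · have hcomm : Commute (logZero n (H * R)) (Real.pi • J) := by
      rw [Commute, SemiconjBy, mul_smul_comm, smul_mul_assoc, hJ.logZero_mul hE hEJ]
    rw [Matrix.exp_add_of_commute _ _ hcomm, hL2,
      hJ.exp_pi hh.reflection_transpose hh.reflection_mul_self, Matrix.mul_assoc,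
      hh.reflection_mul_self, Matrix.mul_one]
  · have h1 := abs_apply_le_of_mem_logRange hL1 i j
    have h2 := hJ.abs_apply_le_one i j
    rw [Matrix.add_apply, Matrix.smul_apply, smul_eq_mul]
    refine (abs_add_le _ _).trans ?_
    rw [abs_mul, abs_of_pos Real.pi_pos, add_mul, one_mul]
    exact add_le_add h1 ((mul_le_mul_of_nonneg_left h2 Real.pi_pos.le).trans_eq (mul_one _))

end Logarithm

/-! ### Loops from periodic paths -/

section Loops

variable {n : ℕ}

/-- The paths in `SO_n` of period one. -/
abbrev PeriodicPath (n : ℕ) : Type := {f : C(ℝ, SO n) // ∀ t, f (t + 1) = f t}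

/-- The loop defined by a path of period one. -/
def PeriodicPath.toLoop (f : PeriodicPath n) : C(UnitAddCircle, SO n) where
  toFun := Function.Periodic.lift (f := f.1) f.2
  continuous_toFun := continuous_coinduced_dom.2 f.1.continuous

/-- `ℝ → ℝ/ℤ` is an open quotient map, so its product with an identity is a quotient map and
evaluation descends. -/
theorem PeriodicPath.continuous_toLoop : Continuous (PeriodicPath.toLoop (n := n)) := by
  refine ContinuousMap.continuous_of_continuous_uncurry _ ?_
  have hq : IsOpenQuotientMap (Prod.map id ((↑) : ℝ → UnitAddCircle) :
      PeriodicPath n × ℝ → PeriodicPath n × UnitAddCircle) :=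
    IsOpenQuotientMap.id.prodMap QuotientAddGroup.isOpenQuotientMap_mk
  rw [hq.isQuotientMap.continuous_iff]
  exact continuous_eval.comp (continuous_subtype_val.prodMap continuous_id)

/-- The loop is `exp(-tC) exp(tA) exp(tB)`. Periodicity needs only that `exp B`, not `B`, commutes
with `A`. For division of paths `B = 0`; for the section `A = log_0 ε(h)` and `B = πJ_h`. -/
theorem exists_loop_of_exp_mul_eq {A B C : Matrix (Fin n) (Fin n) ℝ}
    (hA : A ∈ LieAlgebra.Orthogonal.so (Fin n) ℝ) (hB : B ∈ LieAlgebra.Orthogonal.so (Fin n) ℝ)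
    (hC : C ∈ LieAlgebra.Orthogonal.so (Fin n) ℝ)
    (hABC : NormedSpace.exp C = NormedSpace.exp A * NormedSpace.exp B)
    (hcomm : NormedSpace.exp B * A = A * NormedSpace.exp B) {K : ℕ} (hAK : ∀ i j, |A i j| ≤ K)
    (hBK : ∀ i j, |B i j| ≤ K) (hCK : ∀ i j, |C i j| ≤ K) :
    ∃ γ : C(UnitAddCircle, SO n), IsLaurent (n * K) γ ∧
      ∀ t : ℝ, NormedSpace.exp (t • C) * (γ (t : UnitAddCircle) : Matrix (Fin n) (Fin n) ℝ) =
        NormedSpace.exp (t • A) * NormedSpace.exp (t • B) := by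
  set Φ : ℝ → Matrix (Fin n) (Fin n) ℝ := fun t =>
    NormedSpace.exp (t • -C) * NormedSpace.exp (t • A) * NormedSpace.exp (t • B) with hΦ
  have hcont : Continuous Φ :=
    ((continuous_matrix_exp.comp (continuous_id.smul continuous_const)).mul
      (continuous_matrix_exp.comp (continuous_id.smul continuous_const))).mul
      (continuous_matrix_exp.comp (continuous_id.smul continuous_const))
  have hso : ∀ t, Φ t ∈ Matrix.specialOrthogonalGroup (Fin n) ℝ := fun t =>
    mul_mem (mul_mem (exp_mem_SO (Submodule.smul_mem _ t (neg_mem hC)))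
      (exp_mem_SO (Submodule.smul_mem _ t hA))) (exp_mem_SO (Submodule.smul_mem _ t hB))
  have hcomm' : ∀ t : ℝ, NormedSpace.exp B * NormedSpace.exp (t • A) =
      NormedSpace.exp (t • A) * NormedSpace.exp B := by
    intro t
    have hQ : (NormedSpace.exp B)ᵀ * NormedSpace.exp B = 1 := SO.transpose_mul_self ⟨_, exp_mem_SO hB⟩
    have h1 := exp_orthogonal_conj (X := t • A) hQ
    have h2 : NormedSpace.exp B * (t • A) * (NormedSpace.exp B)ᵀ = t • A := by
      rw [mul_smul_comm, hcomm, smul_mul_assoc, Matrix.mul_assoc, mul_eq_one_comm.1 hQ, Matrix.mul_one]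
    rw [h2] at h1
    conv_rhs => rw [h1]
    rw [Matrix.mul_assoc, hQ, Matrix.mul_one]
  have hper : ∀ t, Φ (t + 1) = Φ t := by
    intro t
    have h1 : NormedSpace.exp (-C) * (NormedSpace.exp A * NormedSpace.exp B) = 1 := by
      have h2 := exp_smul_mul_exp_smul_neg 1 C
      rw [one_smul, one_smul] at h2
      rw [← hABC, mul_eq_one_comm.1 h2]
    have hA1 : NormedSpace.exp (t • A) * NormedSpace.exp A =
        NormedSpace.exp A * NormedSpace.exp (t • A) := by
      rw [← exp_add_one_smul, add_comm, add_smul, one_smul, Matrix.exp_add_of_commute]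
      exact (Commute.refl A).smul_right t
    have hB1 : NormedSpace.exp (t • B) * NormedSpace.exp B =
        NormedSpace.exp B * NormedSpace.exp (t • B) := by
      rw [← exp_add_one_smul, add_comm, add_smul, one_smul, Matrix.exp_add_of_commute]
      exact (Commute.refl B).smul_right t
    calc Φ (t + 1) = NormedSpace.exp (t • -C) * NormedSpace.exp (-C) *
          (NormedSpace.exp (t • A) * NormedSpace.exp A) *
            (NormedSpace.exp (t • B) * NormedSpace.exp B) := by
          simp only [hΦ, exp_add_one_smul]
      _ = NormedSpace.exp (t • -C) * NormedSpace.exp (-C) * NormedSpace.exp A *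
          (NormedSpace.exp (t • A) * NormedSpace.exp B) * NormedSpace.exp (t • B) := by
          rw [hA1, hB1]
          simp only [Matrix.mul_assoc]
      _ = NormedSpace.exp (t • -C) *
          (NormedSpace.exp (-C) * (NormedSpace.exp A * NormedSpace.exp B)) *
            NormedSpace.exp (t • A) * NormedSpace.exp (t • B) := by
          rw [← hcomm']
          simp only [Matrix.mul_assoc]
      _ = Φ t := by rw [h1, Matrix.mul_one]
  let f : PeriodicPath n := ⟨⟨fun t => ⟨Φ t, hso t⟩, hcont.subtype_mk _⟩,
    fun t => Subtype.ext (hper t)⟩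
  refine ⟨f.toLoop, ?_, fun t => ?_⟩
  · obtain ⟨w, c, hw, hdec⟩ := exists_exp_mul_decomposition (neg_mem hC) hA hB
    refine isLaurent_of_exp_sum (Φ := Φ) hdec hper (fun p => ?_) fun t => rfl
    obtain ⟨x, y, z, hx, hy, hz, hp⟩ := hw p
    have hx' := hx.norm_le (K := K) (fun i j => by rw [Matrix.neg_apply, abs_neg]; exact hCK i j)
    have hy' := hy.norm_le hAK
    have hz' := hz.norm_le hBK
    rw [norm_mul, Complex.norm_I, mul_one, Complex.norm_real, Real.norm_eq_abs] at hx' hy' hz'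
    rw [hp]
    -- Three eigenvalues of modulus at most `nK` add up to a frequency at most `3nK ≤ 2π · nK`,
    -- hence degree at most `nK`.
    have h1 : |x + y + z| ≤ 3 * (n * K : ℝ) :=
      (abs_add_three x y z).trans (by linarith)
    have h2 : (0 : ℝ) ≤ n * K := by positivity
    push_cast
    nlinarith [Real.pi_gt_three]
  · have h1 := exp_smul_mul_exp_smul_neg t C
    change NormedSpace.exp (t • C) * (NormedSpace.exp (t • -C) * NormedSpace.exp (t • A) *
      NormedSpace.exp (t • B)) = _
    rw [← Matrix.mul_assoc, ← Matrix.mul_assoc, h1, Matrix.one_mul]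

end Loops

end

noncomputable section

/-! ### Division of paths with the same projection -/

section Division

variable {n : ℕ}

/-- The path `t ↦ α(t)⁻¹ β(t)`. -/
def leftQuotient (α β : C(ℝ, SO n)) : C(ℝ, SO n) :=
  (ContinuousMap.comp ⟨fun g : SO n => g⁻¹, continuous_inv⟩ α) * β

theorem leftQuotient_apply (α β : C(ℝ, SO n)) (t : ℝ) : leftQuotient α β t = (α t)⁻¹ * β t := rfl

theorem continuous_leftQuotient :
    Continuous fun p : C(ℝ, SO n) × C(ℝ, SO n) => leftQuotient p.1 p.2 :=
  ((ContinuousMap.continuous_postcomp _).comp continuous_fst).mul continuous_snd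

theorem PpolSO.leftQuotient_periodic {α β : PpolSO n} (h : PpolSO.proj n α = PpolSO.proj n β)
    (t : ℝ) : leftQuotient α.path β.path (t + 1) = leftQuotient α.path β.path t := by
  rw [leftQuotient_apply, leftQuotient_apply, α.path_add_one, β.path_add_one, h]
  group

/-- The loop by which two paths with the same projection differ. -/
def PpolSO.divLoop (α β : PpolSO n) (h : PpolSO.proj n α = PpolSO.proj n β) :
    C(UnitAddCircle, SO n) :=
  PeriodicPath.toLoop ⟨leftQuotient α.path β.path, PpolSO.leftQuotient_periodic h⟩

/-- The quotient is `γ⁻¹ ε δ` with `ε(t) = exp(-tξ) exp(tζ)`, a loop of degree at most `n · max N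
M`. The bound depends only on the pieces, as needed for continuity of division. -/
theorem FactorsAs.isLaurent_divLoop {α β : PpolSO n} (h : PpolSO.proj n α = PpolSO.proj n β)
    {ξ ζ : Matrix (Fin n) (Fin n) ℝ} (hξ : ξ ∈ LieAlgebra.Orthogonal.so (Fin n) ℝ)
    (hζ : ζ ∈ LieAlgebra.Orthogonal.so (Fin n) ℝ) {N M : ℕ} (hξN : ∀ i j, |ξ i j| ≤ N)
    (hζM : ∀ i j, |ζ i j| ≤ M) {γ δ : C(UnitAddCircle, SO n)} (hγ : IsLaurent N γ)
    (hδ : IsLaurent M δ) (hα : FactorsAs α.path ξ γ) (hβ : FactorsAs β.path ζ δ) :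
    IsLaurent (N + n * max N M + M) (PpolSO.divLoop α β h) := by
  have hexp : NormedSpace.exp ξ = NormedSpace.exp ζ * NormedSpace.exp 0 := by
    rw [NormedSpace.exp_zero, Matrix.mul_one, ← α.proj_eq_exp hξ hα, h, β.proj_eq_exp hζ hβ]
  obtain ⟨ε, hε, hεt⟩ := exists_loop_of_exp_mul_eq hζ (zero_mem _) hξ hexp
    (by rw [NormedSpace.exp_zero, Matrix.one_mul, Matrix.mul_one]) (K := max N M)
    (fun i j => (hζM i j).trans (by exact_mod_cast le_max_right N M))
    (fun i j => by simp)
    (fun i j => (hξN i j).trans (by exact_mod_cast le_max_left N M))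
  have h1 : PpolSO.divLoop α β h = γ⁻¹ * ε * δ := by
    ext1 z
    obtain ⟨t, rfl⟩ := QuotientAddGroup.mk_surjective z
    change (α.path t)⁻¹ * β.path t = (γ (t : UnitAddCircle))⁻¹ * ε (t : UnitAddCircle) *
      δ (t : UnitAddCircle)
    rw [inv_mul_eq_iff_eq_mul]
    refine Subtype.ext ?_
    have h2 : (γ (t : UnitAddCircle) : Matrix (Fin n) (Fin n) ℝ) *
        ((γ (t : UnitAddCircle))⁻¹ : SO n) = 1 := by
      rw [← Submonoid.coe_mul, mul_inv_cancel, Submonoid.coe_one]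
    simp only [Submonoid.coe_mul]
    have h3 := hεt t
    rw [smul_zero, NormedSpace.exp_zero, Matrix.mul_one] at h3
    rw [hβ t, hα t, ← h3, ← Matrix.mul_assoc, ← Matrix.mul_assoc,
      Matrix.mul_assoc (NormedSpace.exp (t • ξ)) (γ (t : UnitAddCircle)).1, h2, Matrix.mul_one]
  rw [h1]
  exact (hγ.inv.mul hε).mul hδ

theorem PpolPiece.isLaurent_divLoop {N M : ℕ} (a : PpolPiece n N) (b : PpolPiece n M)
    (h : PpolSO.proj n (PpolPiece.incl n N a) = PpolSO.proj n (PpolPiece.incl n M b)) :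
    IsLaurent (N + n * max N M + M) (PpolSO.divLoop _ _ h) := by
  obtain ⟨-, ξ, hξ, hξN, γ, hγ, hα⟩ := a.2
  obtain ⟨-, ζ, hζ, hζM, δ, hδ, hβ⟩ := b.2
  exact FactorsAs.isLaurent_divLoop h hξ hζ hξN hζM hγ hδ hα hβ

theorem PpolSO.divLoop_mem (α β : PpolSO n) (h : PpolSO.proj n α = PpolSO.proj n β) :
    PpolSO.divLoop α β h ∈ polLoops n := by
  obtain ⟨N, a, rfl⟩ := (PpolSO.isLimitOfPieces n).cover α
  obtain ⟨M, b, rfl⟩ := (PpolSO.isLimitOfPieces n).cover β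
  exact ⟨_, PpolPiece.isLaurent_divLoop a b h⟩

/-- The polynomial loop by which two paths with the same projection differ. -/
def PpolSO.div (α β : PpolSO n) (h : PpolSO.proj n α = PpolSO.proj n β) : LpolSO n :=
  ⟨PpolSO.divLoop α β h, PpolSO.divLoop_mem α β h⟩

theorem PpolSO.div_smul (α β : PpolSO n) (h : PpolSO.proj n α = PpolSO.proj n β) :
    MulOpposite.op (PpolSO.div α β h) • α = β := by
  refine PpolSO.ext (ContinuousMap.ext fun t => ?_)
  change α.path t * ((α.path t)⁻¹ * β.path t) = β.path t
  rw [mul_inv_cancel_left]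

theorem PpolSO.smul_left_injective (α : PpolSO n) {γ δ : LpolSO n}
    (h : MulOpposite.op γ • α = MulOpposite.op δ • α) : γ = δ := by
  refine Subtype.ext (ContinuousMap.ext fun z => ?_)
  obtain ⟨t, rfl⟩ := QuotientAddGroup.mk_surjective z
  have h1 : α.path t * γ.loop (t : UnitAddCircle) = α.path t * δ.loop (t : UnitAddCircle) :=
    congrArg (fun β : PpolSO n => β.path t) h
  exact mul_left_cancel h1

theorem PpolSO.existsUnique_smul (α β : PpolSO n) (h : PpolSO.proj n α = PpolSO.proj n β) :
    ∃! γ : LpolSO n, MulOpposite.op γ • α = β :=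
  ⟨PpolSO.div α β h, PpolSO.div_smul α β h, fun _ hγ =>
    α.smul_left_injective (hγ.trans (PpolSO.div_smul α β h).symm)⟩

/-- Division is continuous for the compact-open topology, and the uniform degree bound keeps it in
one piece of the loop group, from which the inclusion into the limit is continuous. -/
theorem PpolPiece.continuous_div {X : Type*} [TopologicalSpace X] {N M : ℕ}
    {a : X → PpolPiece n N} {b : X → PpolPiece n M} (ha : Continuous a) (hb : Continuous b)
    (h : ∀ x, PpolSO.proj n (PpolPiece.incl n N (a x)) =
      PpolSO.proj n (PpolPiece.incl n M (b x))) :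
    Continuous fun x => PpolSO.div _ _ (h x) := by
  have h1 : Continuous fun x => leftQuotient (a x).1 (b x).1 :=
    continuous_leftQuotient.comp ((continuous_subtype_val.comp ha).prodMk
      (continuous_subtype_val.comp hb))
  have h2 : Continuous fun x => PpolSO.divLoop _ _ (h x) :=
    PeriodicPath.continuous_toLoop.comp
      (h1.subtype_mk fun x => PpolSO.leftQuotient_periodic (h x))
  exact ((LpolSO.isLimitOfPieces n).continuous_incl _).comp
    (h2.subtype_mk fun x => PpolPiece.isLaurent_divLoop _ _ (h x))

/-- The constant path at the identity. -/
def PpolSO.constOne (n : ℕ) : PpolSO n where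
  path := 1
  mem := by
    have h1 : FactorsAs (1 : C(ℝ, SO n)) 0 1 := fun t => by
      rw [smul_zero, NormedSpace.exp_zero]
      exact (Matrix.one_mul _).symm
    exact ⟨h1.mem_Pper (zero_mem _) (IsLaurent.one n), 0, zero_mem _, 1, one_mem _, h1⟩

end Division

/-! ### Local trivializations from local sections -/

section Trivialization

variable {n N : ℕ} {U : Set (SO n)}

/-- A section over `U` with values in one compact piece, extended arbitrarily. -/
def extendSection (σ : U → PpolPiece n N) (α₀ : PpolSO n) (h : SO n) : PpolSO n := by
  classical exact if hh : h ∈ U then PpolPiece.incl n N (σ ⟨h, hh⟩) else α₀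

theorem extendSection_apply (σ : U → PpolPiece n N) (α₀ : PpolSO n) {h : SO n} (hh : h ∈ U) :
    extendSection σ α₀ h = PpolPiece.incl n N (σ ⟨h, hh⟩) := dif_pos hh

theorem continuousOn_extendSection {σ : U → PpolPiece n N} (hσ : Continuous σ) (α₀ : PpolSO n) :
    ContinuousOn (extendSection σ α₀) U := by
  rw [continuousOn_iff_continuous_domRestrict]
  refine (((PpolSO.isLimitOfPieces n).continuous_incl N).comp hσ).congr fun h => ?_
  exact (extendSection_apply σ α₀ h.2).symm

/-- The second component of the local trivialization defined by a local section. -/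
def fibreCoordinate (s : SO n → PpolSO n) (α : PpolSO n) : LpolSO n := by
  classical exact if h : PpolSO.proj n (s (PpolSO.proj n α)) = PpolSO.proj n α then
    PpolSO.div (s (PpolSO.proj n α)) α h else 1

theorem fibreCoordinate_smul {s : SO n → PpolSO n} {α : PpolSO n}
    (h : PpolSO.proj n (s (PpolSO.proj n α)) = PpolSO.proj n α) :
    MulOpposite.op (fibreCoordinate s α) • s (PpolSO.proj n α) = α := by
  rw [fibreCoordinate, dif_pos h, PpolSO.div_smul]

theorem fibreCoordinate_op_smul {s : SO n → PpolSO n} {h : SO n} (hs : PpolSO.proj n (s h) = h)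
    (γ : LpolSO n) : fibreCoordinate s (MulOpposite.op γ • s h) = γ := by
  have h1 : PpolSO.proj n (MulOpposite.op γ • s h) = h := by rw [PpolSO.proj_smul, hs]
  have h2 := fibreCoordinate_smul (s := s) (α := MulOpposite.op γ • s h) (by rw [h1, hs])
  rw [h1] at h2
  exact (s h).smul_left_injective h2

/-- On the piece `M` the coordinate is a division between the pieces `N` and `M`, continuous because
`σ` takes values in the single piece `N`. -/
theorem continuousOn_fibreCoordinate {σ : U → PpolPiece n N} (hU : IsOpen U) (hσ : Continuous σ)
    (α₀ : PpolSO n) (hs : ∀ h : U, PpolSO.proj n (PpolPiece.incl n N (σ h)) = h) :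
    ContinuousOn (fibreCoordinate (extendSection σ α₀)) (PpolSO.proj n ⁻¹' U) := by
  rw [(PpolSO.isLimitOfPieces n).continuousOn_iff (hU.preimage (PpolSO.continuous_proj n))]
  intro M
  rw [continuousOn_iff_continuous_domRestrict]
  have hproj : Continuous fun a : PpolPiece.incl n M ⁻¹' (PpolSO.proj n ⁻¹' U) =>
      (⟨PpolSO.proj n (PpolPiece.incl n M a.1), a.2⟩ : U) :=
    (((PpolSO.continuous_proj n).comp ((PpolSO.isLimitOfPieces n).continuous_incl M)).comp
      continuous_subtype_val).subtype_mk _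
  have heq : ∀ a : PpolPiece.incl n M ⁻¹' (PpolSO.proj n ⁻¹' U), PpolSO.proj n (PpolPiece.incl n N
      (σ ⟨PpolSO.proj n (PpolPiece.incl n M a.1), a.2⟩)) =
      PpolSO.proj n (PpolPiece.incl n M a.1) := fun a => hs _
  refine (PpolPiece.continuous_div (hσ.comp hproj) continuous_subtype_val heq).congr fun a => ?_
  have h1 : extendSection σ α₀ (PpolSO.proj n (PpolPiece.incl n M a.1)) = PpolPiece.incl n N
      (σ ⟨PpolSO.proj n (PpolPiece.incl n M a.1), a.2⟩) := extendSection_apply σ α₀ a.2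
  have h2 := fibreCoordinate_smul (s := extendSection σ α₀) (α := PpolPiece.incl n M a.1)
    (by rw [h1]; exact heq a)
  rw [h1] at h2
  refine PpolSO.smul_left_injective _ (Eq.trans ?_ h2.symm)
  exact PpolSO.div_smul _ _ (heq a)

/-- The local trivialization defined by a local section with values in one compact piece. -/
def sectionTrivialization {σ : U → PpolPiece n N} (hU : IsOpen U) (hσ : Continuous σ)
    (α₀ : PpolSO n) (hs : ∀ h : U, PpolSO.proj n (PpolPiece.incl n N (σ h)) = h) :
    Bundle.Trivialization (LpolSO n) (PpolSO.proj n) where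
  toFun α := (PpolSO.proj n α, fibreCoordinate (extendSection σ α₀) α)
  invFun p := MulOpposite.op p.2 • extendSection σ α₀ p.1
  source := PpolSO.proj n ⁻¹' U
  target := U ×ˢ univ
  map_source' _ hα := ⟨hα, mem_univ _⟩
  map_target' p hp := by
    rw [mem_preimage, PpolSO.proj_smul, extendSection_apply σ α₀ hp.1, hs]
    exact hp.1
  left_inv' α hα := fibreCoordinate_smul (by rw [extendSection_apply σ α₀ hα, hs])
  right_inv' p hp := by
    have h1 : PpolSO.proj n (extendSection σ α₀ p.1) = p.1 := by
      rw [extendSection_apply σ α₀ hp.1, hs]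
    refine Prod.ext ?_ (fibreCoordinate_op_smul h1 p.2)
    simp only
    rw [PpolSO.proj_smul, h1]
  continuousOn_toFun := (PpolSO.continuous_proj n).continuousOn.prodMk
    (continuousOn_fibreCoordinate hU hσ α₀ hs)
  continuousOn_invFun := by
    have := PpolSO.continuousSMul n
    exact (MulOpposite.continuous_op.comp continuous_snd).continuousOn.smul
      ((continuousOn_extendSection hσ α₀).comp continuous_fst.continuousOn fun p hp => hp.1)
  open_source := hU.preimage (PpolSO.continuous_proj n)
  open_target := hU.prod isOpen_univ
  baseSet := U
  open_baseSet := hU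
  source_eq := rfl
  target_eq := rfl
  proj_toFun _ _ := rfl

variable {σ : U → PpolPiece n N} (hU : IsOpen U) (hσ : Continuous σ)
    (α₀ : PpolSO n) (hs : ∀ h : U, PpolSO.proj n (PpolPiece.incl n N (σ h)) = h)

theorem sectionTrivialization_isEquivariant :
    IsEquivariantTrivialization (sectionTrivialization hU hσ α₀ hs) := by
  intro α hα γ
  change fibreCoordinate (extendSection σ α₀) (MulOpposite.op γ • α) =
    fibreCoordinate (extendSection σ α₀) α * γ
  have h1 : PpolSO.proj n (extendSection σ α₀ (PpolSO.proj n α)) = PpolSO.proj n α := by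
    rw [extendSection_apply σ α₀ hα, hs]
  have h2 := fibreCoordinate_smul h1
  conv_lhs => rw [← h2, smul_smul, ← MulOpposite.op_mul]
  exact fibreCoordinate_op_smul h1 _

theorem sectionTrivialization_section {h : SO n} (hh : h ∈ U) :
    sectionTrivialization hU hσ α₀ hs (extendSection σ α₀ h) = (h, 1) := by
  have h1 : PpolSO.proj n (extendSection σ α₀ h) = h := by rw [extendSection_apply σ α₀ hh, hs]
  refine Prod.ext h1 ?_
  have h2 := fibreCoordinate_op_smul h1 1
  rwa [MulOpposite.op_one, one_smul] at h2

end Trivialization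

/-! ### The section defined by a family of unitary structures -/

section FamilySection

variable {n : ℕ} {r : ℝ} {U : Set (SO n)}
  {J : Matrix (Fin n) (Fin n) ℝ → Matrix (Fin n) (Fin n) ℝ}

/-- Dividing `β(h)` by `exp(tC)`, with `C` the bounded logarithm of `h`, leaves a Laurent loop: `R_h
= exp(πJ_h)` commutes with `h`, hence with `log_0 ε(h)`. All bounds are uniform in `h`, so `β` stays
in one compact piece, where joint continuity in `(h, t)` suffices. -/
theorem IsUnitaryFamily.exists_section (hJ : IsUnitaryFamily r U J) (hr : r ∈ Icc (-1 : ℝ) 1)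
    (hU : U ⊆ specGap n r) : ∃ (N : ℕ) (σ : U → PpolPiece n N), Continuous σ ∧
      (∀ h : U, PpolSO.proj n (PpolPiece.incl n N (σ h)) = h) ∧
      ∀ (h : U) (t : ℝ), ((σ h).1 t : Matrix (Fin n) (Fin n) ℝ) = sectionPath J h t := by
  -- An integer bound for `(n + 1)π`, hence for the entries of `C`, `log_0 ε(h)` and `πJ_h`.
  set K : ℕ := (n + 1) * 4 with hK
  have hpi : ((n : ℝ) + 1) * Real.pi ≤ K := by
    rw [hK]
    push_cast
    exact mul_le_mul_of_nonneg_left Real.pi_le_four (by positivity)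
  have hn : (0 : ℝ) ≤ n * Real.pi := by positivity
  have hA : ∀ h ∈ U, logZero n (twist J h) ∈ logRange n ∧
      NormedSpace.exp (logZero n (twist J h)) = twist J h := fun h hh =>
    (logZero_spec (hJ.twist_mem hr hU hh)).1
  have hB : ∀ h ∈ U, Real.pi • J h ∈ LieAlgebra.Orthogonal.so (Fin n) ℝ := fun h hh =>
    (hJ.isComplexStructure hU hh).mem_so _
  have hcont : Continuous fun p : U × ℝ => sectionPath J (p.1 : SO n) p.2 := by
    have h1 := hJ.continuousOn_sectionPath hr hU
    refine h1.comp_continuous (f := fun p : U × ℝ =>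
      (((p.1 : SO n) : Matrix (Fin n) (Fin n) ℝ), p.2)) ?_ fun p => ⟨⟨p.1, p.1.2, rfl⟩, mem_univ _⟩
    exact (continuous_subtype_val.comp (continuous_subtype_val.comp continuous_fst)).prodMk
      continuous_snd
  have hso : ∀ (h : U) (t : ℝ),
      sectionPath J (h : SO n) t ∈ Matrix.specialOrthogonalGroup (Fin n) ℝ := fun h t =>
    mul_mem (exp_mem_SO (Submodule.smul_mem _ t (hA h h.2).1.1))
      (exp_mem_SO (Submodule.smul_mem _ t (hB h h.2)))
  let F : C(U × ℝ, SO n) := ⟨fun p => ⟨sectionPath J (p.1 : SO n) p.2, hso p.1 p.2⟩,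
    hcont.subtype_mk _⟩
  have hfac : ∀ h : U, ∃ C ∈ LieAlgebra.Orthogonal.so (Fin n) ℝ,
      NormedSpace.exp C = ((h : SO n) : Matrix (Fin n) (Fin n) ℝ) ∧ (∀ i j, |C i j| ≤ K) ∧
      ∃ γ, IsLaurent (n * K) γ ∧ FactorsAs (F.curry h) C γ := by
    intro h
    have hg := mem_specGap_iff.1 (hU h.2)
    obtain ⟨C, hC, hCh, hCK⟩ := SO.exists_bounded_log (h : SO n)
    obtain ⟨hA1, hA2⟩ := hA h h.2
    have hCK' : ∀ i j, |C i j| ≤ K := fun i j => (hCK i j).trans hpi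
    obtain ⟨γ, hγ, hγt⟩ := exists_loop_of_exp_mul_eq (K := K) hA1.1 (hB h h.2) hC
      (by
        rw [hCh, hA2, hJ.twist_eq hU h.2, hJ.exp_pi hU h.2, Matrix.mul_assoc,
          hg.reflection_mul_self, Matrix.mul_one])
      (by
        rw [hJ.exp_pi hU h.2]
        refine logZero_commute (hJ.twist_mem hr hU h.2)
          (by rw [hg.reflection_transpose, hg.reflection_mul_self]) ?_
        rw [hJ.twist_eq hU h.2, ← Matrix.mul_assoc,
          ← hg.reflection_commute (h : SO n).mul_transpose_self])
      (fun i j => (abs_apply_le_of_mem_logRange hA1 i j).trans (by linarith [Real.pi_pos]))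
      (fun i j => by
        have h1 := (hJ.isComplexStructure hU h.2).abs_apply_le_one i j
        rw [Matrix.smul_apply, smul_eq_mul, abs_mul, abs_of_pos Real.pi_pos]
        nlinarith [Real.pi_pos])
      hCK'
    exact ⟨C, hC, hCh, hCK', γ, hγ, fun t => (hγt t).symm⟩
  -- The index `(n + 1)K` dominates both the entry bound `K` and the degree bound `nK`.
  have hle1 : K ≤ (n + 1) * K := Nat.le_mul_of_pos_left _ n.succ_pos
  have hle2 : n * K ≤ (n + 1) * K := Nat.mul_le_mul_right _ n.le_succ
  have hmem : ∀ h : U, F.curry h ∈ Pper n ∧ ∃ ξ ∈ LieAlgebra.Orthogonal.so (Fin n) ℝ,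
      (∀ i j, |ξ i j| ≤ ((n + 1) * K : ℕ)) ∧
        ∃ γ, IsLaurent ((n + 1) * K) γ ∧ FactorsAs (F.curry h) ξ γ := by
    intro h
    obtain ⟨C, hC, -, hCK, γ, hγ, hα⟩ := hfac h
    exact ⟨hα.mem_Pper hC hγ, C, hC, fun i j => (hCK i j).trans (by exact_mod_cast hle1), γ,
      hγ.mono hle2, hα⟩
  refine ⟨(n + 1) * K, fun h => ⟨F.curry h, hmem h⟩, F.curry.continuous.subtype_mk _,
    fun h => ?_, fun h t => rfl⟩
  obtain ⟨C, hC, hCh, -, γ, hγ, hα⟩ := hfac h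
  refine Subtype.ext (Eq.trans ?_ hCh)
  exact PpolSO.proj_eq_exp _ hC hα

theorem IsUnitaryFamily.exists_trivialization (hJ : IsUnitaryFamily r U J)
    (hr : r ∈ Icc (-1 : ℝ) 1) (hUo : IsOpen U) (hU : U ⊆ specGap n r) :
    ∃ s : SO n → PpolSO n, ContinuousOn s U ∧ (∀ h ∈ U, PpolSO.proj n (s h) = h) ∧
      (∀ h ∈ U, ∀ t : ℝ,
        ((s h).path t : Matrix (Fin n) (Fin n) ℝ) = sectionPath J h t) ∧
      ∃ e : Bundle.Trivialization (LpolSO n) (PpolSO.proj n),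
        e.baseSet = U ∧ IsEquivariantTrivialization e ∧ ∀ h ∈ U, e (s h) = (h, 1) := by
  obtain ⟨N, σ, hσ, hs, hpath⟩ := hJ.exists_section hr hU
  refine ⟨extendSection σ (PpolSO.constOne n), continuousOn_extendSection hσ _, fun h hh => ?_,
    fun h hh t => ?_, sectionTrivialization hUo hσ (PpolSO.constOne n) hs, rfl,
    sectionTrivialization_isEquivariant hUo hσ _ hs,
    fun h hh => sectionTrivialization_section hUo hσ _ hs hh⟩
  · rw [extendSection_apply σ _ hh, hs]
  · rw [extendSection_apply σ _ hh]
    exact hpath ⟨h, hh⟩ t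

theorem PpolSO.isPrincipalBundle (n : ℕ) : IsPrincipalBundle (LpolSO n) (PpolSO.proj n) where
  isTopologicalGroup := LpolSO.isTopologicalGroup n
  continuousSMul := PpolSO.continuousSMul n
  proj_smul := PpolSO.proj_smul
  existsUnique_smul := PpolSO.existsUnique_smul
  locallyTrivial g := by
    obtain ⟨r, hr, hg⟩ := g.exists_mem_specGap
    have hg' := mem_specGap_iff.1 hg
    obtain ⟨J, hJ⟩ := exists_isUnitaryFamily hr hg'
    obtain ⟨s, -, -, -, e, he, heq, -⟩ :=
      hJ.exists_trivialization hr (isOpen_specGapNear hg') fun h hh => hh.1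
    exact ⟨e, he ▸ mem_specGapNear_self hg', heq⟩

end FamilySection

end

/-! ### The main theorem -/

theorem mainTheorem4 (n : ℕ) :
    -- `η_ξ γ` is mapped to `exp ξ`
    (∀ (α : PpolSO n), ∀ ξ ∈ LieAlgebra.Orthogonal.so (Fin n) ℝ, ∀ γ : LpolSO n,
      FactorsAs α.path ξ γ.loop →
        (PpolSO.proj n α : Matrix (Fin n) (Fin n) ℝ) = NormedSpace.exp ξ) ∧
    -- the projection is a locally trivial principal bundle
    IsPrincipalBundle (LpolSO n) (PpolSO.proj n) ∧
    -- the sets `W_r` cover `SO_n`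
    (∀ g : SO n, ∃ r ∈ Icc (-1 : ℝ) 1, g ∈ specGap n r) ∧
    -- over `W_r` there are the spectral splittings, and near every point of `W_r` a smoothly
    -- varying family of unitary structures
    (∀ r ∈ Icc (-1 : ℝ) 1, ∀ g ∈ specGap n r,
      spectralSpace r 1 g = (spectralSpace (-1) r g)ᗮ ∧
      IsOpen (specGapNear r g) ∧ g ∈ specGapNear r g ∧
      ∃ J, IsUnitaryFamily r (specGapNear r g) J) ∧
    -- every such family gives a smooth local section of the bundle, and an equivariant local
    -- trivialization for which this section is the unit section
    (∀ r ∈ Icc (-1 : ℝ) 1, ∀ U : Set (SO n), IsOpen U → U ⊆ specGap n r →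
      ∀ J, IsUnitaryFamily r U J →
        (∀ h ∈ U, ¬ IsCEigenvalue (twist J h) (-1) ∧
          logZero n (twist J h) ∈ logRange n ∧
          NormedSpace.exp (logZero n (twist J h)) = twist J h) ∧
        MatPathSmoothOn (sectionPath J) (matSet U) ∧
        ∃ s : SO n → PpolSO n, ContinuousOn s U ∧
          (∀ h ∈ U, PpolSO.proj n (s h) = h) ∧
          (∀ h ∈ U, ∀ t : ℝ,
            ((s h).path t : Matrix (Fin n) (Fin n) ℝ) = sectionPath J h t) ∧
          ∃ e : Bundle.Trivialization (LpolSO n) (PpolSO.proj n),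
            e.baseSet = U ∧ IsEquivariantTrivialization e ∧ ∀ h ∈ U, e (s h) = (h, 1)) := by
  refine ⟨fun α ξ hξ γ h => PpolSO.proj_eq_exp α hξ h, PpolSO.isPrincipalBundle n,
    SO.exists_mem_specGap, fun r hr g hg => ?_, fun r hr U hUo hU J hJ => ?_⟩
  · have hg' := mem_specGap_iff.1 hg
    exact ⟨spectralSpace_upper_eq_orthogonal hg', isOpen_specGapNear hg', mem_specGapNear_self hg',
      exists_isUnitaryFamily hr hg'⟩
  · refine ⟨fun h hh => ⟨?_, (logZero_spec (hJ.twist_mem hr hU hh)).1⟩,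
      matPathSmoothOn_of_contDiffOn (hJ.contDiffOn_sectionPath hr hU),
      hJ.exists_trivialization hr hUo hU⟩
    rw [isCEigenvalue_neg_one_iff, not_not]
    exact (hJ.twist_mem hr hU hh).2
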